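/- Let $m\ge 0$ and let $H_0=-\mathrm i\,\sigma_1\frac{\mathrm d}{\mathrm dx}+m\,\sigma_3$, with domain $H^1(\mathbb R;\mathbb C^2)$, be the free Dirac operator in $\mathcal H=L^2(\mathbb R)\otimes\mathbb C^2=L^2(\mathbb R;\mathbb C^2)$, where $\sigma_1=\begin{pmatrix}0&1\\1&0\end{pmatrix}$, $\sigma_3=\begin{pmatrix}1&0\\0&-1\end{pmatrix}$. Let $V=\mathrm i\,\widetilde V$, where $\widetilde V=(\widetilde V_{ij})_{i,j=1}^2$ is a matrix-valued function on $\mathbb R$ with entries $\widetilde V_{ij}\in L^1(\mathbb R)$ and with $\widetilde V(x)\ge 0$ (positive semidefinite) for almost every $x$. Then $$\rho(H_0)=\mathbb C\setminus\big((-\infty,-m]\cup[m,\infty)\big).$$ Let $A=|V|^{1/2}$ and $B=U|V|^{1/2}$ be the maximal multiplication operators in $\mathcal H$, where $V(x)=U(x)|V(x)|$ is the polar decomposition, so that $V=BA$. For $z\in\rho(H_0)$ write $R_0(z)=(H_0-z)^{-1}$ and let $\overline{R_0(z)B}$ and $Q(z)=\overline{AR_0(z)B}$ denote the (bounded, everywhere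 defined) closures. There is exactly one closed densely defined extension $H$ of $H_0+V$ such that $$\rho(H)\cap\rho(H_0)=\{z\in\rho(H_0): -1\in\rho(Q(z))\}\neq\emptyset$$ and $$(H-z)^{-1}=R_0(z)-\overline{R_0(z)B}\,(I+Q(z))^{-1}AR_0(z),\qquad z\in\rho(H)\cap\rho(H_0).$$ This operator $H$, the perturbed Dirac operator $H_0+V$, has the following properties. 1. The discrete spectrum $\sigma_{\rm d}(H)$, i.e. the set of eigenvalues of $H$ of finite multiplicity that are isolated points of $\sigma(H)$, is contained in the open upper half plane $\{z\in\mathbb C:\operatorname{Im}z>0\}$. 2. For $z\in\rho(H_0)$ let $\zeta(z)=\dfrac{z+m}{\sqrt{z^2-m^2}}$, where the square root is the branch on $\mathbb C\setminus[0,\infty)$ with positive imaginary part. If $z\in\rho(H_0)$ and $$\operatorname{Re}(\zeta(z))\,\|\widetilde V_{11}\|_{1}+\operatorname{Re}\big(\zeta(z)^{-1}\big)\,\|\widetilde V_{22}\|_{1}<2,$$ then $z\notin\sigma(H)$. 3. If $m=0$ and $\|\widetilde V_{11}\|_{1}+\|\widetilde V_{22}\|_{1}<2$, then $\sigma(H)=\mathbb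 R$. -/

import Mathlib

open MeasureTheory
open scoped Matrix ComplexOrder

noncomputable section

namespace DiracOp

/-! ### Unbounded operators: resolvent set, spectrum, discrete spectrum -/

section Abstract

variable {E : Type*} [NormedAddCommGroup E] [NormedSpace ℂ E]
variable {F : Type*} [NormedAddCommGroup F] [NormedSpace ℂ F]

/-- `R` is the resolvent `(T - z)⁻¹`: a bounded, everywhere defined two-sided inverse of
`T - z : dom T → E`. -/
def IsResolventAt (T : E →ₗ.[ℂ] E) (z : ℂ) (R : E →L[ℂ] E) : Prop :=
  (∀ g : E, ∃ h : R g ∈ T.domain, T ⟨R g, h⟩ - z • R g = g) ∧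
    ∀ f : T.domain, R (T f - z • (f : E)) = f

/-- The resolvent set `ρ(T)`. -/
def resolventSet (T : E →ₗ.[ℂ] E) : Set ℂ :=
  {z | ∃ R : E →L[ℂ] E, IsResolventAt T z R}

/-- The spectrum `σ(T) = ℂ ∖ ρ(T)`. -/
def spectrum (T : E →ₗ.[ℂ] E) : Set ℂ := (resolventSet T)ᶜ

/-- The space `ker ((T - z) ^ n)` (with its natural domain). -/
def genKer (T : E →ₗ.[ℂ] E) (z : ℂ) : ℕ → Submodule ℂ E
  | 0 => ⊥
  | n + 1 => ((genKer T z n).comap (T.toFun - z • T.domain.subtype)).map T.domain.subtype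

/-- The root space of `T` at `z`, i.e. the union of the increasing sequence `ker ((T - z) ^ n)`;
its dimension is the algebraic multiplicity of `z`. -/
def rootSpace (T : E →ₗ.[ℂ] E) (z : ℂ) : Submodule ℂ E := ⨆ n, genKer T z n

/-- `z` is an eigenvalue of `T`. -/
def IsEigenvalue (T : E →ₗ.[ℂ] E) (z : ℂ) : Prop :=
  ∃ f : T.domain, f ≠ 0 ∧ T f = z • (f : E)

/-- The discrete spectrum `σ_d(T)`: the eigenvalues of finite (algebraic) multiplicity that are
isolated points of the spectrum. -/
def discreteSpectrum (T : E →ₗ.[ℂ] E) : Set ℂ :=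
  {z | IsEigenvalue T z ∧ FiniteDimensional ℂ (rootSpace T z) ∧
    ∃ r > 0, ∀ w ∈ spectrum T, dist w z < r → w = z}

/-- `H` is the closed densely defined extension of `H₀ + B A` given by the resolvent formula
`R(z) = R₀(z) - cl(R₀(z) B) (1 + Q(z))⁻¹ A R₀(z)`, `Q(z) = cl(A R₀(z) B)`, for
`z ∈ ρ(H₀) ∩ ρ(H) = {z ∈ ρ(H₀) | -1 ∈ ρ(Q(z))} ≠ ∅`, where `cl` is the (bounded) closure. -/
structure IsFactorizedPerturbation (H₀ : E →ₗ.[ℂ] E) (A : E →ₗ.[ℂ] F) (B : F →ₗ.[ℂ] E)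
    (H : E →ₗ.[ℂ] E) : Prop where
  isClosed : H.IsClosed
  dense_domain : Dense (H.domain : Set E)
  /-- `H` extends `H₀ + B A`, whose domain is `dom H₀ ∩ {f ∈ dom A | A f ∈ dom B}`. -/
  extends_sum : ∀ (f : E) (h₀ : f ∈ H₀.domain) (hA : f ∈ A.domain)
    (hB : A ⟨f, hA⟩ ∈ B.domain),
    ∃ h : f ∈ H.domain, H ⟨f, h⟩ = H₀ ⟨f, h₀⟩ + B ⟨A ⟨f, hA⟩, hB⟩
  /-- Bounded operators defined on the whole space that extend `R₀(z) B` or `A R₀(z) B` are their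
  closures, because these two operators are densely defined. -/
  dense_domain_B : Dense (B.domain : Set F)
  nonempty : (resolventSet H₀ ∩ resolventSet H).Nonempty
  resolvent_formula : ∀ (z : ℂ) (R₀ : E →L[ℂ] E), IsResolventAt H₀ z R₀ →
    ∃ (AR₀ : E →L[ℂ] F) (R₀B : F →L[ℂ] E) (Q : F →L[ℂ] F),
      (∀ f : E, ∃ h : R₀ f ∈ A.domain, A ⟨R₀ f, h⟩ = AR₀ f) ∧
      (∀ f : B.domain, R₀ (B f) = R₀B f) ∧
      (∀ f : B.domain, ∃ h : R₀ (B f) ∈ A.domain, A ⟨R₀ (B f), h⟩ = Q f) ∧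
      (z ∈ resolventSet H ↔ (-1 : ℂ) ∈ _root_.resolventSet ℂ Q) ∧
      ∀ R : E →L[ℂ] E, IsResolventAt H z R →
        R = R₀ - R₀B ∘L Ring.inverse (1 + Q) ∘L AR₀

end Abstract

/-! ### The Hilbert space and the free Dirac operator -/

/-- `ℂ²` with the Euclidean norm. -/
abbrev C2 : Type := EuclideanSpace ℂ (Fin 2)

/-- The Hilbert space `L²(ℝ) ⊗ ℂ² = L²(ℝ; ℂ²)`. -/
abbrev L2 : Type := Lp C2 2 (volume : Measure ℝ)

/-- Complex `2 × 2` matrices. -/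
abbrev Mat : Type := Matrix (Fin 2) (Fin 2) ℂ

/-- The action of a matrix on `ℂ²`. -/
def act (M : Mat) : C2 →L[ℂ] C2 := Matrix.toEuclideanCLM (𝕜 := ℂ) M

/-- `f` belongs to the Sobolev space `H¹(ℝ; ℂ²)` with derivative `g ∈ L²`: it has a locally
absolutely continuous representative `u` with `u' = g` almost everywhere. -/
def HasL2Deriv (f g : L2) : Prop :=
  ∃ u : ℝ → C2, u =ᵐ[volume] f ∧ ∀ a b : ℝ, u b - u a = ∫ t in a..b, g t

theorem locallyIntegrable_coe (g : L2) : LocallyIntegrable (g : ℝ → C2) volume :=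
  (Lp.memLp g).locallyIntegrable (by norm_num)

theorem intervalIntegrable_coe (g : L2) (a b : ℝ) :
    IntervalIntegrable (g : ℝ → C2) volume a b :=
  ((locallyIntegrable_coe g).integrableOn_isCompact isCompact_uIcc).intervalIntegrable

theorem HasL2Deriv.add {f₁ f₂ g₁ g₂ : L2} (h₁ : HasL2Deriv f₁ g₁) (h₂ : HasL2Deriv f₂ g₂) :
    HasL2Deriv (f₁ + f₂) (g₁ + g₂) := by
  obtain ⟨u₁, hu₁, e₁⟩ := h₁
  obtain ⟨u₂, hu₂, e₂⟩ := h₂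
  refine ⟨u₁ + u₂, ?_, fun a b => ?_⟩
  · filter_upwards [hu₁, hu₂, Lp.coeFn_add f₁ f₂] with x h1 h2 h3
    rw [h3, Pi.add_apply, Pi.add_apply, h1, h2]
  · have hae : (∫ t in a..b, (g₁ + g₂ : L2) t) = ∫ t in a..b, (g₁ t + g₂ t) := by
      refine intervalIntegral.integral_congr_ae ?_
      filter_upwards [Lp.coeFn_add g₁ g₂] with x hx _
      rw [hx, Pi.add_apply]
    rw [hae, intervalIntegral.integral_add (intervalIntegrable_coe _ _ _)
      (intervalIntegrable_coe _ _ _), ← e₁, ← e₂]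
    simp only [Pi.add_apply]
    abel

theorem HasL2Deriv.smul {f g : L2} (c : ℂ) (h : HasL2Deriv f g) :
    HasL2Deriv (c • f) (c • g) := by
  obtain ⟨u, hu, e⟩ := h
  refine ⟨c • u, ?_, fun a b => ?_⟩
  · filter_upwards [hu, Lp.coeFn_smul c f] with x h1 h2
    rw [h2, Pi.smul_apply, Pi.smul_apply, h1]
  · have hae : (∫ t in a..b, (c • g : L2) t) = ∫ t in a..b, c • g t := by
      refine intervalIntegral.integral_congr_ae ?_
      filter_upwards [Lp.coeFn_smul c g] with x hx _
      rw [hx, Pi.smul_apply]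
    rw [hae, intervalIntegral.integral_smul, ← e]
    simp only [Pi.smul_apply, smul_sub]

theorem HasL2Deriv.zero : HasL2Deriv 0 0 := by
  refine ⟨0, (Lp.coeFn_zero C2 2 volume).symm, fun a b => ?_⟩
  have hae : (∫ t in a..b, (0 : L2) t) = ∫ _ in a..b, (0 : C2) := by
    refine intervalIntegral.integral_congr_ae ?_
    filter_upwards [Lp.coeFn_zero C2 2 (volume : Measure ℝ)] with x hx _
    rw [hx, Pi.zero_apply]
  rw [hae]
  simp

theorem HasL2Deriv.unique {f g₁ g₂ : L2} (h₁ : HasL2Deriv f g₁) (h₂ : HasL2Deriv f g₂) :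
    g₁ = g₂ := by
  obtain ⟨u₁, hu₁, e₁⟩ := h₁
  obtain ⟨u₂, hu₂, e₂⟩ := h₂
  have hu : u₁ =ᵐ[volume] u₂ := hu₁.trans hu₂.symm
  have key : ∀ (u : ℝ → C2) (g : L2), (∀ a b : ℝ, u b - u a = ∫ t in a..b, g t) →
      Continuous u ∧ ∀ᵐ x, HasDerivAt u (g x) x := by
    intro u g e
    have hfun : u = fun x => u 0 + ∫ t in (0 : ℝ)..x, g t := by
      funext x
      rw [← e 0 x]
      abel
    constructor
    · rw [hfun]
      exact continuous_const.add
        (intervalIntegral.continuous_primitive (intervalIntegrable_coe g) 0)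
    · filter_upwards [LocallyIntegrable.ae_hasDerivAt_integral (locallyIntegrable_coe g)]
        with x hx
      rw [hfun]
      exact (hx 0).const_add (u 0)
  obtain ⟨c₁, d₁⟩ := key u₁ g₁ e₁
  obtain ⟨c₂, d₂⟩ := key u₂ g₂ e₂
  have huu : u₁ = u₂ := (Continuous.ae_eq_iff_eq volume c₁ c₂).1 hu
  refine Lp.ext ?_
  filter_upwards [d₁, d₂] with x h1 h2
  rw [huu] at h1
  exact h1.unique h2

/-- The Sobolev space `H¹(ℝ; ℂ²)`. -/
def sobolevH1 : Submodule ℂ L2 where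
  carrier := {f | ∃ g, HasL2Deriv f g}
  add_mem' := fun ⟨g₁, h₁⟩ ⟨g₂, h₂⟩ => ⟨g₁ + g₂, h₁.add h₂⟩
  zero_mem' := ⟨0, HasL2Deriv.zero⟩
  smul_mem' := fun c _ ⟨g, h⟩ => ⟨c • g, h.smul c⟩

/-- The (unique) derivative of a function in `H¹(ℝ; ℂ²)`. -/
def l2Deriv : sobolevH1 →ₗ[ℂ] L2 where
  toFun f := f.2.choose
  map_add' f g := (f + g).2.choose_spec.unique (f.2.choose_spec.add g.2.choose_spec)
  map_smul' c f := (c • f).2.choose_spec.unique (f.2.choose_spec.smul c)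

def sigma1 : Mat := !![0, 1; 1, 0]

def sigma3 : Mat := !![1, 0; 0, -1]

/-- The free Dirac operator `H₀ = -i σ₁ d/dx + m σ₃` on `H¹(ℝ; ℂ²)`. -/
def freeDirac (m : ℝ) : L2 →ₗ.[ℂ] L2 where
  domain := sobolevH1
  toFun := (-Complex.I) • (((act sigma1).compLpL 2 volume : L2 →L[ℂ] L2) : L2 →ₗ[ℂ] L2) ∘ₗ l2Deriv
    + (m : ℂ) • (((act sigma3).compLpL 2 volume : L2 →L[ℂ] L2) : L2 →ₗ[ℂ] L2) ∘ₗ sobolevH1.subtype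

/-! ### Matrix potentials and the perturbed operator -/

/-- The pointwise product of a matrix function and a vector function. -/
def pmul (M : ℝ → Mat) (f : ℝ → C2) : ℝ → C2 := fun x => act (M x) (f x)

theorem pmul_add (M : ℝ → Mat) (f g : L2) :
    pmul M (f + g : L2) =ᵐ[volume] pmul M f + pmul M g := by
  filter_upwards [Lp.coeFn_add f g] with x hx
  simp only [pmul, Pi.add_apply, hx, map_add]

theorem pmul_smul (M : ℝ → Mat) (c : ℂ) (f : L2) :
    pmul M (c • f : L2) =ᵐ[volume] c • pmul M f := by
  filter_upwards [Lp.coeFn_smul c f] with x hx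
  simp only [pmul, Pi.smul_apply, hx, map_smul]

theorem pmul_zero (M : ℝ → Mat) : pmul M (0 : L2) =ᵐ[volume] 0 := by
  filter_upwards [Lp.coeFn_zero C2 2 (volume : Measure ℝ)] with x hx
  simp only [pmul, hx, Pi.zero_apply, map_zero]

/-- The domain `{f ∈ L² | M f ∈ L²}` of the maximal multiplication operator. -/
def mulDomain (M : ℝ → Mat) : Submodule ℂ L2 where
  carrier := {f | MemLp (pmul M f) 2 volume}
  add_mem' := fun {f g} hf hg =>
    MemLp.ae_eq (pmul_add M f g).symm (MemLp.add (show MemLp _ _ _ from hf) hg)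
  zero_mem' := MemLp.ae_eq (pmul_zero M).symm MemLp.zero
  smul_mem' := fun c {f} hf =>
    MemLp.ae_eq (pmul_smul M c f).symm (MemLp.const_smul (show MemLp _ _ _ from hf) c)

theorem memLp_of_mem {M : ℝ → Mat} {f : L2} (hf : f ∈ mulDomain M) :
    MemLp (pmul M f) 2 volume := hf

/-- The maximal operator of multiplication by the matrix function `M` in `L²(ℝ; ℂ²)`. -/
def mulOp (M : ℝ → Mat) : L2 →ₗ.[ℂ] L2 where
  domain := mulDomain M
  toFun :=
    { toFun := fun f => MemLp.toLp (pmul M (f : L2)) (memLp_of_mem f.2)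
      map_add' := fun f g => (MemLp.toLp_congr (memLp_of_mem (f + g).2)
        ((memLp_of_mem f.2).add (memLp_of_mem g.2)) (pmul_add M f g)).trans
        (MemLp.toLp_add _ _)
      map_smul' := fun c f => (MemLp.toLp_congr (memLp_of_mem (c • f).2)
        ((memLp_of_mem f.2).const_smul c) (pmul_smul M c f)).trans
        (MemLp.toLp_const_smul c _) }

/-- The modulus `|M| = (M* M)^{1/2}`. -/
def matAbs (M : Mat) : Mat := cfc Real.sqrt (Mᴴ * M)

/-- The square root `|M|^{1/2}` of the modulus. -/
def matAbsSqrt (M : Mat) : Mat := cfc Real.sqrt (matAbs M)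

/-- The partial isometry `U` in the polar decomposition `M = U |M|`, given by `M |M|⁻¹` on the
range of `|M|` and by `0` on `ker |M|` (recall `0⁻¹ = 0`). -/
def polarU (M : Mat) : Mat := M * cfc (fun t : ℝ => t⁻¹) (matAbs M)

/-- `H` is the Dirac operator `H₀ + V`: the closed extension of `H₀ + V` obtained from the
factorization `V = B A` with `A = |V|^{1/2}`, `B = U |V|^{1/2}`, `V = U |V|`. -/
def IsDiracOperator (m : ℝ) (V : ℝ → Mat) (H : L2 →ₗ.[ℂ] L2) : Prop :=
  IsFactorizedPerturbation (freeDirac m) (mulOp fun x => matAbsSqrt (V x))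
    (mulOp fun x => polarU (V x) * matAbsSqrt (V x)) H

/-! ### The function `ζ` -/

/-- The branch of the square root on `ℂ ∖ [0, ∞)` with positive imaginary part. -/
def sqrtUpper (w : ℂ) : ℂ := Complex.I * (-w) ^ (1 / 2 : ℂ)

theorem sqrtUpper_sq (w : ℂ) : sqrtUpper w ^ 2 = w := by
  rw [sqrtUpper, mul_pow, Complex.I_sq, one_div, Complex.cpow_ofNat_inv_pow]
  ring

theorem sqrtUpper_im_pos {w : ℂ} (hw : ¬(w.im = 0 ∧ 0 ≤ w.re)) : 0 < (sqrtUpper w).im := by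
  have hs : -w ∈ Complex.slitPlane := by
    rw [Complex.mem_slitPlane_iff]
    by_contra hc
    push Not at hc
    simp only [Complex.neg_re, Complex.neg_im, neg_eq_zero] at hc
    exact hw ⟨hc.2, by linarith [hc.1]⟩
  have h0 : -w ≠ 0 := Complex.slitPlane_ne_zero hs
  have harg : Complex.arg (-w) ≠ Real.pi := Complex.slitPlane_arg_ne_pi hs
  rw [sqrtUpper, Complex.I_mul_im, Complex.cpow_def_of_ne_zero h0, Complex.exp_re]
  refine mul_pos (Real.exp_pos _) (Real.cos_pos_of_mem_Ioo ?_)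
  have him : (Complex.log (-w) * (1 / 2 : ℂ)).im = Complex.arg (-w) / 2 := by
    have : (1 / 2 : ℂ) = ((1 / 2 : ℝ) : ℂ) := by push_cast; rfl
    rw [this, Complex.im_mul_ofReal, Complex.log_im]
    ring
  rw [him]
  constructor
  · linarith [Complex.neg_pi_lt_arg (-w)]
  · linarith [lt_of_le_of_ne (Complex.arg_le_pi (-w)) harg]

/-- `ζ(z) = (z + m) / √(z² - m²)`. -/
def zeta (m : ℝ) (z : ℂ) : ℂ := (z + m) / sqrtUpper (z ^ 2 - (m : ℂ) ^ 2)

end DiracOp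

end

/-!
For `V = i W` with `W ≥ 0` one has `|V| = W` almost everywhere, hence `A = W^{1/2}` and `B = i A`:
formally `H = H₀ + i A²` is a dissipative perturbation of a symmetric operator.

*The abstract part.* Let `R = R₀(z)`, `D = A R₀(z)`, `K = cl(R₀(z) B)`, `Q = cl(A R₀(z) B)`
(`ResolventData`). These satisfy resolvent identities in `z`, and `1 + Q(z)` is invertible exactly
when `1 - (z - w) S(w)` is, where `S = R - K (1 + Q)⁻¹ D` (`factorized_isUnit_iff`). So as soon as
`S(w)` is injective with dense range for a single `w`, the operator `w + S(w)⁻¹` is the wanted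
extension, and it is the only one because the resolvent formula determines its resolvent
(`exists_isFactorizedPerturbation`, `IsFactorizedPerturbation.eq`). Injectivity and dense range in
the lower half plane come from the energy identity `ResolventData.energy`. Its special case
`Re ⟨Q v, v⟩ = -Im z ‖K v‖²` (`ResolventData.re_inner_Q`) shows that `1 + Q(z)` is coercive, and
thus `z ∈ ρ(H)`, for every `z ∈ ρ(H₀)` with `Im z ≤ 0`, and also for `Im z > 0` provided that
`Im z ‖K‖² < 1` (`ResolventData.isUnit_one_add`).

*The free operator.* With `k = √(z² - m²)` and `ζ = (z + m) / k`, the resolvent is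
`R₀(z) g = (i / 2ζ) (p (ζ, 1) + q (ζ, -1))`, where `p` and `q` are one-sided convolutions of
`ζ g₀ ± g₁` with `e^{ik|x|}`. The parallelogram law and Cauchy–Schwarz give the pointwise bound
`|f₀|² + |ζ|² |f₁|² ≤ (|ζ|² + 1) / (4 Im k) ‖g‖²` for `f = R₀(z) g`
(`weighted_norm_resolventFun_le`), hence
`‖A R₀(z)‖² ≤ (‖W₁₁‖₁ + ‖W₂₂‖₁ / |ζ|²) (|ζ|² + 1) / (4 Im k)`. The operator `K(z)` is, up to a
factor `i`, the adjoint of `A R₀(z̄)`, whose parameters are `-k̄` and `-ζ̄`, so it obeys the same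
bound. Since `Im z (|ζ|² + 1) = 2 Im k Re ζ` (`IsSpectralParam.im_mul`), the condition
`Im z ‖K‖² < 1` is implied by `Re ζ ‖W₁₁‖₁ + Re ζ⁻¹ ‖W₂₂‖₁ < 2`. For `m = 0` and `Im z > 0` one has
`ζ = 1`.

*The essential part of the spectrum.* For real `l` with `|l| ≥ m`, slowly modulated plane waves are
approximate eigenfunctions of `H₀`, and moving them to infinity makes `A` small on them
(`exists_weyl_sequence`). If `l` were in `ρ(H)`, the perturbed resolvents at `l - i t` would stay
bounded for small `t`, which such functions exclude (`IsFactorizedPerturbation.mem_spectrum`).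
Thus every real `l` with `|l| ≥ m` is a non-isolated point of `σ(H)`, and eigenvalues that are
isolated points of `σ(H)` have to lie in the open upper half plane.
-/

namespace DiracOp

/-! ### Resolvents and factorized perturbations of closed operators -/

section Resolvent

variable {E : Type*} [NormedAddCommGroup E] [NormedSpace ℂ E]
variable {F : Type*} [NormedAddCommGroup F] [NormedSpace ℂ F]

theorem mem_graph_iff_exists {T : E →ₗ.[ℂ] F} {x : E} {y : F} :
    (x, y) ∈ T.graph ↔ ∃ h : x ∈ T.domain, T ⟨x, h⟩ = y := by
  rw [LinearPMap.mem_graph_iff]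
  constructor
  · rintro ⟨⟨u, hu⟩, rfl, rfl⟩
    exact ⟨hu, rfl⟩
  · rintro ⟨h, rfl⟩
    exact ⟨⟨x, h⟩, rfl, rfl⟩

theorem graph_unique {T : E →ₗ.[ℂ] F} {x : E} {y y' : F} (h : (x, y) ∈ T.graph)
    (h' : (x, y') ∈ T.graph) : y = y' :=
  T.mem_graph_snd_inj h h' rfl

theorem isResolventAt_iff {T : E →ₗ.[ℂ] E} {z : ℂ} {R : E →L[ℂ] E} :
    IsResolventAt T z R ↔ (∀ g, (R g, g + z • R g) ∈ T.graph) ∧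
      ∀ f h, (f, h) ∈ T.graph → R (h - z • f) = f := by
  constructor
  · rintro ⟨h1, h2⟩
    refine ⟨fun g => ?_, fun f h hf => ?_⟩
    · obtain ⟨hm, he⟩ := h1 g
      exact mem_graph_iff_exists.2 ⟨hm, sub_eq_iff_eq_add.1 he⟩
    · obtain ⟨hm, rfl⟩ := mem_graph_iff_exists.1 hf
      exact h2 ⟨f, hm⟩
  · rintro ⟨h1, h2⟩
    refine ⟨fun g => ?_, fun f => h2 _ _ (T.mem_graph f)⟩
    obtain ⟨hm, he⟩ := mem_graph_iff_exists.1 (h1 g)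
    exact ⟨hm, by rw [he, add_sub_cancel_right]⟩

theorem IsResolventAt.unique {T : E →ₗ.[ℂ] E} {z : ℂ} {R R' : E →L[ℂ] E}
    (h : IsResolventAt T z R) (h' : IsResolventAt T z R') : R = R' := by
  rw [isResolventAt_iff] at h h'
  ext g
  simpa using h.2 _ _ (h'.1 g)

theorem IsResolventAt.injective {T : E →ₗ.[ℂ] E} {z : ℂ} {R : E →L[ℂ] E}
    (h : IsResolventAt T z R) {g : E} (hg : R g = 0) : g = 0 := by
  rw [isResolventAt_iff] at h
  have h1 := h.1 g
  rw [hg, smul_zero, add_zero] at h1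
  exact graph_unique h1 T.graph.zero_mem

/-- The first resolvent identity. -/
theorem IsResolventAt.sub_apply {T : E →ₗ.[ℂ] E} {z w : ℂ} {R S : E →L[ℂ] E}
    (hz : IsResolventAt T z R) (hw : IsResolventAt T w S) (f : E) :
    R f - S f = (z - w) • R (S f) := by
  rw [isResolventAt_iff] at hz hw
  have h := hz.2 _ _ (hw.1 f)
  have e : f + w • S f - z • S f = f - (z - w) • S f := by rw [sub_smul]; abel
  rw [e, map_sub, map_smul] at h
  rw [sub_eq_iff_eq_add] at h ⊢
  rw [h, add_comm]

/-- An operator is determined by its resolvent at a single point. -/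
theorem eq_of_isResolventAt {T T' : E →ₗ.[ℂ] E} {z : ℂ} {R : E →L[ℂ] E}
    (h : IsResolventAt T z R) (h' : IsResolventAt T' z R) : T = T' := by
  have key : ∀ {T T' : E →ₗ.[ℂ] E}, IsResolventAt T z R → IsResolventAt T' z R →
      T.graph ≤ T'.graph := by
    rintro T T' h h' ⟨f, g⟩ hf
    rw [isResolventAt_iff] at h h'
    have := h'.1 (g - z • f)
    rwa [h.2 _ _ hf, sub_add_cancel] at this
  exact LinearPMap.eq_of_eq_graph (le_antisymm (key h h') (key h' h))

theorem not_isEigenvalue_of_mem_resolventSet {T : E →ₗ.[ℂ] E} {z : ℂ} (h : z ∈ resolventSet T) :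
    ¬ IsEigenvalue T z := by
  rintro ⟨f, hf, he⟩
  obtain ⟨R, hR⟩ := h
  have := hR.2 f
  rw [he, sub_self, map_zero] at this
  exact hf (Subtype.ext this.symm)

/-- The operator `w + S⁻¹` with domain `ran S`, for an injective bounded operator `S`. -/
noncomputable def ofResolvent (w : ℂ) (S : E →L[ℂ] E) (hS : Function.Injective S) :
    E →ₗ.[ℂ] E where
  domain := LinearMap.range (S : E →ₗ[ℂ] E)
  toFun := ((LinearEquiv.ofInjective (S : E →ₗ[ℂ] E) hS).symm : _ →ₗ[ℂ] E) +
    w • (LinearMap.range (S : E →ₗ[ℂ] E)).subtype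

theorem mem_graph_ofResolvent {w : ℂ} {S : E →L[ℂ] E} {hS : Function.Injective S} {x y : E} :
    (x, y) ∈ (ofResolvent w S hS).graph ↔ S (y - w • x) = x := by
  have key : ∀ f : E, (S f, f + w • S f) ∈ (ofResolvent w S hS).graph := by
    intro f
    refine mem_graph_iff_exists.2 ⟨⟨f, rfl⟩, ?_⟩
    have : (LinearEquiv.ofInjective (S : E →ₗ[ℂ] E) hS).symm ⟨S f, ⟨f, rfl⟩⟩ = f := by
      rw [LinearEquiv.symm_apply_eq]
      rfl
    change (LinearEquiv.ofInjective (S : E →ₗ[ℂ] E) hS).symm ⟨S f, ⟨f, rfl⟩⟩ + w • S f = _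
    rw [this]
  constructor
  · intro h
    obtain ⟨⟨f, hf⟩, -⟩ := mem_graph_iff_exists.1 h
    change S f = x at hf
    subst hf
    rw [graph_unique h (key f), add_sub_cancel_right]
  · intro h
    have := key (y - w • x)
    rwa [h, sub_add_cancel] at this

theorem isClosed_ofResolvent {w : ℂ} {S : E →L[ℂ] E} {hS : Function.Injective S} :
    (ofResolvent w S hS).IsClosed := by
  have : ((ofResolvent w S hS).graph : Set (E × E)) = {p | S (p.2 - w • p.1) = p.1} := by
    ext ⟨x, y⟩
    exact mem_graph_ofResolvent
  rw [LinearPMap.IsClosed, this]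
  exact isClosed_eq (by fun_prop) (by fun_prop)

theorem isResolventAt_ofResolvent {w z : ℂ} {S R : E →L[ℂ] E} {hS : Function.Injective S}
    (h1 : R - S = (z - w) • (R * S)) (h2 : R - S = (z - w) • (S * R)) :
    IsResolventAt (ofResolvent w S hS) z R := by
  rw [isResolventAt_iff]
  have e1 : ∀ f, R f - S f = (z - w) • R (S f) := fun f => congr($h1 f)
  have e2 : ∀ f, R f - S f = (z - w) • S (R f) := fun f => congr($h2 f)
  refine ⟨fun g => mem_graph_ofResolvent.2 ?_, fun f h hf => ?_⟩
  · have : g + z • R g - w • R g = g + (z - w) • R g := by rw [sub_smul]; abel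
    rw [this, map_add, map_smul, ← e2, add_sub_cancel]
  · rw [mem_graph_ofResolvent] at hf
    have e : h - z • f = (h - w • f) - (z - w) • f := by rw [sub_smul]; abel
    have e3 := e1 (h - w • f)
    rw [hf] at e3
    rw [e, map_sub, map_smul, ← e3, sub_sub_cancel]

end Resolvent

section Algebra

variable {A : Type*} [Ring A]

theorem isUnit_one_add_mul_comm (x y : A) : IsUnit (1 + x * y) ↔ IsUnit (1 + y * x) := by
  have h := (spectrum.unit_mem_mul_comm (R := ℤ) (A := A) (a := -x) (b := y) (r := 1)).not
  simpa [spectrum.mem_iff] using h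

variable [Algebra ℂ A]

/-- The algebra behind the resolvent equation of a factorized perturbation. -/
theorem factorized_resolvent_identity {δ : ℂ} {Rz Rw Dz Dw Kz Kw Qz Qw Pz Pw : A}
    (hR : Rz - Rw = δ • (Rz * Rw)) (hD : Dz - Dw = δ • (Dz * Rw))
    (hK : Kz - Kw = δ • (Rz * Kw)) (hQ : Qz - Qw = δ • (Dz * Kw))
    (hPz : Pz * (1 + Qz) = 1) (hPw : (1 + Qw) * Pw = 1) :
    (Rz - Kz * Pz * Dz) - (Rw - Kw * Pw * Dw) =
      δ • ((Rz - Kz * Pz * Dz) * (Rw - Kw * Pw * Dw)) := by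
  have hP : Pz * (Qz - Qw) * Pw = Pw - Pz := by
    have : Pz * (Qz - Qw) * Pw = (Pz * (1 + Qz)) * Pw - Pz * ((1 + Qw) * Pw) := by noncomm_ring
    rw [this, hPz, hPw, one_mul, mul_one]
  have h1 : δ • ((Rz - Kz * Pz * Dz) * (Rw - Kw * Pw * Dw)) =
      δ • (Rz * Rw) - δ • (Rz * Kw) * Pw * Dw - Kz * Pz * δ • (Dz * Rw)
        + Kz * (Pz * δ • (Dz * Kw) * Pw) * Dw := by
    simp only [smul_mul_assoc, mul_smul_comm, ← smul_sub, ← smul_add]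
    congr 1
    noncomm_ring
  rw [h1, ← hR, ← hD, ← hK, ← hQ, hP]
  noncomm_ring

theorem one_add_smul_mul_one_sub_smul {δ : ℂ} {a b : A} (h : a - b = δ • (a * b)) :
    (1 + δ • a) * (1 - δ • b) = 1 := by
  have : (1 + δ • a) * (1 - δ • b) = 1 + δ • (a - b - δ • (a * b)) := by
    simp only [mul_sub, add_mul, mul_one, one_mul, smul_mul_assoc, mul_smul_comm, smul_sub,
      smul_add]
    abel
  rw [this, h, sub_self, smul_zero, add_zero]

theorem one_sub_smul_mul_one_add_smul {δ : ℂ} {a b : A} (h : a - b = δ • (b * a)) :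
    (1 - δ • b) * (1 + δ • a) = 1 := by
  have : (1 - δ • b) * (1 + δ • a) = 1 + δ • (a - b - δ • (b * a)) := by
    simp only [mul_add, sub_mul, one_mul, mul_one, smul_mul_assoc, mul_smul_comm, smul_sub]
    abel
  rw [this, h, sub_self, smul_zero, add_zero]

/-- `1 + Q(z)` is invertible exactly when `1 - (z - w) S(w)` is, where `S(w)` is the perturbed
resolvent: both are, up to invertible factors, `1 + x y` and `1 + y x`. -/
theorem factorized_isUnit_iff {δ : ℂ} {Rz Rw Dz Dw Kw Qz Qw Pw : A}
    (hR : Rz - Rw = δ • (Rz * Rw)) (hR' : Rz - Rw = δ • (Rw * Rz))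
    (hD : Dz - Dw = δ • (Dw * Rz)) (hQ : Qz - Qw = δ • (Dz * Kw))
    (hPw : (1 + Qw) * Pw = 1) (hPw' : Pw * (1 + Qw) = 1) :
    IsUnit (1 + Qz) ↔ IsUnit (1 - δ • (Rw - Kw * Pw * Dw)) := by
  have hY : (1 + δ • Rz) * (1 - δ • Rw) = 1 := one_add_smul_mul_one_sub_smul hR
  have hY' : (1 - δ • Rw) * (1 + δ • Rz) = 1 := one_sub_smul_mul_one_add_smul hR'
  have hYu : IsUnit (1 + δ • Rz) := ⟨⟨_, _, hY, hY'⟩, rfl⟩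
  have hPu : IsUnit (1 + Qw) := ⟨⟨_, _, hPw, hPw'⟩, rfl⟩
  have e1 : 1 + Qz = (1 + (δ • Dw) * ((1 + δ • Rz) * Kw * Pw)) * (1 + Qw) := by
    have hDz : Dz = Dw * (1 + δ • Rz) := by
      rw [mul_add, mul_one, mul_smul_comm, ← hD]; abel
    have : (1 + (δ • Dw) * ((1 + δ • Rz) * Kw * Pw)) * (1 + Qw)
        = 1 + Qw + δ • (Dw * (1 + δ • Rz) * Kw) * (Pw * (1 + Qw)) := by
      rw [add_mul, one_mul]
      congr 1
      simp only [smul_mul_assoc, mul_assoc]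
    rw [this, hPw', mul_one, ← hDz, ← hQ]
    abel
  have e2 : 1 + ((1 + δ • Rz) * Kw * Pw) * (δ • Dw) =
      (1 + δ • Rz) * (1 - δ • (Rw - Kw * Pw * Dw)) := by
    have : (1 + δ • Rz) * (1 - δ • (Rw - Kw * Pw * Dw)) =
        (1 + δ • Rz) * (1 - δ • Rw) + (1 + δ • Rz) * (δ • (Kw * Pw * Dw)) := by
      rw [← mul_add, smul_sub]
      congr 1
      abel
    rw [this, hY]
    simp only [mul_smul_comm, mul_assoc]
  rw [e1, hPu.mul_right_iff, isUnit_one_add_mul_comm, e2, hYu.mul_left_iff]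

end Algebra

/-! ### Operators extending `H₀ + B A` -/

section Factorized

variable {E : Type*} [NormedAddCommGroup E] [NormedSpace ℂ E]

/-- The bounded operators entering the resolvent formula at `z`: `R = R₀(z)`, `D = A R₀(z)`,
`K = cl(R₀(z) B)` and `Q = cl(A R₀(z) B)`. -/
structure ResolventData (H₀ A B : E →ₗ.[ℂ] E) (z : ℂ) (R D K Q : E →L[ℂ] E) : Prop where
  isResolventAt : IsResolventAt H₀ z R
  left_mem : ∀ f, (R f, D f) ∈ A.graph
  right_eq : ∀ f g, (f, g) ∈ B.graph → R g = K f
  both_eq : ∀ f g, (f, g) ∈ B.graph → D g = Q f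

/-- The right hand side `R₀ - cl(R₀ B) (1 + Q)⁻¹ A R₀` of the resolvent formula. -/
noncomputable def perturbedResolvent (R D K Q : E →L[ℂ] E) : E →L[ℂ] E :=
  R - K * Ring.inverse (1 + Q) * D

theorem ext_on_domain {B : E →ₗ.[ℂ] E} (hB : Dense (B.domain : Set E)) {S T : E →L[ℂ] E}
    (h : ∀ f g, (f, g) ∈ B.graph → S f = T f) : S = T := by
  refine ContinuousLinearMap.coeFn_injective (S.continuous.ext_on hB T.continuous fun f hf => ?_)
  exact h f _ (B.mem_graph ⟨f, hf⟩)

variable {H₀ A B : E →ₗ.[ℂ] E} {z w : ℂ} {R D K Q R' D' K' Q' : E →L[ℂ] E}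

theorem ResolventData.unique (hB : Dense (B.domain : Set E)) (h : ResolventData H₀ A B z R D K Q)
    (h' : ResolventData H₀ A B z R' D' K' Q') : R = R' ∧ D = D' ∧ K = K' ∧ Q = Q' := by
  obtain rfl := h.isResolventAt.unique h'.isResolventAt
  obtain rfl : D = D' :=
    ContinuousLinearMap.ext fun f => graph_unique (h.left_mem f) (h'.left_mem f)
  refine ⟨rfl, rfl, ext_on_domain hB fun f g hf => ?_, ext_on_domain hB fun f g hf => ?_⟩
  · rw [← h.right_eq f g hf, ← h'.right_eq f g hf]
  · rw [← h.both_eq f g hf, ← h'.both_eq f g hf]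

theorem ResolventData.sub_R (h : ResolventData H₀ A B z R D K Q)
    (h' : ResolventData H₀ A B w R' D' K' Q') : R - R' = (z - w) • (R * R') :=
  ContinuousLinearMap.ext fun f => h.isResolventAt.sub_apply h'.isResolventAt f

theorem ResolventData.sub_R' (h : ResolventData H₀ A B z R D K Q)
    (h' : ResolventData H₀ A B w R' D' K' Q') : R - R' = (z - w) • (R' * R) := by
  rw [← neg_sub R' R, h'.sub_R h, ← neg_smul, neg_sub]

theorem ResolventData.sub_D (h : ResolventData H₀ A B z R D K Q)
    (h' : ResolventData H₀ A B w R' D' K' Q') : D - D' = (z - w) • (D * R') := by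
  ext f
  have h1 := A.graph.sub_mem (h.left_mem f) (h'.left_mem f)
  have h2 := A.graph.smul_mem (z - w) (h.left_mem (R' f))
  rw [Prod.mk_sub_mk, h.isResolventAt.sub_apply h'.isResolventAt f] at h1
  exact graph_unique h1 h2

theorem ResolventData.sub_D' (h : ResolventData H₀ A B z R D K Q)
    (h' : ResolventData H₀ A B w R' D' K' Q') : D - D' = (z - w) • (D' * R) := by
  rw [← neg_sub D' D, h'.sub_D h, ← neg_smul, neg_sub]

theorem ResolventData.sub_K (hB : Dense (B.domain : Set E)) (h : ResolventData H₀ A B z R D K Q)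
    (h' : ResolventData H₀ A B w R' D' K' Q') : K - K' = (z - w) • (R * K') := by
  refine ext_on_domain hB fun f g hf => ?_
  have := congr($(h.sub_R h') g)
  simpa [h.right_eq f g hf, h'.right_eq f g hf] using this

theorem ResolventData.sub_Q (hB : Dense (B.domain : Set E)) (h : ResolventData H₀ A B z R D K Q)
    (h' : ResolventData H₀ A B w R' D' K' Q') : Q - Q' = (z - w) • (D * K') := by
  refine ext_on_domain hB fun f g hf => ?_
  have := congr($(h.sub_D h') g)
  simpa [h.both_eq f g hf, h'.both_eq f g hf, h'.right_eq f g hf] using this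

theorem ResolventData.perturbedResolvent_sub (hB : Dense (B.domain : Set E))
    (h : ResolventData H₀ A B z R D K Q) (h' : ResolventData H₀ A B w R' D' K' Q')
    (hQ : IsUnit (1 + Q)) (hQ' : IsUnit (1 + Q')) :
    perturbedResolvent R D K Q - perturbedResolvent R' D' K' Q' =
      (z - w) • (perturbedResolvent R D K Q * perturbedResolvent R' D' K' Q') :=
  factorized_resolvent_identity (h.sub_R h') (h.sub_D h') (h.sub_K hB h') (h.sub_Q hB h')
    (Ring.inverse_mul_cancel _ hQ) (Ring.mul_inverse_cancel _ hQ')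

theorem ResolventData.isUnit_iff (hB : Dense (B.domain : Set E))
    (h : ResolventData H₀ A B z R D K Q) (h' : ResolventData H₀ A B w R' D' K' Q')
    (hQ' : IsUnit (1 + Q')) :
    IsUnit (1 + Q) ↔ IsUnit (1 - (z - w) • perturbedResolvent R' D' K' Q') :=
  factorized_isUnit_iff (h.sub_R h') (h.sub_R' h') (h.sub_D' h') (h.sub_Q hB h')
    (Ring.mul_inverse_cancel _ hQ') (Ring.inverse_mul_cancel _ hQ')

theorem neg_one_mem_resolventSet_iff {Q : E →L[ℂ] E} :
    (-1 : ℂ) ∈ _root_.resolventSet ℂ Q ↔ IsUnit (1 + Q) := by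
  rw [spectrum.mem_resolventSet_iff, map_neg, map_one, ← IsUnit.neg_iff]
  congr! 1
  abel

/-- What membership in the class of factorized perturbations says about the resolvent of `H`. -/
theorem IsFactorizedPerturbation.mem_resolventSet_iff {H : E →ₗ.[ℂ] E}
    (hH : IsFactorizedPerturbation H₀ A B H) (h : ResolventData H₀ A B z R D K Q) :
    (z ∈ resolventSet H ↔ IsUnit (1 + Q)) ∧
      ∀ S, IsResolventAt H z S → S = perturbedResolvent R D K Q := by
  obtain ⟨D', K', Q', h1, h2, h3, h4, h5⟩ := hH.resolvent_formula z R h.isResolventAt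
  have h' : ResolventData H₀ A B z R D' K' Q' := by
    refine ⟨h.isResolventAt, fun f => mem_graph_iff_exists.2 (h1 f), fun f g hf => ?_,
      fun f g hf => ?_⟩
    · obtain ⟨hm, rfl⟩ := mem_graph_iff_exists.1 hf
      exact h2 ⟨f, hm⟩
    · obtain ⟨hm, rfl⟩ := mem_graph_iff_exists.1 hf
      exact graph_unique (mem_graph_iff_exists.2 (h1 _)) (mem_graph_iff_exists.2 (h3 ⟨f, hm⟩))
  obtain ⟨-, rfl, rfl, rfl⟩ := h.unique hH.dense_domain_B h'
  exact ⟨h4.trans neg_one_mem_resolventSet_iff, fun S hS => h5 S hS⟩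

theorem IsFactorizedPerturbation.isResolventAt {H : E →ₗ.[ℂ] E}
    (hH : IsFactorizedPerturbation H₀ A B H) (h : ResolventData H₀ A B z R D K Q)
    (hQ : IsUnit (1 + Q)) : IsResolventAt H z (perturbedResolvent R D K Q) := by
  obtain ⟨S, hS⟩ := (hH.mem_resolventSet_iff h).1.2 hQ
  rwa [(hH.mem_resolventSet_iff h).2 S hS] at hS

theorem IsFactorizedPerturbation.eq {H H' : E →ₗ.[ℂ] E}
    (hdata : ∀ z ∈ resolventSet H₀, ∃ R D K Q, ResolventData H₀ A B z R D K Q)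
    (hH : IsFactorizedPerturbation H₀ A B H) (hH' : IsFactorizedPerturbation H₀ A B H') :
    H = H' := by
  obtain ⟨z, hz₀, hz⟩ := hH.nonempty
  obtain ⟨R, D, K, Q, h⟩ := hdata z hz₀
  have hQ := (hH.mem_resolventSet_iff h).1.1 hz
  exact eq_of_isResolventAt (hH.isResolventAt h hQ) (hH'.isResolventAt h hQ)

/-- On `f ∈ dom H₀` the perturbed resolvent can be evaluated at `(H₀ - z) f` in terms of `A f`. -/
theorem ResolventData.perturbedResolvent_apply (h : ResolventData H₀ A B z R D K Q) {f g u : E}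
    (hf : (f, g) ∈ H₀.graph) (hu : (f, u) ∈ A.graph) :
    perturbedResolvent R D K Q (g - z • f) = f - K (Ring.inverse (1 + Q) u) := by
  have hR : R (g - z • f) = f := (isResolventAt_iff.1 h.isResolventAt).2 f g hf
  have hD : D (g - z • f) = u := by
    have := h.left_mem (g - z • f)
    rw [hR] at this
    exact graph_unique this hu
  change R (g - z • f) - K (Ring.inverse (1 + Q) (D (g - z • f))) = _
  rw [hR, hD]

/-- Construction of the perturbed operator from one point `w` at which `1 + Q(w)` is invertible and
the perturbed resolvent is injective with dense range. -/
theorem exists_isFactorizedPerturbation (hB : Dense (B.domain : Set E))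
    (hdata : ∀ z ∈ resolventSet H₀, ∃ R D K Q, ResolventData H₀ A B z R D K Q)
    (h : ResolventData H₀ A B w R D K Q) (hQ : IsUnit (1 + Q))
    (hinj : Function.Injective (perturbedResolvent R D K Q))
    (hdense : DenseRange (perturbedResolvent R D K Q)) :
    ∃ H, IsFactorizedPerturbation H₀ A B H := by
  set S := perturbedResolvent R D K Q with hS
  have hw : IsResolventAt (ofResolvent w S hinj) w S :=
    isResolventAt_ofResolvent (by simp) (by simp)
  refine ⟨ofResolvent w S hinj, ?_⟩
  refine ⟨isClosed_ofResolvent, hdense, ?_, hB, ⟨w, ⟨R, h.isResolventAt⟩, S, hw⟩, ?_⟩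
  · intro f h₀ hA hAB
    refine mem_graph_iff_exists.1 (mem_graph_ofResolvent.2 ?_)
    have hf := H₀.mem_graph ⟨f, h₀⟩
    have hu := A.mem_graph ⟨f, hA⟩
    have hv := B.mem_graph ⟨_, hAB⟩
    have e1 := h.perturbedResolvent_apply hf hu
    have e2 : S (B ⟨A ⟨f, hA⟩, hAB⟩) = K (Ring.inverse (1 + Q) (A ⟨f, hA⟩)) := by
      have e3 : Ring.inverse (1 + Q) (Q (A ⟨f, hA⟩)) =
          A ⟨f, hA⟩ - Ring.inverse (1 + Q) (A ⟨f, hA⟩) := by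
        have := congr($(Ring.inverse_mul_cancel _ hQ) (A ⟨f, hA⟩))
        rw [mul_apply_eq_comp, add_apply, map_add] at this
        exact eq_sub_of_add_eq' this
      change R _ - K (Ring.inverse (1 + Q) (D _)) = _
      rw [h.right_eq _ _ hv, h.both_eq _ _ hv, e3, map_sub, sub_sub_cancel]
    have : H₀ ⟨f, h₀⟩ + B ⟨A ⟨f, hA⟩, hAB⟩ - w • f =
        (H₀ ⟨f, h₀⟩ - w • f) + B ⟨A ⟨f, hA⟩, hAB⟩ := by abel
    rw [this, map_add, e2, hS, e1, sub_add_cancel]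
  · intro z R₀ hR₀
    obtain ⟨R₁, D₁, K₁, Q₁, h₁⟩ := hdata z ⟨R₀, hR₀⟩
    obtain rfl := h₁.isResolventAt.unique hR₀
    have hres : IsUnit (1 + Q₁) →
        IsResolventAt (ofResolvent w S hinj) z (perturbedResolvent R₁ D₁ K₁ Q₁) := by
      intro hQ₁
      refine isResolventAt_ofResolvent (h₁.perturbedResolvent_sub hB h hQ₁ hQ) ?_
      rw [← neg_sub S, h.perturbedResolvent_sub hB h₁ hQ hQ₁, ← neg_smul, neg_sub]
    have hunit : z ∈ resolventSet (ofResolvent w S hinj) → IsUnit (1 + Q₁) := by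
      rintro ⟨T, hT⟩
      rw [h₁.isUnit_iff hB h hQ]
      have e1 : T - S = (z - w) • (T * S) := ContinuousLinearMap.ext fun f => hT.sub_apply hw f
      have e2 : T - S = (z - w) • (S * T) := by
        rw [← neg_sub S, ← neg_sub w, neg_smul]
        exact congrArg Neg.neg (ContinuousLinearMap.ext fun f => hw.sub_apply hT f)
      exact ⟨⟨_, _, one_sub_smul_mul_one_add_smul e2, one_add_smul_mul_one_sub_smul e1⟩, rfl⟩
    refine ⟨D₁, K₁, Q₁, fun f => mem_graph_iff_exists.1 (h₁.left_mem f),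
      fun f => h₁.right_eq _ _ (B.mem_graph f), fun f => ?_,
      Iff.trans ⟨hunit, fun hQ₁ => ⟨_, hres hQ₁⟩⟩ neg_one_mem_resolventSet_iff.symm,
      fun T hT => hT.unique (hres (hunit ⟨T, hT⟩))⟩
    have := h₁.left_mem (B f)
    rw [h₁.both_eq _ _ (B.mem_graph f)] at this
    exact mem_graph_iff_exists.1 this

end Factorized

/-! ### Dissipative perturbations `H₀ + i A²` of a symmetric operator -/

section Dissipative

variable {E : Type*} [NormedAddCommGroup E] [InnerProductSpace ℂ E]

/-- A (possibly unbounded) operator is symmetric. -/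
def IsSymm (T : E →ₗ.[ℂ] E) : Prop :=
  ∀ f g f' g' : E, (f, f') ∈ T.graph → (g, g') ∈ T.graph → inner ℂ f' g = inner ℂ f g'

theorem IsSymm.im_inner_sub {T : E →ₗ.[ℂ] E} (hT : IsSymm T) (z : ℂ) {f f' : E}
    (h : (f, f') ∈ T.graph) : (inner ℂ f (f' - z • f)).im = -z.im * ‖f‖ ^ 2 := by
  have h1 : (inner ℂ f f').im = 0 := by
    rw [← Complex.conj_eq_iff_im, inner_conj_symm]
    exact hT f f f' f' h h
  have h2 : inner ℂ f f = ((‖f‖ ^ 2 : ℝ) : ℂ) := by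
    rw [inner_self_eq_norm_sq_to_K]
    norm_cast
  rw [inner_sub_right, inner_smul_right, Complex.sub_im, h1, h2, Complex.im_mul_ofReal]
  ring

/-- A symmetric operator has no eigenvector at `z` if `T - z̄` is onto. -/
theorem isResolventAt_of_isSymm {T : E →ₗ.[ℂ] E} (hT : IsSymm T) {z : ℂ} {R R' : E →L[ℂ] E}
    (hR : ∀ g, (R g, g + z • R g) ∈ T.graph)
    (hR' : ∀ g, (R' g, g + (starRingEnd ℂ z) • R' g) ∈ T.graph) : IsResolventAt T z R := by
  rw [isResolventAt_iff]
  refine ⟨hR, fun f h hf => ?_⟩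
  set w := R (h - z • f) - f with hw
  have hwg : (w, z • w) ∈ T.graph := by
    have := T.graph.sub_mem (hR (h - z • f)) hf
    rw [Prod.mk_sub_mk] at this
    convert this using 2
    rw [hw, smul_sub]
    abel
  have h1 := hT _ _ _ _ hwg (hR' w)
  rw [inner_add_right, inner_smul_left, inner_smul_right, right_eq_add, inner_self_eq_zero] at h1
  exact sub_eq_zero.1 h1

/-- The resolvents of a symmetric operator at `z` and `z̄` are adjoint to each other. -/
theorem IsSymm.inner_resolvent {T : E →ₗ.[ℂ] E} (hT : IsSymm T) {z : ℂ} {R R' : E →L[ℂ] E}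
    (hR : IsResolventAt T z R) (hR' : IsResolventAt T (starRingEnd ℂ z) R') (f g : E) :
    inner ℂ f (R g) = inner ℂ (R' f) g := by
  rw [isResolventAt_iff] at hR hR'
  have h := hT _ _ _ _ (hR'.1 f) (hR.1 g)
  rw [inner_add_right, inner_add_left, inner_smul_left, inner_smul_right,
    Complex.conj_conj] at h
  exact add_right_cancel h

variable {H₀ A B : E →ₗ.[ℂ] E} {z : ℂ} {R D K Q : E →L[ℂ] E}

/-- The energy identity. Formally `u = R₀ (f - B v)` solves `(H₀ - z) u = f - B v`; pairing with `u`
and using that `A` is symmetric and `B = i A` gives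
`Im ⟨u, f⟩ - Re ⟨A u, v⟩ = -Im z ‖u‖²`. Density of `dom B` extends it to all `v`. -/
theorem ResolventData.energy (hH : IsSymm H₀) (hA : IsSymm A)
    (hAB : ∀ f g, (f, g) ∈ B.graph → ∃ g', (f, g') ∈ A.graph ∧ g = Complex.I • g')
    (hB : Dense (B.domain : Set E)) (h : ResolventData H₀ A B z R D K Q) (f v : E) :
    (inner ℂ (R f - K v) f).im - (inner ℂ (D f - Q v) v).re = -z.im * ‖R f - K v‖ ^ 2 := by
  have hcl : IsClosed {v : E | (inner ℂ (R f - K v) f).im - (inner ℂ (D f - Q v) v).re =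
      -z.im * ‖R f - K v‖ ^ 2} := by
    refine isClosed_eq (Continuous.sub (Complex.continuous_im.comp ?_)
      (Complex.continuous_re.comp ?_)) (by fun_prop)
    · exact Continuous.inner (by fun_prop) (by fun_prop)
    · exact Continuous.inner (by fun_prop) (by fun_prop)
  have hsub : (B.domain : Set E) ⊆ {v : E | (inner ℂ (R f - K v) f).im -
      (inner ℂ (D f - Q v) v).re = -z.im * ‖R f - K v‖ ^ 2} := by
    intro v hv
    have hvB := B.mem_graph ⟨v, hv⟩
    obtain ⟨a, hva, hag⟩ := hAB _ _ hvB
    change (v, a) ∈ A.graph at hva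
    set b : E := B ⟨v, hv⟩
    change (v, b) ∈ B.graph at hvB
    have e1 : R f - K v = R (f - b) := by rw [map_sub, h.right_eq _ _ hvB]
    have e2 : D f - Q v = D (f - b) := by rw [map_sub, h.both_eq _ _ hvB]
    have e3 := hH.im_inner_sub z ((isResolventAt_iff.1 h.isResolventAt).1 (f - b))
    have e4 := hA _ _ _ _ (h.left_mem (f - b)) hva
    rw [add_sub_cancel_right, inner_sub_right, hag, inner_smul_right, ← hag, ← e4, Complex.sub_im,
      Complex.I_mul_im] at e3
    change _ - _ = _
    rw [e1, e2, e3]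
  exact (hcl.closure_subset_iff.2 hsub) (hB v)

theorem ResolventData.re_inner_Q (hH : IsSymm H₀) (hA : IsSymm A)
    (hAB : ∀ f g, (f, g) ∈ B.graph → ∃ g', (f, g') ∈ A.graph ∧ g = Complex.I • g')
    (hB : Dense (B.domain : Set E)) (h : ResolventData H₀ A B z R D K Q) (v : E) :
    (inner ℂ (Q v) v).re = -z.im * ‖K v‖ ^ 2 := by
  have := h.energy hH hA hAB hB 0 v
  simpa using this

theorem mem_spectrum_of_approx {T : E →ₗ.[ℂ] E} {z : ℂ}
    (happ : ∀ ε > 0, ∃ f g, (f, g) ∈ T.graph ∧ ‖f‖ = 1 ∧ ‖g - z • f‖ ≤ ε) : z ∈ spectrum T := by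
  rintro ⟨S, hS⟩
  obtain ⟨f, g, hf, hf1, hg⟩ := happ (1 / (2 * (‖S‖ + 1))) (by positivity)
  have h1 := (isResolventAt_iff.1 hS).2 f g hf
  have h2 := S.le_opNorm_of_le hg
  rw [h1, hf1, mul_one_div, le_div_iff₀ (by positivity)] at h2
  linarith [norm_nonneg S]

variable [CompleteSpace E]

/-- `1 + Q(z)` is coercive as soon as `Im z ‖K‖² < 1`. -/
theorem ResolventData.isUnit_one_add (hH : IsSymm H₀) (hA : IsSymm A)
    (hAB : ∀ f g, (f, g) ∈ B.graph → ∃ g', (f, g') ∈ A.graph ∧ g = Complex.I • g')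
    (hB : Dense (B.domain : Set E)) (h : ResolventData H₀ A B z R D K Q) {c : ℝ} (hc : c < 1)
    (hK : ∀ v, z.im * ‖K v‖ ^ 2 ≤ c * ‖v‖ ^ 2) : IsUnit (1 + Q) := by
  refine ContinuousLinearMap.isUnit_of_forall_le_norm_inner_map _ (c := ⟨1 - c, by linarith⟩)
    (show (0 : ℝ) < 1 - c by linarith) fun v => ?_
  refine le_trans ?_ (Complex.re_le_norm _)
  have e1 := h.re_inner_Q hH hA hAB hB v
  have e2 : (inner ℂ v v).re = ‖v‖ ^ 2 := by
    rw [← inner_self_eq_norm_sq (𝕜 := ℂ)]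
    rfl
  have e3 : (1 + Q) v = v + Q v := rfl
  rw [e3, inner_add_left, Complex.add_re, e1, e2]
  change ‖v‖ ^ 2 * (1 - c) ≤ _
  linarith [hK v]

theorem ResolventData.isUnit_one_add_of_im_nonpos (hH : IsSymm H₀) (hA : IsSymm A)
    (hAB : ∀ f g, (f, g) ∈ B.graph → ∃ g', (f, g') ∈ A.graph ∧ g = Complex.I • g')
    (hB : Dense (B.domain : Set E)) (h : ResolventData H₀ A B z R D K Q) (hz : z.im ≤ 0) :
    IsUnit (1 + Q) :=
  h.isUnit_one_add hH hA hAB hB one_half_lt_one fun v => by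
    have := mul_nonneg (neg_nonneg.2 hz) (sq_nonneg ‖K v‖)
    have := sq_nonneg ‖v‖
    linarith

/-- In the energy identity with `v = (1 + Q)⁻¹ A R₀ f` all terms have the same sign when
`Im z < 0`. This gives both the injectivity and the dense range of the perturbed resolvent. -/
theorem ResolventData.eq_zero_of_inner_perturbedResolvent (hH : IsSymm H₀) (hA : IsSymm A)
    (hAB : ∀ f g, (f, g) ∈ B.graph → ∃ g', (f, g') ∈ A.graph ∧ g = Complex.I • g')
    (hB : Dense (B.domain : Set E)) (h : ResolventData H₀ A B z R D K Q) (hz : z.im < 0) :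
    ∀ f, inner ℂ (perturbedResolvent R D K Q f) f = 0 → f = 0 := by
  have hQ := h.isUnit_one_add_of_im_nonpos hH hA hAB hB hz.le
  intro f hf
  set v := Ring.inverse (1 + Q) (D f) with hv
  have hDv : D f = v + Q v := by
    have := congr($(Ring.mul_inverse_cancel _ hQ) (D f))
    exact this.symm
  have e := h.energy hH hA hAB hB f v
  change inner ℂ (R f - K v) f = 0 at hf
  have e2 : (inner ℂ v v).re = ‖v‖ ^ 2 := by
    rw [← inner_self_eq_norm_sq (𝕜 := ℂ)]
    rfl
  rw [hf, hDv, add_sub_cancel_right, e2, Complex.zero_im] at e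
  have h1 := mul_nonneg (neg_nonneg.2 hz.le) (sq_nonneg ‖R f - K v‖)
  have h2 := sq_nonneg ‖v‖
  have h3 : ‖v‖ ^ 2 = 0 := by linarith
  have h4 : -z.im * ‖R f - K v‖ ^ 2 = 0 := by linarith
  have hv0 : v = 0 := by simpa using h3
  have hR : R f = 0 := by
    simpa [hv0, hz.ne] using h4
  exact h.isResolventAt.injective hR

theorem exists_isFactorizedPerturbation_of_isSymm (hH : IsSymm H₀) (hA : IsSymm A)
    (hAB : ∀ f g, (f, g) ∈ B.graph → ∃ g', (f, g') ∈ A.graph ∧ g = Complex.I • g')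
    (hB : Dense (B.domain : Set E))
    (hdata : ∀ z ∈ resolventSet H₀, ∃ R D K Q, ResolventData H₀ A B z R D K Q)
    (hz : z.im < 0) (hz₀ : z ∈ resolventSet H₀) :
    ∃ H, IsFactorizedPerturbation H₀ A B H := by
  obtain ⟨R, D, K, Q, h⟩ := hdata z hz₀
  have key := h.eq_zero_of_inner_perturbedResolvent hH hA hAB hB hz
  refine exists_isFactorizedPerturbation hB hdata h
    (h.isUnit_one_add_of_im_nonpos hH hA hAB hB hz.le) ?_ ?_
  · rw [injective_iff_map_eq_zero]
    intro f hf
    exact key f (by rw [hf, inner_zero_left])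
  · -- a vector orthogonal to the range is orthogonal to its own image, hence zero
    have : (LinearMap.range (perturbedResolvent R D K Q : E →ₗ[ℂ] E)).topologicalClosure = ⊤ := by
      rw [Submodule.topologicalClosure_eq_top_iff, Submodule.eq_bot_iff]
      intro f hf
      exact key f (hf _ ⟨f, rfl⟩)
    exact (Submodule.dense_iff_topologicalClosure_eq_top).2 this

/-- If `w` runs to a real point `l` of `ρ(H)` from below, the resolvents stay bounded; approximate
eigenvectors of `H₀` on which `A` is small exclude this. -/
theorem IsFactorizedPerturbation.mem_spectrum {H : E →ₗ.[ℂ] E}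
    (hP : IsFactorizedPerturbation H₀ A B H) (hH : IsSymm H₀) (hA : IsSymm A)
    (hAB : ∀ f g, (f, g) ∈ B.graph → ∃ g', (f, g') ∈ A.graph ∧ g = Complex.I • g')
    (hdata : ∀ z : ℂ, z.im < 0 → ∃ R D K Q, ResolventData H₀ A B z R D K Q) {l : ℝ}
    (happ : ∀ ε > 0, ∃ f g u, (f, g) ∈ H₀.graph ∧ (f, u) ∈ A.graph ∧ ‖f‖ = 1 ∧
      ‖g - (l : ℂ) • f‖ ≤ ε ∧ ‖u‖ ≤ ε) : (l : ℂ) ∈ spectrum H := by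
  rintro ⟨S, hS⟩
  obtain ⟨t, ht, htS⟩ : ∃ t > 0, t * ‖S‖ ≤ 1 / 4 := by
    refine ⟨1 / (4 * (‖S‖ + 1)), by positivity, ?_⟩
    have := norm_nonneg S
    rw [div_mul_eq_mul_div, one_mul, div_le_div_iff₀ (by positivity) (by norm_num)]
    linarith
  set w : ℂ := l - t * Complex.I with hw
  have hwim : w.im < 0 := by simpa [hw] using ht
  obtain ⟨R, D, K, Q, h⟩ := hdata w hwim
  have hQ := h.isUnit_one_add_of_im_nonpos hH hA hAB hP.dense_domain_B hwim.le
  have hT := hP.isResolventAt h hQ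
  set T := perturbedResolvent R D K Q with hTdef
  -- the resolvent identity between `l` and `w`, with `t ‖S‖` small
  have hnorm : ‖T‖ ≤ 2 * ‖S‖ := by
    have e : T = S - ((l : ℂ) - w) • (S * T) := by
      ext f
      have := hS.sub_apply hT f
      change T f = S f - ((l : ℂ) - w) • S (T f)
      rw [← this, sub_sub_cancel]
    have hlw : ‖(l : ℂ) - w‖ = t := by
      rw [hw, sub_sub_cancel, norm_mul, Complex.norm_I, mul_one, Complex.norm_real,
        Real.norm_of_nonneg ht.le]
    have h1 : ‖T‖ ≤ ‖S‖ + t * (‖S‖ * ‖T‖) := by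
      calc ‖T‖ = ‖S - ((l : ℂ) - w) • (S * T)‖ := congrArg _ e
        _ ≤ ‖S‖ + ‖((l : ℂ) - w) • (S * T)‖ := norm_sub_le _ _
        _ ≤ ‖S‖ + t * (‖S‖ * ‖T‖) := by
          rw [norm_smul, hlw]
          gcongr
          exact norm_mul_le _ _
    nlinarith [norm_nonneg T, norm_nonneg S]
  set C := ‖K * Ring.inverse (1 + Q)‖ with hC
  have hC0 : 0 ≤ C := norm_nonneg _
  have hS0 := norm_nonneg S
  -- chosen so that `1 ≤ 2 ‖S‖ (ε + t) + C ε` fails; `C` depends on `t`, hence `ε` comes last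
  set ε := 1 / (4 * (C + 2 * ‖S‖ + 1)) with hε
  have hε0 : 0 < ε := by positivity
  have hεC : (C + 2 * ‖S‖) * ε ≤ 1 / 4 := by
    rw [hε, mul_one_div, div_le_div_iff₀ (by positivity) (by norm_num)]
    linarith
  obtain ⟨f, g, u, hf, hu, hf1, hg, hu1⟩ := happ ε hε0
  have e1 := h.perturbedResolvent_apply hf hu
  rw [← hTdef] at e1
  have h1 : ‖g - w • f‖ ≤ ε + t := by
    have : g - w • f = (g - (l : ℂ) • f) + ((t : ℂ) * Complex.I) • f := by
      rw [hw, sub_smul]; abel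
    rw [this]
    refine (norm_add_le _ _).trans (add_le_add hg ?_)
    rw [norm_smul, hf1, norm_mul, Complex.norm_I, mul_one, mul_one, Complex.norm_real,
      Real.norm_of_nonneg ht.le]
  have h2 : ‖f‖ ≤ ‖T (g - w • f)‖ + ‖K (Ring.inverse (1 + Q) u)‖ := by
    rw [e1]
    have := norm_add_le (f - K (Ring.inverse (1 + Q) u)) (K (Ring.inverse (1 + Q) u))
    rwa [sub_add_cancel] at this
  have h3 : ‖K (Ring.inverse (1 + Q) u)‖ ≤ C * ε :=
    ((K * Ring.inverse (1 + Q)).le_opNorm u).trans (by gcongr)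
  have h4 : ‖T (g - w • f)‖ ≤ 2 * ‖S‖ * (ε + t) :=
    (T.le_opNorm _).trans (by gcongr)
  rw [hf1] at h2
  nlinarith

/-- Construction of the data of the resolvent formula: only `A R₀(z)`, `A R₀(z̄)` and the bound on
`A R₀(z) A` are needed, since `R₀(z) A` is the adjoint of `A R₀(z̄)`. -/
theorem exists_resolventData (hH : IsSymm H₀) (hA : IsSymm A)
    (hAB : ∀ f g, (f, g) ∈ B.graph → ∃ g', (f, g') ∈ A.graph ∧ g = Complex.I • g')
    (hB : Dense (B.domain : Set E)) {R' D' : E →L[ℂ] E} (hR : IsResolventAt H₀ z R)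
    (hR' : IsResolventAt H₀ (starRingEnd ℂ z) R') (hD : ∀ f, (R f, D f) ∈ A.graph)
    (hD' : ∀ f, (R' f, D' f) ∈ A.graph) {C : ℝ}
    (hQ : ∀ f g, (f, g) ∈ B.graph → ‖D g‖ ≤ C * ‖f‖) :
    ∃ K Q, ResolventData H₀ A B z R D K Q ∧ ‖K‖ = ‖D'‖ := by
  have hrange : DenseRange B.domain.subtype := by
    simpa [DenseRange] using hB
  have hn : ∃ C, ∀ f : B.domain, ‖((D : E →ₗ[ℂ] E) ∘ₗ B.toFun) f‖ ≤ C * ‖B.domain.subtype f‖ :=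
    ⟨C, fun f => hQ f _ (B.mem_graph f)⟩
  refine ⟨Complex.I • ContinuousLinearMap.adjoint D',
    ((D : E →ₗ[ℂ] E) ∘ₗ B.toFun).extendOfNorm B.domain.subtype, ⟨hR, hD, ?_, ?_⟩, ?_⟩
  · intro f g hf
    obtain ⟨a, ha, rfl⟩ := hAB f g hf
    refine ext_inner_left ℂ fun h => ?_
    rw [hH.inner_resolvent hR hR', smul_apply, inner_smul_right,
      inner_smul_right, ContinuousLinearMap.adjoint_inner_right, hA _ _ _ _ (hD' h) ha]
  · intro f g hf
    obtain ⟨hm, rfl⟩ := mem_graph_iff_exists.1 hf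
    exact (LinearMap.extendOfNorm_eq hrange hn ⟨f, hm⟩).symm
  · rw [norm_smul, Complex.norm_I, one_mul, LinearIsometryEquiv.norm_map]

end Dissipative

/-! ### Locally absolutely continuous functions -/

/-- `u` is a locally absolutely continuous function with derivative `u'`. -/
structure IsPrimitive (u u' : ℝ → ℂ) : Prop where
  locallyIntegrable : LocallyIntegrable u' volume
  sub_eq : ∀ a b : ℝ, u b - u a = ∫ t in a..b, u' t

namespace IsPrimitive

variable {u u' v v' : ℝ → ℂ}

theorem intervalIntegrable (h : IsPrimitive u u') (a b : ℝ) : IntervalIntegrable u' volume a b :=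
  (h.locallyIntegrable.integrableOn_isCompact isCompact_uIcc).intervalIntegrable

theorem eq_add (h : IsPrimitive u u') : u = fun x => u 0 + ∫ t in (0 : ℝ)..x, u' t := by
  funext x
  rw [← h.sub_eq 0 x]
  abel

theorem continuous (h : IsPrimitive u u') : Continuous u := by
  rw [h.eq_add]
  exact continuous_const.add (intervalIntegral.continuous_primitive h.intervalIntegrable 0)

theorem ae_hasDerivAt (h : IsPrimitive u u') : ∀ᵐ x, HasDerivAt u (u' x) x := by
  filter_upwards [LocallyIntegrable.ae_hasDerivAt_integral h.locallyIntegrable] with x hx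
  rw [h.eq_add]
  exact (hx 0).const_add (u 0)

theorem of_hasDerivAt (h : ∀ x, HasDerivAt u (u' x) x) (hc : Continuous u') : IsPrimitive u u' :=
  ⟨hc.locallyIntegrable, fun _ _ =>
    (intervalIntegral.integral_eq_sub_of_hasDerivAt (fun x _ => h x)
      (hc.intervalIntegrable _ _)).symm⟩

theorem congr_ae (h : IsPrimitive u u') (hv : u' =ᵐ[volume] v') : IsPrimitive u v' :=
  ⟨h.locallyIntegrable.congr hv, fun a b => by
    rw [h.sub_eq, intervalIntegral.integral_congr_ae]
    filter_upwards [hv] with x hx _ using hx⟩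

theorem add (h : IsPrimitive u u') (h' : IsPrimitive v v') : IsPrimitive (u + v) (u' + v') :=
  ⟨h.locallyIntegrable.add h'.locallyIntegrable, fun a b => by
    simp only [Pi.add_apply]
    rw [intervalIntegral.integral_add (h.intervalIntegrable a b) (h'.intervalIntegrable a b),
      ← h.sub_eq, ← h'.sub_eq]
    ring⟩

theorem const_mul (h : IsPrimitive u u') (c : ℂ) :
    IsPrimitive (fun x => c * u x) (fun x => c * u' x) :=
  ⟨h.locallyIntegrable.smul c, fun a b => by
    rw [intervalIntegral.integral_const_mul, ← h.sub_eq, mul_sub]⟩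

theorem conj (h : IsPrimitive u u') :
    IsPrimitive (fun x => (starRingEnd ℂ) (u x)) (fun x => (starRingEnd ℂ) (u' x)) := by
  refine ⟨fun x => ?_, fun a b => ?_⟩
  · obtain ⟨s, hs, hi⟩ := h.locallyIntegrable x
    exact ⟨s, hs, hi.norm.mono' (Complex.continuous_conj.comp_aestronglyMeasurable
      hi.aestronglyMeasurable) (by simp)⟩
  · rw [← map_sub, h.sub_eq]
    simp only [intervalIntegral, map_sub]
    rw [← integral_conj, ← integral_conj]

theorem comp_neg (h : IsPrimitive u u') :
    IsPrimitive (fun x => u (-x)) (fun x => -u' (-x)) := by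
  refine ⟨LocallyIntegrable.neg fun x => ?_, fun a b => ?_⟩
  · obtain ⟨s, hs, hi⟩ := h.locallyIntegrable (-x)
    refine ⟨-s, ?_, ?_⟩
    · exact continuous_neg.continuousAt.preimage_mem_nhds hs
    · have := (Measure.measurePreserving_neg (volume : Measure ℝ)).integrableOn_comp_preimage
        (f := u') (s := s) (Homeomorph.neg ℝ).measurableEmbedding
      exact this.2 hi
  · rw [intervalIntegral.integral_neg, intervalIntegral.integral_comp_neg u', h.sub_eq,
      intervalIntegral.integral_symm]

theorem absolutelyContinuousOnInterval (h : IsPrimitive u u') (a b : ℝ) :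
    AbsolutelyContinuousOnInterval u a b := by
  have hre : AbsolutelyContinuousOnInterval (fun x => ∫ t in a..x, (u' t).re) a b :=
    IntervalIntegrable.absolutelyContinuousOnInterval_intervalIntegral
      ⟨(h.intervalIntegrable a b).1.re, (h.intervalIntegrable a b).2.re⟩ Set.left_mem_uIcc
  have him : AbsolutelyContinuousOnInterval (fun x => ∫ t in a..x, (u' t).im) a b :=
    IntervalIntegrable.absolutelyContinuousOnInterval_intervalIntegral
      ⟨(h.intervalIntegrable a b).1.im, (h.intervalIntegrable a b).2.im⟩ Set.left_mem_uIcc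
  have hconst : ∀ c : ℂ, AbsolutelyContinuousOnInterval (fun _ : ℝ => c) a b := fun c =>
    (LipschitzWith.const c).lipschitzOnWith.absolutelyContinuousOnInterval
  have key := ((hconst (u a)).add (hre.smul (hconst 1))).add (him.smul (hconst Complex.I))
  refine (congrArg (fun f : ℝ → ℂ => AbsolutelyContinuousOnInterval f a b) ?_).mpr key
  funext x
  have h1 : u x = u a + ∫ t in a..x, u' t := by rw [← h.sub_eq]; ring
  have hi := h.intervalIntegrable a x
  rw [h1]
  simp only [Pi.add_apply, Pi.smul_apply', Complex.real_smul, mul_one, add_assoc]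
  congr 1
  rw [← intervalIntegral.integral_ofReal, ← intervalIntegral.integral_ofReal,
    ← intervalIntegral.integral_mul_const, ← intervalIntegral.integral_add]
  · simp only [Complex.re_add_im]
  · exact ⟨hi.1.re.ofReal, hi.2.re.ofReal⟩
  · exact IntervalIntegrable.mul_const ⟨hi.1.im.ofReal, hi.2.im.ofReal⟩ _

/-- The product rule. -/
theorem mul (h : IsPrimitive u u') (h' : IsPrimitive v v') :
    IsPrimitive (fun x => u x * v x) (fun x => u' x * v x + u x * v' x) := by
  have hloc : LocallyIntegrable (fun x => u' x * v x + u x * v' x) volume := by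
    refine LocallyIntegrable.add (fun x => ?_) (fun x => ?_)
    all_goals
      refine ⟨Set.Icc (x - 1) (x + 1), Icc_mem_nhds (by linarith) (by linarith), ?_⟩
    · exact (h.locallyIntegrable.integrableOn_isCompact isCompact_Icc).mul_continuousOn
        h'.continuous.continuousOn isCompact_Icc
    · exact (h'.locallyIntegrable.integrableOn_isCompact isCompact_Icc).continuousOn_mul
        h.continuous.continuousOn isCompact_Icc
  refine ⟨hloc, fun a b => ?_⟩
  set w : ℝ → ℂ := fun x => ∫ t in a..x, (u' t * v t + u t * v' t) with hw
  have hwp : IsPrimitive w (fun x => u' x * v x + u x * v' x) := by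
    refine ⟨hloc, fun c d => ?_⟩
    have hI : ∀ c d : ℝ, IntervalIntegrable (fun x => u' x * v x + u x * v' x) volume c d :=
      fun c d => (hloc.integrableOn_isCompact isCompact_uIcc).intervalIntegrable
    exact intervalIntegral.integral_interval_sub_left (hI a d) (hI a c)
  have hac : AbsolutelyContinuousOnInterval (u • v - w) a b :=
    ((h.absolutelyContinuousOnInterval a b).smul (h'.absolutelyContinuousOnInterval a b)).sub
      (hwp.absolutelyContinuousOnInterval a b)
  obtain ⟨C, hC⟩ := hac.const_of_ae_hasDerivAt_zero (by
    filter_upwards [h.ae_hasDerivAt, h'.ae_hasDerivAt, hwp.ae_hasDerivAt] with x h1 h2 h3 _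
    have := (h1.mul h2).sub h3
    rwa [sub_self] at this)
  have ha := hC a Set.left_mem_uIcc
  have hb := hC b Set.right_mem_uIcc
  have hwa : w a = 0 := by simp [hw]
  change u a * v a - w a = C at ha
  change u b * v b - w b = C at hb
  change _ = w b
  rw [hwa, sub_zero] at ha
  rw [ha, ← hb]
  ring

/-- An integrable function with integrable derivative has no boundary terms at infinity. -/
theorem integral_eq_zero (h : IsPrimitive u u') (hu : Integrable u volume)
    (hu' : Integrable u' volume) : ∫ x, u' x = 0 := by
  have htop : ∃ l, Filter.Tendsto u Filter.atTop (nhds l) := by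
    refine ⟨u 0 + ∫ t in Set.Ioi (0 : ℝ), u' t, ?_⟩
    have := (intervalIntegral_tendsto_integral_Ioi (0 : ℝ) hu'.integrableOn
      Filter.tendsto_id).const_add (u 0)
    rw [h.eq_add]
    simpa using this
  have hbot : ∃ l, Filter.Tendsto u Filter.atBot (nhds l) := by
    refine ⟨u 0 - ∫ t in Set.Iic (0 : ℝ), u' t, ?_⟩
    have := (intervalIntegral_tendsto_integral_Iic (0 : ℝ) hu'.integrableOn
      Filter.tendsto_id).const_sub (u 0)
    convert this using 1
    funext x
    rw [id, ← h.sub_eq]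
    ring
  obtain ⟨l, hl⟩ := htop
  obtain ⟨l', hl'⟩ := hbot
  have h0 : l = 0 := by
    refine IntegrableAtFilter.eq_zero_of_tendsto ⟨Set.univ, Filter.univ_mem, hu.integrableOn⟩
      (fun s hs => ?_) hl
    obtain ⟨b, hb⟩ := Filter.mem_atTop_sets.1 hs
    exact top_le_iff.1 (Real.volume_Ici (a := b) ▸ measure_mono hb)
  have h0' : l' = 0 := by
    refine IntegrableAtFilter.eq_zero_of_tendsto ⟨Set.univ, Filter.univ_mem, hu.integrableOn⟩
      (fun s hs => ?_) hl'
    obtain ⟨b, hb⟩ := Filter.mem_atBot_sets.1 hs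
    exact top_le_iff.1 (Real.volume_Iic (a := b) ▸ measure_mono hb)
  have h1 := intervalIntegral_tendsto_integral hu' Filter.tendsto_neg_atTop_atBot Filter.tendsto_id
  have h2 : Filter.Tendsto (fun x : ℝ => ∫ t in (-x)..(id x), u' t) Filter.atTop (nhds 0) := by
    have := hl.sub (hl'.comp Filter.tendsto_neg_atTop_atBot)
    rw [h0, h0', sub_zero] at this
    convert this using 1
    funext x
    exact (h.sub_eq _ _).symm
  exact tendsto_nhds_unique h1 h2

end IsPrimitive

/-! ### The one-sided exponential convolution -/

theorem norm_integral_mul_sq_le {α : Type*} [MeasurableSpace α] {μ : Measure α} {f g : α → ℂ}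
    (hf : MemLp f 2 μ) (hg : MemLp g 2 μ) :
    ‖∫ x, f x * g x ∂μ‖ ^ 2 ≤ (∫ x, ‖f x‖ ^ 2 ∂μ) * ∫ x, ‖g x‖ ^ 2 ∂μ := by
  have h2 : ENNReal.ofReal (2 : ℝ) = 2 := by norm_num
  have h := integral_mul_norm_le_Lp_mul_Lq (μ := μ) (f := f) (g := g) (p := 2) (q := 2)
    (by constructor <;> norm_num) (by rwa [h2]) (by rwa [h2])
  have h1 : ‖∫ x, f x * g x ∂μ‖ ≤ ∫ x, ‖f x‖ * ‖g x‖ ∂μ := by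
    refine (norm_integral_le_integral_norm _).trans_eq ?_
    simp only [norm_mul]
  simp only [Real.rpow_ofNat, ← Real.sqrt_eq_rpow] at h
  calc _ ≤ (√(∫ x, ‖f x‖ ^ 2 ∂μ) * √(∫ x, ‖g x‖ ^ 2 ∂μ)) ^ 2 := by
        gcongr
        exact h1.trans h
    _ = _ := by
      rw [mul_pow, Real.sq_sqrt (integral_nonneg fun _ => by positivity),
        Real.sq_sqrt (integral_nonneg fun _ => by positivity)]

/-- The convolution of `g` with `e^{ikx}` restricted to the half line `x ≥ 0`. -/
noncomputable def causalConv (k : ℂ) (g : ℝ → ℂ) (x : ℝ) : ℂ :=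
  ∫ y in Set.Iic x, Complex.exp (Complex.I * k * (x - y)) * g y

section CausalConv

variable {k : ℂ}

theorem norm_exp_I_mul (k : ℂ) (t : ℝ) :
    ‖Complex.exp (Complex.I * k * t)‖ = Real.exp (-k.im * t) := by
  rw [Complex.norm_exp]
  congr 1
  simp [mul_assoc]

theorem norm_exp_I_mul_sub (k : ℂ) (x y : ℝ) :
    ‖Complex.exp (Complex.I * k * (x - y))‖ = Real.exp (-k.im * (x - y)) := by
  rw [← norm_exp_I_mul, Complex.ofReal_sub]

theorem integral_exp_sub_Iic {κ : ℝ} (hκ : 0 < κ) (x : ℝ) :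
    IntegrableOn (fun y : ℝ => Real.exp (-κ * (x - y))) (Set.Iic x) volume ∧
      ∫ y in Set.Iic x, Real.exp (-κ * (x - y)) = 1 / κ := by
  have h : (fun y : ℝ => Real.exp (-κ * (x - y))) =
      fun y => Real.exp (-κ * x) * Real.exp (κ * y) := by
    funext y
    rw [← Real.exp_add]
    congr 1
    ring
  rw [h]
  refine ⟨(integrableOn_exp_mul_Iic hκ x).const_mul _, ?_⟩
  rw [integral_const_mul, integral_exp_mul_Iic hκ, ← mul_div_assoc, ← Real.exp_add]
  congr 1
  rw [neg_mul, neg_add_cancel, Real.exp_zero]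

theorem memLp_exp (hk : 0 < k.im) (x : ℝ) :
    MemLp (fun y : ℝ => Complex.exp (Complex.I * k * (x - y))) 2
      (volume.restrict (Set.Iic x)) := by
  rw [memLp_two_iff_integrable_sq_norm (by fun_prop)]
  have h := (integral_exp_sub_Iic (κ := 2 * k.im) (by linarith) x).1
  refine h.congr (.of_forall fun y => ?_)
  simp only [norm_exp_I_mul_sub]
  rw [← Real.exp_nat_mul]
  congr 1
  push_cast
  ring

theorem integral_norm_exp_sq (hk : 0 < k.im) (x : ℝ) :
    ∫ y in Set.Iic x, ‖Complex.exp (Complex.I * k * (x - y))‖ ^ 2 = 1 / (2 * k.im) := by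
  rw [← (integral_exp_sub_Iic (κ := 2 * k.im) (by linarith) x).2]
  congr 1
  funext y
  rw [norm_exp_I_mul_sub, ← Real.exp_nat_mul]
  congr 1
  push_cast
  ring

variable {g : ℝ → ℂ}

theorem integrableOn_causalConv (hk : 0 < k.im) (hg : MemLp g 2 volume) (x : ℝ) :
    IntegrableOn (fun y : ℝ => Complex.exp (Complex.I * k * (x - y)) * g y) (Set.Iic x) volume :=
  (memLp_exp hk x).integrable_mul (hg.restrict _)

theorem causalConv_add (hk : 0 < k.im) {h : ℝ → ℂ} (hg : MemLp g 2 volume)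
    (hh : MemLp h 2 volume) : causalConv k (g + h) = causalConv k g + causalConv k h := by
  funext x
  simp only [causalConv, Pi.add_apply, mul_add]
  exact integral_add (integrableOn_causalConv hk hg x) (integrableOn_causalConv hk hh x)

theorem causalConv_smul (c : ℂ) : causalConv k (c • g) = c • causalConv k g := by
  funext x
  simp only [causalConv, Pi.smul_apply, smul_eq_mul, ← integral_const_mul]
  congr 1
  funext y
  ring

theorem causalConv_congr {h : ℝ → ℂ} (hgh : g =ᵐ[volume] h) : causalConv k g = causalConv k h := by
  funext x
  refine integral_congr_ae (ae_restrict_of_ae ?_)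
  filter_upwards [hgh] with y hy
  simp only [hy]

theorem norm_causalConv_sq_le (hk : 0 < k.im) (hg : MemLp g 2 volume) (x : ℝ) :
    ‖causalConv k g x‖ ^ 2 ≤ 1 / (2 * k.im) * ∫ y in Set.Iic x, ‖g y‖ ^ 2 := by
  rw [← integral_norm_exp_sq hk x]
  exact norm_integral_mul_sq_le (memLp_exp hk x) (hg.restrict _)

theorem norm_causalConv_le (hk : 0 < k.im) (hg : Integrable g volume) (x : ℝ) :
    ‖causalConv k g x‖ ≤ ∫ y, ‖g y‖ := by
  have hle : ∀ y ∈ Set.Iic x, ‖Complex.exp (Complex.I * k * (x - y))‖ ≤ 1 := by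
    intro y hy
    rw [norm_exp_I_mul_sub, Real.exp_le_one_iff]
    have := mul_nonneg hk.le (sub_nonneg.2 (Set.mem_Iic.1 hy))
    linarith
  have hi : IntegrableOn (fun y : ℝ => Complex.exp (Complex.I * k * (x - y)) * g y)
      (Set.Iic x) volume :=
    Integrable.bdd_mul (c := 1) hg.integrableOn
      (Continuous.aestronglyMeasurable (by fun_prop))
      ((ae_restrict_iff' measurableSet_Iic).2 (.of_forall hle))
  refine (norm_integral_le_integral_norm _).trans
    ((setIntegral_mono_on hi.norm hg.norm.integrableOn measurableSet_Iic fun y hy => ?_).trans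
      (setIntegral_le_integral hg.norm (.of_forall fun _ => norm_nonneg _)))
  rw [norm_mul]
  exact mul_le_of_le_one_left (norm_nonneg _) (hle y hy)

/-- The differential equation `p' = i k p + g`. -/
theorem isPrimitive_causalConv (hk : 0 < k.im) (hg : MemLp g 2 volume) :
    IsPrimitive (causalConv k g) (fun x => Complex.I * k * causalConv k g x + g x) := by
  have hexp : ∀ x : ℝ, causalConv k g x = Complex.exp (Complex.I * k * x) *
      ∫ y in Set.Iic x, Complex.exp (-(Complex.I * k * y)) * g y := by
    intro x
    rw [causalConv, ← integral_const_mul]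
    congr 1
    funext y
    rw [← mul_assoc, ← Complex.exp_add]
    congr 2
    ring
  have hint : ∀ x : ℝ, IntegrableOn (fun y : ℝ => Complex.exp (-(Complex.I * k * y)) * g y)
      (Set.Iic x) volume := by
    intro x
    have := (integrableOn_causalConv hk hg x).const_mul (Complex.exp (-(Complex.I * k * x)))
    refine this.congr (.of_forall fun y => ?_)
    simp only
    rw [← mul_assoc, ← Complex.exp_add]
    congr 2
    ring
  have hG : IsPrimitive (fun x : ℝ => ∫ y in Set.Iic x, Complex.exp (-(Complex.I * k * y)) * g y)
      (fun y : ℝ => Complex.exp (-(Complex.I * k * y)) * g y) :=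
    ⟨fun x => ⟨Set.Iic (x + 1), Iic_mem_nhds (by linarith), hint _⟩, fun a b =>
      intervalIntegral.integral_Iic_sub_Iic (hint a) (hint b)⟩
  have hE : IsPrimitive (fun x : ℝ => Complex.exp (Complex.I * k * x))
      (fun x : ℝ => Complex.exp (Complex.I * k * x) * (Complex.I * k)) := by
    refine IsPrimitive.of_hasDerivAt (fun x => ?_) (by fun_prop)
    have h1 : HasDerivAt (fun x : ℝ => Complex.I * k * x) (Complex.I * k) x := by
      simpa using (Complex.ofRealCLM.hasDerivAt (x := x)).const_mul (Complex.I * k)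
    exact h1.cexp
  have := hE.mul hG
  rw [funext hexp]
  refine (congrArg₂ IsPrimitive rfl ?_).mp this
  funext x
  have he : Complex.exp (Complex.I * k * x) * Complex.exp (-(Complex.I * k * x)) = 1 := by
    rw [← Complex.exp_add, add_neg_cancel, Complex.exp_zero]
  linear_combination g x * he

/-- Young's inequality for the one-sided exponential, by Schur's test. -/
theorem memLp_causalConv (hk : 0 < k.im) (hg : MemLp g 2 volume) :
    MemLp (causalConv k g) 2 volume ∧
      ∫ x, ‖causalConv k g x‖ ^ 2 ≤ (1 / k.im) ^ 2 * ∫ x, ‖g x‖ ^ 2 := by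
  set h : ℝ → ℝ := (Set.Ici 0).indicator fun t => Real.exp (-k.im * t) with hh
  have hhi : Integrable h volume ∧ ∫ t, h t = 1 / k.im := by
    have e := integral_exp_sub_Iic hk 0
    have e1 : ∀ y : ℝ, h (-y) = (Set.Iic 0).indicator (fun y => Real.exp (-k.im * (0 - y))) y := by
      intro y
      simp [hh, Set.indicator]
    rw [← integral_indicator measurableSet_Iic, ← integrable_indicator_iff measurableSet_Iic] at e
    rw [← funext e1] at e
    exact ⟨by simpa using e.1.comp_neg, by rw [← e.2]; exact (integral_neg_eq_self h _).symm⟩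
  have hg2 : Integrable (fun x => ‖g x‖ ^ 2) volume :=
    (memLp_two_iff_integrable_sq_norm hg.1).1 hg
  have hconv : Integrable (convolution (fun x => ‖g x‖ ^ 2) h (ContinuousLinearMap.mul ℝ ℝ) volume)
    volume := hg2.integrable_convolution _ hhi.1
  have hconvi := integral_convolution (ContinuousLinearMap.mul ℝ ℝ) hg2 hhi.1
    (ν := volume) (μ := volume)
  have hpt : ∀ x, ‖causalConv k g x‖ ^ 2 ≤ 1 / k.im *
      convolution (fun x => ‖g x‖ ^ 2) h (ContinuousLinearMap.mul ℝ ℝ) volume x := by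
    intro x
    have hk2 : 0 < (k / 2).im := by
      rw [Complex.div_ofNat_im]; linarith
    have e1 : causalConv k g x = ∫ y in Set.Iic x, Complex.exp (Complex.I * (k / 2) * (x - y)) *
        (Complex.exp (Complex.I * (k / 2) * (x - y)) * g y) := by
      rw [causalConv]
      congr 1
      funext y
      rw [← mul_assoc, ← Complex.exp_add]
      congr 2
      ring
    have hnorm : ∀ y ∈ Set.Iic x, ‖Complex.exp (Complex.I * (k / 2) * (x - y)) * g y‖ ^ 2 =
        ‖g y‖ ^ 2 * h (x - y) := by
      intro y hy
      have : x - y ∈ Set.Ici (0 : ℝ) := sub_nonneg.2 (Set.mem_Iic.1 hy)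
      rw [norm_mul, norm_exp_I_mul_sub, hh, Set.indicator_of_mem this, mul_pow,
        ← Real.exp_nat_mul, mul_comm, Complex.div_ofNat_im]
      congr 2
      push_cast
      ring
    have hmem : MemLp (fun y : ℝ => Complex.exp (Complex.I * (k / 2) * (x - y)) * g y) 2
        (volume.restrict (Set.Iic x)) := by
      refine (hg.restrict (Set.Iic x)).of_le (by
        exact (Continuous.aestronglyMeasurable (by fun_prop)).mul hg.1.restrict) ?_
      refine (ae_restrict_iff' measurableSet_Iic).2 (.of_forall fun y hy => ?_)
      rw [norm_mul, norm_exp_I_mul_sub]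
      refine mul_le_of_le_one_left (norm_nonneg _) (Real.exp_le_one_iff.2 ?_)
      have := mul_nonneg hk2.le (sub_nonneg.2 (Set.mem_Iic.1 hy))
      linarith
    have e2 := norm_integral_mul_sq_le (memLp_exp hk2 x) hmem
    rw [← e1, integral_norm_exp_sq hk2 x, setIntegral_congr_fun measurableSet_Iic hnorm] at e2
    have e3 : 2 * (k / 2).im = k.im := by rw [Complex.div_ofNat_im]; ring
    rw [e3] at e2
    refine e2.trans_eq ?_
    congr 1
    rw [convolution_def]
    refine setIntegral_eq_integral_of_forall_compl_eq_zero fun y hy => ?_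
    have : x - y ∉ Set.Ici (0 : ℝ) := by simpa using hy
    rw [hh, Set.indicator_of_notMem this, mul_zero]
  have hi : Integrable (fun x => ‖causalConv k g x‖ ^ 2) volume := by
    refine (hconv.const_mul (1 / k.im)).mono' ?_ (.of_forall fun x => ?_)
    · exact ((isPrimitive_causalConv hk hg).continuous.norm.pow 2).aestronglyMeasurable
    · rw [Real.norm_of_nonneg (by positivity)]
      exact hpt x
  refine ⟨(memLp_two_iff_integrable_sq_norm
    (isPrimitive_causalConv hk hg).continuous.aestronglyMeasurable).2 hi, ?_⟩
  refine (integral_mono hi (hconv.const_mul _) hpt).trans_eq ?_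
  rw [integral_const_mul, hconvi, hhi.2, ContinuousLinearMap.mul_apply']
  ring

end CausalConv

/-! ### The free Dirac operator -/

section FreeDirac

theorem act_apply (M : Mat) (v : C2) (i : Fin 2) : act M v i = M i 0 * v 0 + M i 1 * v 1 := by
  simp [act, Matrix.mulVec, dotProduct,
    Fin.sum_univ_two]

theorem norm_sq_C2 (v : C2) : ‖v‖ ^ 2 = ‖v 0‖ ^ 2 + ‖v 1‖ ^ 2 := by
  rw [EuclideanSpace.norm_sq_eq, Fin.sum_univ_two]

theorem inner_C2 (v w : C2) : inner ℂ v w =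
    (starRingEnd ℂ) (v 0) * w 0 + (starRingEnd ℂ) (v 1) * w 1 := by
  simp [PiLp.inner_apply, Fin.sum_univ_two, mul_comm]

theorem norm_sq_L2 (f : L2) : ‖f‖ ^ 2 = ∫ x, ‖f x‖ ^ 2 := by
  have h := inner_self_eq_norm_sq (𝕜 := ℂ) f
  rw [← h, L2.inner_def]
  have : ∀ x, inner ℂ (f x) (f x) = ((‖f x‖ ^ 2 : ℝ) : ℂ) := fun x => by
    rw [inner_self_eq_norm_sq_to_K]
    norm_cast
  simp only [this]
  rw [integral_complex_ofReal]
  rfl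

theorem integrable_norm_sq (f : L2) : Integrable (fun x => ‖f x‖ ^ 2) volume :=
  (memLp_two_iff_integrable_sq_norm (Lp.memLp f).1).1 (Lp.memLp f)

theorem memLp_apply {f : ℝ → C2} (hf : MemLp f 2 volume) (i : Fin 2) :
    MemLp (fun x => f x i) 2 volume :=
  (EuclideanSpace.proj (𝕜 := ℂ) i).comp_memLp' hf

/-- Multiplication by a constant matrix on `L²`. -/
noncomputable abbrev constMul (M : Mat) : L2 →L[ℂ] L2 := (act M).compLpL 2 volume

theorem constMul_ae (M : Mat) (f : L2) : ∀ᵐ x, constMul M f x = act M (f x) :=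
  (act M).coeFn_compLpL f

theorem mem_graph_freeDirac_iff_deriv {m : ℝ} {f h : L2} : (f, h) ∈ (freeDirac m).graph ↔
    ∃ g, HasL2Deriv f g ∧ h = (-Complex.I) • constMul sigma1 g + (m : ℂ) • constMul sigma3 f := by
  rw [mem_graph_iff_exists]
  constructor
  · rintro ⟨hf, rfl⟩
    exact ⟨l2Deriv ⟨f, hf⟩, hf.choose_spec, rfl⟩
  · rintro ⟨g, hg, rfl⟩
    refine ⟨⟨g, hg⟩, ?_⟩
    have : l2Deriv ⟨f, ⟨g, hg⟩⟩ = g :=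
      HasL2Deriv.unique (Exists.choose_spec (⟨g, hg⟩ : ∃ g, HasL2Deriv f g)) hg
    change (-Complex.I) • constMul sigma1 (l2Deriv ⟨f, ⟨g, hg⟩⟩) + _ = _
    rw [this]
    rfl

theorem hasL2Deriv_iff {f g : L2} : HasL2Deriv f g ↔ ∃ u : Fin 2 → ℝ → ℂ,
    (∀ i, ∀ᵐ x, u i x = f x i) ∧ ∀ i, IsPrimitive (u i) (fun x => g x i) := by
  have hcomp : ∀ (i : Fin 2) (a b : ℝ), (∫ t in a..b, g t) i = ∫ t in a..b, g t i := fun i a b =>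
    ((EuclideanSpace.proj (𝕜 := ℂ) i).intervalIntegral_comp_comm
      (intervalIntegrable_coe g a b)).symm
  have hloc : ∀ i : Fin 2, LocallyIntegrable (fun x => g x i) volume := fun i =>
    (memLp_apply (Lp.memLp g) i).locallyIntegrable (by norm_num)
  constructor
  · rintro ⟨u, hu, e⟩
    refine ⟨fun i x => u x i, fun i => ?_, fun i => ⟨hloc i, fun a b => ?_⟩⟩
    · filter_upwards [hu] with x hx
      rw [hx]
    · rw [← hcomp, ← e]
      rfl
  · rintro ⟨u, hu, e⟩
    refine ⟨fun x => !₂[u 0 x, u 1 x], ?_, fun a b => ?_⟩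
    · filter_upwards [hu 0, hu 1] with x h0 h1
      ext i
      fin_cases i
      · simpa using h0
      · simpa using h1
    · ext i
      rw [hcomp, ← (e i).sub_eq]
      fin_cases i <;> simp

/-- The equation `H₀ f = h` written out in components. -/
theorem mem_graph_freeDirac {m : ℝ} {f h : L2} : (f, h) ∈ (freeDirac m).graph ↔
    ∃ u₀ u₁ : ℝ → ℂ, (∀ᵐ x, u₀ x = f x 0) ∧ (∀ᵐ x, u₁ x = f x 1) ∧
      IsPrimitive u₀ (fun x => Complex.I * (h x 1 + m * f x 1)) ∧
      IsPrimitive u₁ (fun x => Complex.I * (h x 0 - m * f x 0)) := by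
  rw [mem_graph_freeDirac_iff_deriv]
  constructor
  · rintro ⟨g, hg, hh⟩
    obtain ⟨u, hu, hp⟩ := hasL2Deriv_iff.1 hg
    have hae : ∀ᵐ x, h x = (-Complex.I) • act sigma1 (g x) + (m : ℂ) • act sigma3 (f x) := by
      rw [hh]
      filter_upwards [constMul_ae sigma1 g, constMul_ae sigma3 f,
        Lp.coeFn_add ((-Complex.I) • constMul sigma1 g) ((m : ℂ) • constMul sigma3 f),
        Lp.coeFn_smul (-Complex.I) (constMul sigma1 g),
        Lp.coeFn_smul (m : ℂ) (constMul sigma3 f)] with x h1 h2 h3 h4 h5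
      rw [h3, Pi.add_apply, h4, h5, Pi.smul_apply, Pi.smul_apply, h1, h2]
    refine ⟨u 0, u 1, hu 0, hu 1, (hp 0).congr_ae ?_, (hp 1).congr_ae ?_⟩
    · filter_upwards [hae] with x hx
      rw [hx]
      simp only [PiLp.add_apply, PiLp.smul_apply, act_apply, sigma1, sigma3, smul_eq_mul]
      simp
      linear_combination g x 0 * Complex.I_sq
    · filter_upwards [hae] with x hx
      rw [hx]
      simp only [PiLp.add_apply, PiLp.smul_apply, act_apply, sigma1, sigma3, smul_eq_mul]
      simp
      linear_combination g x 1 * Complex.I_sq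
  · rintro ⟨u₀, u₁, h0, h1, hp0, hp1⟩
    set g : L2 := Complex.I • constMul sigma1 (h - (m : ℂ) • constMul sigma3 f) with hg
    have hae : ∀ᵐ x, g x = Complex.I • act sigma1 (h x - (m : ℂ) • act sigma3 (f x)) := by
      filter_upwards [constMul_ae sigma1 (h - (m : ℂ) • constMul sigma3 f), constMul_ae sigma3 f,
        Lp.coeFn_sub h ((m : ℂ) • constMul sigma3 f),
        Lp.coeFn_smul Complex.I (constMul sigma1 (h - (m : ℂ) • constMul sigma3 f)),
        Lp.coeFn_smul (m : ℂ) (constMul sigma3 f)] with x h1 h2 h3 h4 h5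
      rw [hg, h4, Pi.smul_apply, h1, h3, Pi.sub_apply, h5, Pi.smul_apply, h2]
    refine ⟨g, hasL2Deriv_iff.2 ⟨![u₀, u₁], ?_, ?_⟩, ?_⟩
    · intro i
      fin_cases i
      · simpa using h0
      · simpa using h1
    · intro i
      fin_cases i
      · refine hp0.congr_ae ?_
        filter_upwards [hae] with x hx
        rw [hx]
        simp only [PiLp.sub_apply, PiLp.smul_apply, act_apply, sigma1, sigma3, smul_eq_mul]
        simp
      · refine hp1.congr_ae ?_
        filter_upwards [hae] with x hx
        rw [hx]
        simp only [PiLp.sub_apply, PiLp.smul_apply, act_apply, sigma1, sigma3, smul_eq_mul]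
        simp
    · refine Lp.ext ?_
      filter_upwards [hae, constMul_ae sigma1 g, constMul_ae sigma3 f,
        Lp.coeFn_add ((-Complex.I) • constMul sigma1 g) ((m : ℂ) • constMul sigma3 f),
        Lp.coeFn_smul (-Complex.I) (constMul sigma1 g),
        Lp.coeFn_smul (m : ℂ) (constMul sigma3 f)] with x h0 h1 h2 h3 h4 h5
      rw [h3, Pi.add_apply, h4, h5, Pi.smul_apply, Pi.smul_apply, h1, h2, h0]
      ext i
      simp only [PiLp.add_apply, PiLp.sub_apply, PiLp.smul_apply, act_apply, sigma1, sigma3,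
        smul_eq_mul]
      fin_cases i
      · simp
        linear_combination (h x 0 - m * f x 0) * Complex.I_sq
      · simp
        linear_combination (h x 1 + m * f x 1) * Complex.I_sq

/-- The difference of the two inner products is the integral of the derivative of the current
`ū₀ v₁ + ū₁ v₀`. -/
theorem isSymm_freeDirac (m : ℝ) : IsSymm (freeDirac m) := by
  intro f g f' g' hf hg
  obtain ⟨u₀, u₁, hu0, hu1, hp0, hp1⟩ := mem_graph_freeDirac.1 hf
  obtain ⟨v₀, v₁, hv0, hv1, hq0, hq1⟩ := mem_graph_freeDirac.1 hg
  have hprim := ((hp0.conj).mul hq1).add ((hp1.conj).mul hq0)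
  have hi : Integrable (fun x => Complex.I * (inner ℂ (f x) (g' x) - inner ℂ (f' x) (g x)))
      volume := ((L2.integrable_inner f g').sub (L2.integrable_inner f' g)).const_mul _
  have hae : ((fun x => (starRingEnd ℂ) (Complex.I * (f' x 1 + m * f x 1)) * v₁ x +
      (starRingEnd ℂ) (u₀ x) * (Complex.I * (g' x 0 - m * g x 0))) +
      fun x => (starRingEnd ℂ) (Complex.I * (f' x 0 - m * f x 0)) * v₀ x +
      (starRingEnd ℂ) (u₁ x) * (Complex.I * (g' x 1 + m * g x 1))) =ᵐ[volume]
      fun x => Complex.I * (inner ℂ (f x) (g' x) - inner ℂ (f' x) (g x)) := by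
    filter_upwards [hu0, hu1, hv0, hv1] with x h1 h2 h3 h4
    simp only [Pi.add_apply, h1, h2, h3, h4, inner_C2, map_mul, map_add, map_sub, Complex.conj_I,
      Complex.conj_ofReal]
    ring
  have hz := (hprim.congr_ae hae).integral_eq_zero ?_ hi
  · rw [integral_const_mul, integral_sub (L2.integrable_inner f g') (L2.integrable_inner f' g),
      ← L2.inner_def, ← L2.inner_def, mul_eq_zero, sub_eq_zero] at hz
    exact (hz.resolve_left Complex.I_ne_zero).symm
  · have hfi := fun i => memLp_apply (Lp.memLp f) i
    have hgi := fun i => memLp_apply (Lp.memLp g) i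
    have hconj : ∀ i, MemLp (fun x => (starRingEnd ℂ) (f x i)) 2 volume := fun i =>
      (hfi i).of_le (Complex.continuous_conj.comp_aestronglyMeasurable (hfi i).1)
        (.of_forall fun x => by simp)
    refine (((hconj 0).integrable_mul (hgi 1)).add ((hconj 1).integrable_mul (hgi 0))).congr ?_
    filter_upwards [hu0, hu1, hv0, hv1] with x h1 h2 h3 h4
    simp [h1, h2, h3, h4]

end FreeDirac

/-! ### The resolvent of the free Dirac operator -/

section FreeResolvent

variable {k ζ : ℂ} {g : ℝ → C2}

/-- The part of the free resolvent coming from the left of `x`. -/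
noncomputable def leftPart (k ζ : ℂ) (g : ℝ → C2) : ℝ → ℂ :=
  causalConv k fun y => ζ * g y 0 + g y 1

/-- The part of the free resolvent coming from the right of `x`. -/
noncomputable def rightPart (k ζ : ℂ) (g : ℝ → C2) (x : ℝ) : ℂ :=
  causalConv k (fun y => ζ * g (-y) 0 - g (-y) 1) (-x)

/-- The reflection `x ↦ -x` composed with `σ₃` exchanges the two parts. -/
theorem rightPart_eq (k ζ : ℂ) (g : ℝ → C2) : rightPart k ζ g =
    fun x => leftPart k ζ (fun y => act sigma3 (g (-y))) (-x) := by
  funext x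
  simp only [rightPart, leftPart, act_apply, sigma3]
  simp [sub_eq_add_neg]

theorem memLp_reflect (hg : MemLp g 2 volume) : MemLp (fun y => act sigma3 (g (-y))) 2 volume :=
  (act sigma3).comp_memLp' (hg.comp_measurePreserving (Measure.measurePreserving_neg volume))

theorem norm_act_sigma3 (v : C2) : ‖act sigma3 v‖ = ‖v‖ := by
  rw [← sq_eq_sq₀ (norm_nonneg _) (norm_nonneg _), norm_sq_C2, norm_sq_C2]
  simp [act_apply, sigma3]

theorem norm_mul_add_sq_le (ζ : ℂ) (v : C2) :
    ‖ζ * v 0 + v 1‖ ^ 2 ≤ (‖ζ‖ ^ 2 + 1) * ‖v‖ ^ 2 := by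
  have h := norm_add_le (ζ * v 0) (v 1)
  rw [norm_mul] at h
  rw [norm_sq_C2]
  have h2 := pow_le_pow_left₀ (norm_nonneg _) h 2
  nlinarith [sq_nonneg (‖ζ‖ * ‖v 1‖ - ‖v 0‖)]

theorem memLp_left (hg : MemLp g 2 volume) : MemLp (fun y => ζ * g y 0 + g y 1) 2 volume :=
  ((memLp_apply hg 0).const_mul ζ).add (memLp_apply hg 1)

theorem leftPart_add (hk : 0 < k.im) {h : ℝ → C2} (hg : MemLp g 2 volume) (hh : MemLp h 2 volume) :
    leftPart k ζ (g + h) = leftPart k ζ g + leftPart k ζ h := by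
  rw [leftPart, leftPart, leftPart, ← causalConv_add hk (memLp_left hg) (memLp_left hh)]
  congr 1
  funext y
  simp only [Pi.add_apply, PiLp.add_apply]
  ring

theorem leftPart_smul (c : ℂ) : leftPart k ζ (c • g) = c • leftPart k ζ g := by
  rw [leftPart, leftPart, ← causalConv_smul]
  congr 1
  funext y
  simp only [Pi.smul_apply, PiLp.smul_apply, smul_eq_mul]
  ring

theorem leftPart_congr {h : ℝ → C2} (hgh : g =ᵐ[volume] h) : leftPart k ζ g = leftPart k ζ h := by
  refine causalConv_congr ?_
  filter_upwards [hgh] with y hy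
  rw [hy]

theorem norm_leftPart_sq_le (hk : 0 < k.im) (hg : MemLp g 2 volume) (x : ℝ) :
    ‖leftPart k ζ g x‖ ^ 2 ≤ (‖ζ‖ ^ 2 + 1) / (2 * k.im) * ∫ y in Set.Iic x, ‖g y‖ ^ 2 := by
  refine (norm_causalConv_sq_le hk (memLp_left hg) x).trans ?_
  rw [div_mul_eq_mul_div, div_mul_eq_mul_div, one_mul, ← integral_const_mul]
  refine div_le_div_of_nonneg_right
    (integral_mono ?_ ?_ fun y => norm_mul_add_sq_le ζ (g y)) (by positivity)
  · exact ((memLp_two_iff_integrable_sq_norm (memLp_left hg).1).1 (memLp_left hg)).integrableOn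
  · exact (((memLp_two_iff_integrable_sq_norm hg.1).1 hg).integrableOn).const_mul _

theorem norm_leftPart_le (hk : 0 < k.im) (hg : Integrable g volume) (x : ℝ) :
    ‖leftPart k ζ g x‖ ≤ (‖ζ‖ + 1) * ∫ y, ‖g y‖ := by
  have hi : ∀ i, Integrable (fun y => g y i) volume := fun i =>
    (EuclideanSpace.proj (𝕜 := ℂ) i).integrable_comp hg
  have h1 : Integrable (fun y => ζ * g y 0 + g y 1) volume := ((hi 0).const_mul ζ).add (hi 1)
  refine (norm_causalConv_le hk h1 x).trans ?_
  rw [← integral_const_mul]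
  refine integral_mono h1.norm (hg.norm.const_mul _) fun y => ?_
  refine (norm_add_le _ _).trans ?_
  rw [norm_mul, add_mul, one_mul]
  gcongr
  · exact PiLp.norm_apply_le (g y) 0
  · exact PiLp.norm_apply_le (g y) 1

theorem memLp_leftPart (hk : 0 < k.im) (hg : MemLp g 2 volume) :
    MemLp (leftPart k ζ g) 2 volume ∧
      ∫ x, ‖leftPart k ζ g x‖ ^ 2 ≤ (1 / k.im) ^ 2 * ((‖ζ‖ ^ 2 + 1) * ∫ x, ‖g x‖ ^ 2) := by
  obtain ⟨h1, h2⟩ := memLp_causalConv hk (memLp_left (ζ := ζ) hg)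
  refine ⟨h1, h2.trans ?_⟩
  gcongr
  rw [← integral_const_mul]
  refine integral_mono ?_ ?_ fun y => norm_mul_add_sq_le ζ (g y)
  · exact (memLp_two_iff_integrable_sq_norm (memLp_left hg).1).1 (memLp_left hg)
  · exact ((memLp_two_iff_integrable_sq_norm hg.1).1 hg).const_mul _

theorem isPrimitive_leftPart (hk : 0 < k.im) (hg : MemLp g 2 volume) :
    IsPrimitive (leftPart k ζ g)
      (fun x => Complex.I * k * leftPart k ζ g x + (ζ * g x 0 + g x 1)) :=
  isPrimitive_causalConv hk (memLp_left hg)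

theorem rightPart_add (hk : 0 < k.im) {h : ℝ → C2} (hg : MemLp g 2 volume)
    (hh : MemLp h 2 volume) : rightPart k ζ (g + h) = rightPart k ζ g + rightPart k ζ h := by
  have e : (fun y => act sigma3 ((g + h) (-y))) =
      (fun y => act sigma3 (g (-y))) + fun y => act sigma3 (h (-y)) := by
    funext y
    simp
  simp only [rightPart_eq, e, leftPart_add hk (memLp_reflect hg) (memLp_reflect hh)]
  rfl

theorem rightPart_smul (c : ℂ) : rightPart k ζ (c • g) = c • rightPart k ζ g := by
  have e : (fun y => act sigma3 ((c • g) (-y))) = c • fun y => act sigma3 (g (-y)) := by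
    funext y
    simp
  simp only [rightPart_eq, e, leftPart_smul]
  rfl

theorem rightPart_congr {h : ℝ → C2} (hgh : g =ᵐ[volume] h) :
    rightPart k ζ g = rightPart k ζ h := by
  rw [rightPart_eq, rightPart_eq]
  have : (fun y => act sigma3 (g (-y))) =ᵐ[volume] fun y => act sigma3 (h (-y)) := by
    filter_upwards [(Measure.measurePreserving_neg (volume : Measure ℝ)).quasiMeasurePreserving.ae
      hgh] with y hy
    rw [hy]
  rw [leftPart_congr this]

theorem norm_rightPart_sq_le (hk : 0 < k.im) (hg : MemLp g 2 volume) (x : ℝ) :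
    ‖rightPart k ζ g x‖ ^ 2 ≤ (‖ζ‖ ^ 2 + 1) / (2 * k.im) * ∫ y in Set.Ioi x, ‖g y‖ ^ 2 := by
  have h := norm_leftPart_sq_le (ζ := ζ) hk (memLp_reflect hg) (-x)
  simp only [norm_act_sigma3] at h
  rw [integral_comp_neg_Iic (-x) fun y => ‖g y‖ ^ 2, neg_neg] at h
  rwa [rightPart_eq]

theorem norm_rightPart_le (hk : 0 < k.im) (hg : Integrable g volume) (x : ℝ) :
    ‖rightPart k ζ g x‖ ≤ (‖ζ‖ + 1) * ∫ y, ‖g y‖ := by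
  have h := norm_leftPart_le (ζ := ζ) hk ((act sigma3).integrable_comp hg.comp_neg) (-x)
  simp only [norm_act_sigma3] at h
  rw [integral_neg_eq_self fun y => ‖g y‖] at h
  rwa [rightPart_eq]

theorem memLp_rightPart (hk : 0 < k.im) (hg : MemLp g 2 volume) :
    MemLp (rightPart k ζ g) 2 volume ∧
      ∫ x, ‖rightPart k ζ g x‖ ^ 2 ≤ (1 / k.im) ^ 2 * ((‖ζ‖ ^ 2 + 1) * ∫ x, ‖g x‖ ^ 2) := by
  obtain ⟨h1, h2⟩ := memLp_leftPart (ζ := ζ) hk (memLp_reflect hg)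
  simp only [norm_act_sigma3] at h2
  rw [integral_neg_eq_self fun y => ‖g y‖ ^ 2] at h2
  rw [rightPart_eq]
  refine ⟨h1.comp_measurePreserving (Measure.measurePreserving_neg volume), ?_⟩
  rwa [integral_neg_eq_self fun x => ‖leftPart k ζ (fun y => act sigma3 (g (-y))) x‖ ^ 2]

theorem isPrimitive_rightPart (hk : 0 < k.im) (hg : MemLp g 2 volume) :
    IsPrimitive (rightPart k ζ g)
      (fun x => -(Complex.I * k * rightPart k ζ g x + (ζ * g x 0 - g x 1))) := by
  have h := (isPrimitive_leftPart (ζ := ζ) hk (memLp_reflect hg)).comp_neg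
  rw [rightPart_eq]
  refine (congrArg₂ IsPrimitive rfl ?_).mp h
  funext x
  simp [act_apply, sigma3, sub_eq_add_neg]

/-- The value of `R₀(z) g`. With `p`, `q` the left and right parts it is
`(i / 2ζ) (p (ζ, 1) + q (ζ, -1))`, where `(ζ, ±1)` are the polarizations of the two exponential
solutions `e^{±ikx}` of the homogeneous equation. -/
noncomputable def resolventFun (k ζ : ℂ) (g : ℝ → C2) (x : ℝ) : C2 :=
  !₂[Complex.I / 2 * (leftPart k ζ g x + rightPart k ζ g x),
    Complex.I / (2 * ζ) * (leftPart k ζ g x - rightPart k ζ g x)]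

theorem resolventFun_zero (k ζ : ℂ) (g : ℝ → C2) (x : ℝ) : resolventFun k ζ g x 0 =
    Complex.I / 2 * (leftPart k ζ g x + rightPart k ζ g x) := rfl

theorem resolventFun_one (k ζ : ℂ) (g : ℝ → C2) (x : ℝ) : resolventFun k ζ g x 1 =
    Complex.I / (2 * ζ) * (leftPart k ζ g x - rightPart k ζ g x) := rfl

/-- The parallelogram law decouples the two parts. -/
theorem weighted_norm_resolventFun (hζ : ζ ≠ 0) (x : ℝ) :
    ‖resolventFun k ζ g x 0‖ ^ 2 + ‖ζ‖ ^ 2 * ‖resolventFun k ζ g x 1‖ ^ 2 =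
      (‖leftPart k ζ g x‖ ^ 2 + ‖rightPart k ζ g x‖ ^ 2) / 2 := by
  have h := parallelogram_law_with_norm ℝ (leftPart k ζ g x) (rightPart k ζ g x)
  have hn : ‖ζ‖ ≠ 0 := norm_ne_zero_iff.2 hζ
  rw [resolventFun_zero, resolventFun_one]
  simp only [norm_mul, norm_div, Complex.norm_I, Complex.norm_ofNat, mul_pow, div_pow]
  field_simp
  linarith

/-- The left part at `x` depends only on `g` on `(-∞, x]` and the right part only on `g` on `(x, ∞)`,
so that the two `L²` bounds add up to the full norm of `g` without loss. -/
theorem weighted_norm_resolventFun_le (hk : 0 < k.im) (hζ : ζ ≠ 0) (hg : MemLp g 2 volume)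
    (x : ℝ) : ‖resolventFun k ζ g x 0‖ ^ 2 + ‖ζ‖ ^ 2 * ‖resolventFun k ζ g x 1‖ ^ 2 ≤
      (‖ζ‖ ^ 2 + 1) / (4 * k.im) * ∫ y, ‖g y‖ ^ 2 := by
  rw [weighted_norm_resolventFun hζ]
  have h1 := norm_leftPart_sq_le (ζ := ζ) hk hg x
  have h2 := norm_rightPart_sq_le (ζ := ζ) hk hg x
  have hi : Integrable (fun y => ‖g y‖ ^ 2) volume :=
    (memLp_two_iff_integrable_sq_norm hg.1).1 hg
  have h3 := intervalIntegral.integral_Iic_add_Ioi (b := x) hi.integrableOn hi.integrableOn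
  rw [← h3]
  have : (‖ζ‖ ^ 2 + 1) / (4 * k.im) = (‖ζ‖ ^ 2 + 1) / (2 * k.im) / 2 := by
    field_simp
    norm_num
  rw [this]
  linarith

theorem weighted_norm_resolventFun_le_of_integrable (hk : 0 < k.im) (hζ : ζ ≠ 0)
    (hg : Integrable g volume) (x : ℝ) :
    ‖resolventFun k ζ g x 0‖ ^ 2 + ‖ζ‖ ^ 2 * ‖resolventFun k ζ g x 1‖ ^ 2 ≤
      ((‖ζ‖ + 1) * ∫ y, ‖g y‖) ^ 2 := by
  rw [weighted_norm_resolventFun hζ]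
  have h1 := pow_le_pow_left₀ (norm_nonneg _) (norm_leftPart_le (ζ := ζ) hk hg x) 2
  have h2 := pow_le_pow_left₀ (norm_nonneg _) (norm_rightPart_le (ζ := ζ) hk hg x) 2
  linarith

theorem eq_smul_single_add (f : ℝ → C2) : f =
    (fun x => f x 0 • (EuclideanSpace.single 0 (1 : ℂ) : C2)) +
      fun x => f x 1 • (EuclideanSpace.single 1 (1 : ℂ) : C2) := by
  funext x
  ext i
  fin_cases i <;> simp

theorem memLp_C2 {f : ℝ → C2} (h0 : MemLp (fun x => f x 0) 2 volume)
    (h1 : MemLp (fun x => f x 1) 2 volume) : MemLp f 2 volume := by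
  rw [eq_smul_single_add f]
  refine MemLp.add ?_ ?_
  · exact ((ContinuousLinearMap.id ℂ ℂ).smulRight
      (EuclideanSpace.single 0 (1 : ℂ) : C2)).comp_memLp' h0
  · exact ((ContinuousLinearMap.id ℂ ℂ).smulRight
      (EuclideanSpace.single 1 (1 : ℂ) : C2)).comp_memLp' h1

theorem memLp_resolventFun (hk : 0 < k.im) (hg : MemLp g 2 volume) :
    MemLp (resolventFun k ζ g) 2 volume :=
  memLp_C2 (((memLp_leftPart hk hg).1.add (memLp_rightPart hk hg).1).const_mul _)
    (((memLp_leftPart hk hg).1.sub (memLp_rightPart hk hg).1).const_mul _)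

theorem integral_norm_resolventFun_le (hk : 0 < k.im) (hζ : ζ ≠ 0) (hg : MemLp g 2 volume) :
    ∫ x, ‖resolventFun k ζ g x‖ ^ 2 ≤
      (1 + 1 / ‖ζ‖ ^ 2) * ((1 / k.im) ^ 2 * ((‖ζ‖ ^ 2 + 1) * ∫ x, ‖g x‖ ^ 2)) := by
  have hn : 0 < ‖ζ‖ ^ 2 := by positivity
  obtain ⟨hl, hl2⟩ := memLp_leftPart (ζ := ζ) hk hg
  obtain ⟨hr, hr2⟩ := memLp_rightPart (ζ := ζ) hk hg
  have il := (memLp_two_iff_integrable_sq_norm hl.1).1 hl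
  have ir := (memLp_two_iff_integrable_sq_norm hr.1).1 hr
  have hu := memLp_resolventFun (ζ := ζ) hk hg
  have h1 : ∫ x, ‖resolventFun k ζ g x‖ ^ 2 ≤ ∫ x, (1 + 1 / ‖ζ‖ ^ 2) *
      ((‖leftPart k ζ g x‖ ^ 2 + ‖rightPart k ζ g x‖ ^ 2) / 2) := by
    refine integral_mono ((memLp_two_iff_integrable_sq_norm hu.1).1 hu)
      (((il.add ir).div_const 2).const_mul _) fun x => ?_
    rw [← weighted_norm_resolventFun hζ, norm_sq_C2]
    have e : (1 + 1 / ‖ζ‖ ^ 2) * (‖resolventFun k ζ g x 0‖ ^ 2 +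
        ‖ζ‖ ^ 2 * ‖resolventFun k ζ g x 1‖ ^ 2) = ‖resolventFun k ζ g x 0‖ ^ 2 +
        ‖resolventFun k ζ g x 1‖ ^ 2 + (1 / ‖ζ‖ ^ 2 * ‖resolventFun k ζ g x 0‖ ^ 2 +
        ‖ζ‖ ^ 2 * ‖resolventFun k ζ g x 1‖ ^ 2) := by
      field_simp
      ring
    rw [e]
    exact le_add_of_nonneg_right (by positivity)
  refine h1.trans ?_
  rw [integral_const_mul, integral_div, integral_add il ir]
  gcongr
  linarith

/-- The free resolvent as a bounded operator. -/
theorem exists_freeResolvent_clm (hk : 0 < k.im) (hζ : ζ ≠ 0) :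
    ∃ R : L2 →L[ℂ] L2, ∀ g : L2, ∀ᵐ x, R g x = resolventFun k ζ g x := by
  have hm : ∀ g : L2, MemLp (resolventFun k ζ g) 2 volume := fun g =>
    memLp_resolventFun hk (Lp.memLp g)
  set C : ℝ := (1 + 1 / ‖ζ‖ ^ 2) * ((1 / k.im) ^ 2 * (‖ζ‖ ^ 2 + 1)) with hC
  have hC0 : 0 ≤ C := by positivity
  let T : L2 →ₗ[ℂ] L2 :=
    { toFun := fun g => (hm g).toLp _
      map_add' := fun f g => by
        rw [← MemLp.toLp_add (hm f) (hm g)]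
        refine MemLp.toLp_congr _ _ (.of_forall fun x => ?_)
        have e1 : leftPart k ζ (f + g : L2) = leftPart k ζ f + leftPart k ζ g := by
          rw [← leftPart_add hk (Lp.memLp f) (Lp.memLp g), leftPart_congr (Lp.coeFn_add f g)]
        have e2 : rightPart k ζ (f + g : L2) = rightPart k ζ f + rightPart k ζ g := by
          rw [← rightPart_add hk (Lp.memLp f) (Lp.memLp g), rightPart_congr (Lp.coeFn_add f g)]
        ext i
        fin_cases i
        · change Complex.I / 2 * (leftPart k ζ (f + g : L2) x + rightPart k ζ (f + g : L2) x) =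
            resolventFun k ζ f x 0 + resolventFun k ζ g x 0
          rw [e1, e2, resolventFun_zero, resolventFun_zero, Pi.add_apply, Pi.add_apply]
          ring
        · change Complex.I / (2 * ζ) * (leftPart k ζ (f + g : L2) x -
            rightPart k ζ (f + g : L2) x) = resolventFun k ζ f x 1 + resolventFun k ζ g x 1
          rw [e1, e2, resolventFun_one, resolventFun_one, Pi.add_apply, Pi.add_apply]
          ring
      map_smul' := fun c f => by
        rw [RingHom.id_apply, ← MemLp.toLp_const_smul c (hm f)]
        refine MemLp.toLp_congr _ _ (.of_forall fun x => ?_)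
        have e1 : leftPart k ζ (c • f : L2) = c • leftPart k ζ f := by
          rw [← leftPart_smul, leftPart_congr (Lp.coeFn_smul c f)]
        have e2 : rightPart k ζ (c • f : L2) = c • rightPart k ζ f := by
          rw [← rightPart_smul, rightPart_congr (Lp.coeFn_smul c f)]
        ext i
        fin_cases i
        · change Complex.I / 2 * (leftPart k ζ (c • f : L2) x + rightPart k ζ (c • f : L2) x) =
            c * resolventFun k ζ f x 0
          rw [e1, e2, resolventFun_zero, Pi.smul_apply, Pi.smul_apply, smul_eq_mul, smul_eq_mul]
          ring
        · change Complex.I / (2 * ζ) * (leftPart k ζ (c • f : L2) x -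
            rightPart k ζ (c • f : L2) x) = c * resolventFun k ζ f x 1
          rw [e1, e2, resolventFun_one, Pi.smul_apply, Pi.smul_apply, smul_eq_mul, smul_eq_mul]
          ring }
  refine ⟨T.mkContinuous √C fun g => ?_, fun g => (hm g).coeFn_toLp⟩
  have h := integral_norm_resolventFun_le hk hζ (Lp.memLp g)
  refine (sq_le_sq₀ (norm_nonneg _) (by positivity)).1 ?_
  rw [mul_pow, Real.sq_sqrt hC0, norm_sq_L2, norm_sq_L2]
  have e : ∫ x, ‖T g x‖ ^ 2 = ∫ x, ‖resolventFun k ζ g x‖ ^ 2 := by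
    refine integral_congr_ae ?_
    filter_upwards [(hm g).coeFn_toLp] with x hx
    change ‖(hm g).toLp _ x‖ ^ 2 = _
    rw [hx]
  rw [e]
  refine h.trans_eq ?_
  rw [hC]
  ring

/-- `resolventFun` inverts `H₀ - z`. -/
theorem mem_graph_freeResolvent {m : ℝ} {z : ℂ} (hk : 0 < k.im) (hζ : ζ ≠ 0) (h1 : k * ζ = z + m)
    (h2 : ζ * (z - m) = k) {R : L2 →L[ℂ] L2}
    (hR : ∀ g : L2, ∀ᵐ x, R g x = resolventFun k ζ g x) (g : L2) :
    (R g, g + z • R g) ∈ (freeDirac m).graph := by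
  have hl := isPrimitive_leftPart (ζ := ζ) hk (Lp.memLp g)
  have hr := isPrimitive_rightPart (ζ := ζ) hk (Lp.memLp g)
  have hae : ∀ᵐ x, (g + z • R g : L2) x = g x + z • resolventFun k ζ g x ∧
      R g x = resolventFun k ζ g x := by
    filter_upwards [hR g, Lp.coeFn_add g (z • R g), Lp.coeFn_smul z (R g)] with x h1 h2 h3
    rw [h2, Pi.add_apply, h3, Pi.smul_apply, h1]
    exact ⟨rfl, rfl⟩
  refine mem_graph_freeDirac.2 ⟨fun x => resolventFun k ζ g x 0, fun x => resolventFun k ζ g x 1,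
    ?_, ?_, ?_, ?_⟩
  · filter_upwards [hR g] with x hx
    rw [hx]
  · filter_upwards [hR g] with x hx
    rw [hx]
  · refine ((hl.add hr).const_mul (Complex.I / 2)).congr_ae ?_
    filter_upwards [hae] with x hx
    rw [hx.1, hx.2]
    simp only [Pi.add_apply, PiLp.add_apply, PiLp.smul_apply, smul_eq_mul, resolventFun_one]
    have : Complex.I * (g x 1 + z * (Complex.I / (2 * ζ) * (leftPart k ζ g x - rightPart k ζ g x)) +
        m * (Complex.I / (2 * ζ) * (leftPart k ζ g x - rightPart k ζ g x))) =
        Complex.I * g x 1 + Complex.I * ((z + m) * (Complex.I / (2 * ζ) *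
          (leftPart k ζ g x - rightPart k ζ g x))) := by ring
    rw [this, ← h1]
    field_simp
    ring
  · have hd := hl.add (hr.const_mul (-1))
    have hfun : (fun x => resolventFun k ζ g x 1) = fun x => Complex.I / (2 * ζ) *
        (leftPart k ζ g + fun x => -1 * rightPart k ζ g x) x := by
      funext x
      rw [resolventFun_one, Pi.add_apply]
      ring
    rw [hfun]
    refine (hd.const_mul (Complex.I / (2 * ζ))).congr_ae ?_
    filter_upwards [hae] with x hx
    rw [hx.1, hx.2]
    simp only [Pi.add_apply, PiLp.add_apply, PiLp.smul_apply, smul_eq_mul, resolventFun_zero]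
    rw [← h2]
    field_simp
    ring

end FreeResolvent

/-! ### Square roots of positive semidefinite matrices -/

section MatrixSqrt

theorem continuousOn_spectrum (M : Mat) (f : ℝ → ℝ) : ContinuousOn f (_root_.spectrum ℝ M) :=
  M.finite_real_spectrum.continuousOn f

variable {V : Mat}

theorem spectrum_nonneg_of_posSemidef (hV : V.PosSemidef) {t : ℝ} (ht : t ∈ _root_.spectrum ℝ V) :
    0 ≤ t := by
  rw [hV.1.spectrum_real_eq_range_eigenvalues] at ht
  obtain ⟨i, rfl⟩ := ht
  exact hV.eigenvalues_nonneg i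

theorem matAbs_I_smul (hV : V.PosSemidef) : matAbs (Complex.I • V) = V := by
  have hs : IsSelfAdjoint V := hV.1
  have h1 : (Complex.I • V)ᴴ * (Complex.I • V) = V ^ 2 := by
    rw [Matrix.conjTranspose_smul, hV.1.eq, smul_mul_smul_comm, sq]
    simp
  rw [matAbs, h1, ← cfc_comp_pow Real.sqrt 2 V Real.continuous_sqrt.continuousOn]
  exact (cfc_congr (g := id) fun t ht =>
    Real.sqrt_sq (spectrum_nonneg_of_posSemidef hV ht)).trans (cfc_id ℝ V)

theorem matAbsSqrt_I_smul (hV : V.PosSemidef) :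
    matAbsSqrt (Complex.I • V) = cfc Real.sqrt V := by
  rw [matAbsSqrt, matAbs_I_smul hV]

theorem posSemidef_cfc_sqrt (V : Mat) : (cfc Real.sqrt V).PosSemidef := by
  have h : cfc Real.sqrt V = (cfc (fun t => √√t) V)ᴴ * cfc (fun t => √√t) V := by
    have hs : IsSelfAdjoint (cfc (fun t => √√t) V) := cfc_predicate _ _
    rw [← Matrix.star_eq_conjTranspose, hs.star_eq,
      ← cfc_mul _ _ V (continuousOn_spectrum _ _) (continuousOn_spectrum _ _)]
    congr 1
    funext t
    exact (Real.mul_self_sqrt (Real.sqrt_nonneg t)).symm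
  rw [h]
  exact Matrix.posSemidef_conjTranspose_mul_self _

theorem cfc_sqrt_mul_self (hV : V.PosSemidef) : cfc Real.sqrt V * cfc Real.sqrt V = V := by
  have hs : IsSelfAdjoint V := hV.1
  rw [← cfc_mul _ _ V (continuousOn_spectrum _ _) (continuousOn_spectrum _ _)]
  exact (cfc_congr (g := id) fun t ht =>
    Real.mul_self_sqrt (spectrum_nonneg_of_posSemidef hV ht)).trans (cfc_id ℝ V)

/-- For `V = i W` with `W ≥ 0` the second factor `U |V|^{1/2}` is `i W^{1/2}`. -/
theorem polarU_mul_matAbsSqrt (hV : V.PosSemidef) :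
    polarU (Complex.I • V) * matAbsSqrt (Complex.I • V) = Complex.I • cfc Real.sqrt V := by
  have hs : IsSelfAdjoint V := hV.1
  rw [polarU, matAbsSqrt_I_smul hV, matAbs_I_smul hV, smul_mul_assoc, smul_mul_assoc]
  congr 1
  nth_rewrite 1 [← cfc_id ℝ V]
  rw [← cfc_mul _ _ V (continuousOn_spectrum _ _) (continuousOn_spectrum _ _),
    ← cfc_mul _ _ V (continuousOn_spectrum _ _) (continuousOn_spectrum _ _)]
  refine cfc_congr fun t ht => ?_
  rcases (spectrum_nonneg_of_posSemidef hV ht).eq_or_lt with h | h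
  · simp [← h]
  · simp [h.ne']

/-- The Cayley–Hamilton formula for the square root of a `2 × 2` matrix. It makes the measurability
of the square root evident. -/
theorem cfc_sqrt_apply (hV : V.PosSemidef) (i j : Fin 2) : cfc Real.sqrt V i j =
    (V i j + (√V.det.re : ℝ) * (1 : Mat) i j) / (√(V.trace.re + 2 * √V.det.re) : ℝ) := by
  set S := cfc Real.sqrt V with hS
  have hp : S.PosSemidef := posSemidef_cfc_sqrt V
  have hV2 : V = S * S := (cfc_sqrt_mul_self hV).symm
  obtain ⟨a, ha0, ha⟩ : ∃ a : ℝ, 0 ≤ a ∧ S 0 0 = a := by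
    have := hp.diag_nonneg (i := 0)
    rw [Complex.nonneg_iff] at this
    exact ⟨_, this.1, Complex.ext rfl this.2.symm⟩
  obtain ⟨c, hc0, hc⟩ : ∃ c : ℝ, 0 ≤ c ∧ S 1 1 = c := by
    have := hp.diag_nonneg (i := 1)
    rw [Complex.nonneg_iff] at this
    exact ⟨_, this.1, Complex.ext rfl this.2.symm⟩
  set b := S 0 1 with hb
  have hb' : S 1 0 = (starRingEnd ℂ) b := (hp.1.apply 1 0).symm
  have hbb : b * (starRingEnd ℂ) b = ((‖b‖ ^ 2 : ℝ) : ℂ) := by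
    rw [Complex.mul_conj, Complex.normSq_eq_norm_sq]
  have hdet : S.det = ((a * c - ‖b‖ ^ 2 : ℝ) : ℂ) := by
    rw [Matrix.det_fin_two, ha, hc, ← hb, hb', hbb]
    push_cast
    ring
  have hdet0 : 0 ≤ a * c - ‖b‖ ^ 2 := by
    have := hp.det_nonneg
    rw [hdet] at this
    exact_mod_cast this
  have hVdet : √V.det.re = a * c - ‖b‖ ^ 2 := by
    rw [hV2, Matrix.det_mul, hdet, ← Complex.ofReal_mul, Complex.ofReal_re,
      Real.sqrt_mul_self hdet0]
  have h00 : V 0 0 = ((a ^ 2 + ‖b‖ ^ 2 : ℝ) : ℂ) := by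
    rw [hV2, Matrix.mul_apply, Fin.sum_univ_two, ha, ← hb, hb', hbb]
    push_cast
    ring
  have h11 : V 1 1 = ((c ^ 2 + ‖b‖ ^ 2 : ℝ) : ℂ) := by
    rw [hV2, Matrix.mul_apply, Fin.sum_univ_two, hc, ← hb, hb', mul_comm ((starRingEnd ℂ) b), hbb]
    push_cast
    ring
  have h01 : V 0 1 = b * (a + c) := by
    rw [hV2, Matrix.mul_apply, Fin.sum_univ_two, ha, hc, ← hb]
    ring
  have h10 : V 1 0 = (starRingEnd ℂ) b * (a + c) := by
    rw [hV2, Matrix.mul_apply, Fin.sum_univ_two, ha, hc, hb']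
    ring
  have htr : √(V.trace.re + 2 * √V.det.re) = a + c := by
    rw [hVdet, Matrix.trace_fin_two, h00, h11, ← Complex.ofReal_add, Complex.ofReal_re]
    have : a ^ 2 + ‖b‖ ^ 2 + (c ^ 2 + ‖b‖ ^ 2) + 2 * (a * c - ‖b‖ ^ 2) = (a + c) ^ 2 := by ring
    rw [this, Real.sqrt_sq (by positivity)]
  rw [htr, hVdet]
  rcases (add_nonneg ha0 hc0).eq_or_lt with h | h
  · -- a vanishing trace forces the square root to vanish
    have ha' : a = 0 := by linarith
    have hc' : c = 0 := by linarith
    have hb0 : b = 0 := by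
      rw [ha', zero_mul, zero_sub, neg_nonneg] at hdet0
      simpa using le_antisymm hdet0 (sq_nonneg _)
    rw [← h, Complex.ofReal_zero, div_zero]
    fin_cases i <;> fin_cases j
    · simpa [ha'] using ha
    · exact hb0
    · simpa [hb0] using hb'
    · simpa [hc'] using hc
  · have hne : ((a + c : ℝ) : ℂ) ≠ 0 := by exact_mod_cast h.ne'
    rw [eq_div_iff hne]
    fin_cases i <;> fin_cases j
    · change S 0 0 * _ = V 0 0 + _ * (1 : Mat) 0 0
      rw [ha, h00, Matrix.one_apply_eq]
      push_cast
      ring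
    · change S 0 1 * _ = V 0 1 + _ * (1 : Mat) 0 1
      rw [← hb, h01, Matrix.one_apply_ne (by decide)]
      push_cast
      ring
    · change S 1 0 * _ = V 1 0 + _ * (1 : Mat) 1 0
      rw [hb', h10, Matrix.one_apply_ne (by decide)]
      push_cast
      ring
    · change S 1 1 * _ = V 1 1 + _ * (1 : Mat) 1 1
      rw [hc, h11, Matrix.one_apply_eq]
      push_cast
      ring

end MatrixSqrt

/-! ### Multiplication by the square root of an integrable matrix function -/

section Multiplication

/-- `M` is a measurable Hermitian square root of the matrix function `W`, whose diagonal entries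
are integrable. -/
structure IsSqrtWeight (M W : ℝ → Mat) : Prop where
  aestronglyMeasurable : ∀ i j, AEStronglyMeasurable (fun x => M x i j) volume
  isHermitian : ∀ᵐ x, (M x).IsHermitian
  mul_self : ∀ᵐ x, M x * M x = W x
  integrable : ∀ i, Integrable (fun x => W x i i) volume

theorem aestronglyMeasurable_C2 {f : ℝ → C2}
    (h : ∀ i, AEStronglyMeasurable (fun x => f x i) volume) :
    AEStronglyMeasurable f volume := by
  rw [eq_smul_single_add f]
  exact ((h 0).smul_const _).add ((h 1).smul_const _)

theorem mem_graph_mulOp {M : ℝ → Mat} {f u : L2} :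
    (f, u) ∈ (mulOp M).graph ↔ ∀ᵐ x, u x = act (M x) (f x) := by
  rw [mem_graph_iff_exists]
  constructor
  · rintro ⟨hf, rfl⟩
    exact (memLp_of_mem hf).coeFn_toLp
  · intro h
    have hm : MemLp (pmul M f) 2 volume := (Lp.memLp u).ae_eq h
    refine ⟨hm, Lp.ext ?_⟩
    filter_upwards [hm.coeFn_toLp, h] with x h1 h2
    exact h1.trans h2.symm

/-- Cauchy–Schwarz with weights. -/
theorem norm_mul_add_mul_sq_le {c : ℝ} (hc : 0 < c) (a b v w : ℂ) :
    ‖a * v + b * w‖ ^ 2 ≤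
      (‖a‖ ^ 2 + ‖b‖ ^ 2 / c ^ 2) * (‖v‖ ^ 2 + c ^ 2 * ‖w‖ ^ 2) := by
  have h := norm_add_le (a * v) (b * w)
  rw [norm_mul, norm_mul] at h
  have h2 := pow_le_pow_left₀ (norm_nonneg _) h 2
  have e : (‖a‖ ^ 2 + ‖b‖ ^ 2 / c ^ 2) * (‖v‖ ^ 2 + c ^ 2 * ‖w‖ ^ 2) =
      (‖a‖ * ‖v‖ + ‖b‖ * ‖w‖) ^ 2 + (c * ‖a‖ * ‖w‖ - ‖b‖ * ‖v‖ / c) ^ 2 := by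
    field_simp
    ring
  rw [e]
  have := sq_nonneg (c * ‖a‖ * ‖w‖ - ‖b‖ * ‖v‖ / c)
  linarith

theorem norm_act_sq_le {M : Mat} (hM : M.IsHermitian) {c : ℝ} (hc : 0 < c) (v : C2) :
    ‖act M v‖ ^ 2 ≤ (‖(M * M) 0 0‖ + ‖(M * M) 1 1‖ / c ^ 2) * (‖v 0‖ ^ 2 + c ^ 2 * ‖v 1‖ ^ 2) := by
  have hdiag : ∀ j, ‖(M * M) j j‖ = ‖M 0 j‖ ^ 2 + ‖M 1 j‖ ^ 2 := by
    intro j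
    have : (M * M) j j = ((‖M 0 j‖ ^ 2 + ‖M 1 j‖ ^ 2 : ℝ) : ℂ) := by
      rw [Matrix.mul_apply, Fin.sum_univ_two, ← hM.apply j 0, ← hM.apply j 1]
      simp only [RCLike.star_def, ← Complex.normSq_eq_conj_mul_self, Complex.normSq_eq_norm_sq]
      push_cast
      ring
    rw [this, Complex.norm_real, Real.norm_of_nonneg (by positivity)]
  rw [norm_sq_C2, act_apply, act_apply, hdiag, hdiag]
  have h0 := norm_mul_add_mul_sq_le hc (M 0 0) (M 0 1) (v 0) (v 1)
  have h1 := norm_mul_add_mul_sq_le hc (M 1 0) (M 1 1) (v 0) (v 1)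
  refine (add_le_add h0 h1).trans_eq ?_
  ring

namespace IsSqrtWeight

variable {M W : ℝ → Mat}

theorem norm_act_sq_le (h : IsSqrtWeight M W) {c : ℝ} (hc : 0 < c) : ∀ᵐ x, ∀ v : C2,
    ‖act (M x) v‖ ^ 2 ≤
      (‖W x 0 0‖ + ‖W x 1 1‖ / c ^ 2) * (‖v 0‖ ^ 2 + c ^ 2 * ‖v 1‖ ^ 2) := by
  filter_upwards [h.isHermitian, h.mul_self] with x h1 h2 v
  rw [← h2]
  exact DiracOp.norm_act_sq_le h1 hc v

theorem norm_act_sq_le_trace (h : IsSqrtWeight M W) : ∀ᵐ x, ∀ v : C2,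
    ‖act (M x) v‖ ^ 2 ≤ (‖W x 0 0‖ + ‖W x 1 1‖) * ‖v‖ ^ 2 := by
  filter_upwards [h.norm_act_sq_le one_pos] with x hx v
  rw [norm_sq_C2 v]
  simpa using hx v

theorem aestronglyMeasurable_act (h : IsSqrtWeight M W) {f : ℝ → C2}
    (hf : AEStronglyMeasurable f volume) :
    AEStronglyMeasurable (fun x => act (M x) (f x)) volume := by
  refine aestronglyMeasurable_C2 fun i => ?_
  simp only [act_apply]
  have hfi : ∀ j, AEStronglyMeasurable (fun x => f x j) volume := fun j =>
    (EuclideanSpace.proj (𝕜 := ℂ) j).continuous.comp_aestronglyMeasurable hf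
  exact ((h.aestronglyMeasurable i 0).mul (hfi 0)).add ((h.aestronglyMeasurable i 1).mul (hfi 1))

theorem integrable_weight (h : IsSqrtWeight M W) (c : ℝ) :
    Integrable (fun x => ‖W x 0 0‖ + ‖W x 1 1‖ / c) volume ∧
      ∫ x, (‖W x 0 0‖ + ‖W x 1 1‖ / c) = (∫ x, ‖W x 0 0‖) + (∫ x, ‖W x 1 1‖) / c := by
  have h0 := (h.integrable 0).norm
  have h1 := (h.integrable 1).norm
  exact ⟨h0.add (h1.div_const c), by rw [integral_add h0 (h1.div_const c), integral_div]⟩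

/-- Bounded functions belong to the domain of the multiplication operator. -/
theorem exists_mem_graph (h : IsSqrtWeight M W) {c S : ℝ} (hc : 0 < c) {f : L2}
    (hf : ∀ᵐ x, ‖f x 0‖ ^ 2 + c ^ 2 * ‖f x 1‖ ^ 2 ≤ S) :
    ∃ u, (f, u) ∈ (mulOp M).graph ∧
      ‖u‖ ^ 2 ≤ ((∫ x, ‖W x 0 0‖) + (∫ x, ‖W x 1 1‖) / c ^ 2) * S := by
  obtain ⟨hwi, hwe⟩ := h.integrable_weight (c ^ 2)
  have hb : ∀ᵐ x, ‖act (M x) (f x)‖ ^ 2 ≤ (‖W x 0 0‖ + ‖W x 1 1‖ / c ^ 2) * S := by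
    filter_upwards [h.norm_act_sq_le hc, hf] with x h1 h2
    exact (h1 (f x)).trans (by gcongr)
  have hms := h.aestronglyMeasurable_act (Lp.memLp f).1
  have hi : Integrable (fun x => ‖act (M x) (f x)‖ ^ 2) volume := by
    refine (hwi.mul_const S).mono' (hms.norm.pow 2) ?_
    filter_upwards [hb] with x hx
    rwa [Real.norm_of_nonneg (by positivity)]
  have hm : MemLp (fun x => act (M x) (f x)) 2 volume :=
    (memLp_two_iff_integrable_sq_norm hms).2 hi
  refine ⟨hm.toLp _, mem_graph_mulOp.2 hm.coeFn_toLp, ?_⟩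
  rw [norm_sq_L2, ← hwe, ← integral_mul_const]
  have e : ∫ x, ‖hm.toLp _ x‖ ^ 2 = ∫ x, ‖act (M x) (f x)‖ ^ 2 := by
    refine integral_congr_ae ?_
    filter_upwards [hm.coeFn_toLp] with x hx
    rw [hx]
  rw [e]
  exact integral_mono_ae hi (hwi.mul_const S) hb

theorem isSymm (h : IsSqrtWeight M W) : IsSymm (mulOp M) := by
  intro f g f' g' hf hg
  rw [mem_graph_mulOp] at hf hg
  rw [L2.inner_def, L2.inner_def]
  refine integral_congr_ae ?_
  filter_upwards [hf, hg, h.isHermitian] with x h1 h2 h3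
  rw [h1, h2, inner_C2, inner_C2]
  simp only [act_apply, map_add, map_mul]
  have e : ∀ i j, (starRingEnd ℂ) (M x i j) = M x j i := fun i j => h3.apply j i
  rw [e, e, e, e]
  ring

/-- The product of the weight with an `L²` function is integrable when it is in `L²`. -/
theorem integrable_of_mem_graph (h : IsSqrtWeight M W) {f u : L2} (hu : (f, u) ∈ (mulOp M).graph) :
    Integrable u volume ∧
      ∫ x, ‖u x‖ ≤ √((∫ x, ‖W x 0 0‖) + (∫ x, ‖W x 1 1‖)) * ‖f‖ := by
  rw [mem_graph_mulOp] at hu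
  obtain ⟨hwi, hwe⟩ := h.integrable_weight 1
  simp only [div_one] at hwi hwe
  set w : ℝ → ℝ := fun x => √(‖W x 0 0‖ + ‖W x 1 1‖) with hw
  have hwsq : ∀ x, ‖w x‖ ^ 2 = ‖W x 0 0‖ + ‖W x 1 1‖ := fun x => by
    rw [hw, Real.norm_of_nonneg (Real.sqrt_nonneg _), Real.sq_sqrt (by positivity)]
  have hwm : AEStronglyMeasurable w volume :=
    Real.continuous_sqrt.comp_aestronglyMeasurable hwi.1
  have hw2 : MemLp w 2 volume :=
    (memLp_two_iff_integrable_sq_norm hwm).2 (hwi.congr (.of_forall fun x => (hwsq x).symm))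
  have hb : ∀ᵐ x, ‖u x‖ ≤ w x * ‖f x‖ := by
    filter_upwards [hu, h.norm_act_sq_le_trace] with x h1 h2
    refine (sq_le_sq₀ (norm_nonneg _) (by positivity)).1 ?_
    rw [h1, mul_pow, Real.sq_sqrt (by positivity)]
    exact h2 (f x)
  have hwf : Integrable (fun x => w x * ‖f x‖) volume := hw2.integrable_mul (Lp.memLp f).norm
  refine ⟨hwf.mono' (Lp.memLp u).1 hb, ?_⟩
  refine (integral_mono_ae (hwf.mono' (Lp.memLp u).1 hb).norm hwf hb).trans ?_
  have h2 : ENNReal.ofReal (2 : ℝ) = 2 := by norm_num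
  have hcs := integral_mul_norm_le_Lp_mul_Lq (μ := volume) (f := w) (g := fun x => ‖f x‖)
    (p := 2) (q := 2) (by constructor <;> norm_num) (by rwa [h2])
    (by rw [h2]; exact (Lp.memLp f).norm)
  simp only [Real.rpow_ofNat, ← Real.sqrt_eq_rpow, norm_norm, hwsq] at hcs
  rw [hwe, ← norm_sq_L2, Real.sqrt_sq (norm_nonneg _)] at hcs
  refine le_trans (le_of_eq ?_) hcs
  congr 1
  funext x
  rw [Real.norm_of_nonneg (Real.sqrt_nonneg _)]

/-- A function `h` orthogonal to the domain is orthogonal to `h / (1 + tr W)`. -/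
theorem dense_domain (h : IsSqrtWeight M W) : Dense ((mulOp M).domain : Set L2) := by
  refine (Submodule.dense_iff_topologicalClosure_eq_top).2 ?_
  rw [Submodule.topologicalClosure_eq_top_iff, Submodule.eq_bot_iff]
  intro f hf
  obtain ⟨hwi, -⟩ := h.integrable_weight 1
  simp only [div_one] at hwi
  set w : ℝ → ℝ := fun x => ‖W x 0 0‖ + ‖W x 1 1‖ with hw
  have hw0 : ∀ x, 0 ≤ w x := fun x => by positivity
  set r : ℝ → ℝ := fun x => (1 + w x)⁻¹ with hr
  have hr0 : ∀ x, 0 < r x := fun x => inv_pos.2 (by linarith [hw0 x])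
  have hr1 : ∀ x, r x ≤ 1 := fun x => inv_le_one_of_one_le₀ (by linarith [hw0 x])
  have hrw : ∀ x, w x * r x ^ 2 ≤ 1 := fun x => by
    have h1 : (1 + w x) * r x = 1 := mul_inv_cancel₀ (by linarith [hw0 x])
    nlinarith [hr0 x, hr1 x, hw0 x]
  have hrm : AEStronglyMeasurable r volume :=
    ((aemeasurable_const.add hwi.1.aemeasurable).inv).aestronglyMeasurable
  have hgm : MemLp (fun x => (r x : ℂ) • f x) 2 volume := by
    refine (Lp.memLp f).of_le
      ((Complex.continuous_ofReal.comp_aestronglyMeasurable hrm).smul (Lp.memLp f).1) ?_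
    refine .of_forall fun x => ?_
    rw [norm_smul, Complex.norm_real, Real.norm_of_nonneg (hr0 x).le]
    exact mul_le_of_le_one_left (norm_nonneg _) (hr1 x)
  set g := hgm.toLp _ with hg
  have hgd : g ∈ (mulOp M).domain := by
    have hms := h.aestronglyMeasurable_act (Lp.memLp g).1
    refine (Lp.memLp f).of_le hms ?_
    filter_upwards [hgm.coeFn_toLp, h.norm_act_sq_le_trace] with x h1 h2
    change ‖act (M x) (g x)‖ ≤ _
    refine (sq_le_sq₀ (norm_nonneg _) (norm_nonneg _)).1 ?_
    refine (h2 (g x)).trans ?_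
    rw [hg, h1, norm_smul, Complex.norm_real, Real.norm_of_nonneg (hr0 x).le, mul_pow, ← mul_assoc]
    exact mul_le_of_le_one_left (by positivity) (hrw x)
  have h0 := hf g hgd
  rw [L2.inner_def] at h0
  have e : ∀ᵐ x, inner ℂ (g x) (f x) = ((r x * ‖f x‖ ^ 2 : ℝ) : ℂ) := by
    filter_upwards [hgm.coeFn_toLp] with x hx
    rw [hg, hx, inner_smul_left, inner_self_eq_norm_sq_to_K, Complex.conj_ofReal]
    push_cast
    rfl
  rw [integral_congr_ae e, integral_complex_ofReal, Complex.ofReal_eq_zero,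
    integral_eq_zero_iff_of_nonneg (fun x => by have := (hr0 x).le; positivity)] at h0
  · refine Lp.ext ?_
    filter_upwards [h0, Lp.coeFn_zero C2 2 (volume : Measure ℝ)] with x h1 h2
    rw [h2]
    simpa [(hr0 x).ne'] using h1
  · refine (integrable_norm_sq f).mono' (hrm.mul ((Lp.memLp f).1.norm.pow 2)) ?_
    refine .of_forall fun x => ?_
    have := hr0 x
    rw [Real.norm_of_nonneg (by positivity)]
    exact mul_le_of_le_one_left (by positivity) (hr1 x)

end IsSqrtWeight

end Multiplication

/-! ### The spectral parameters -/

section Parameters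

/-- `k` is the square root of `z² - m²` in the upper half plane and `ζ = (z + m) / k`. -/
structure IsSpectralParam (m : ℝ) (z k ζ : ℂ) : Prop where
  im_pos : 0 < k.im
  ne_zero : ζ ≠ 0
  mul_eq : k * ζ = z + m
  mul_sub_eq : ζ * (z - m) = k

variable {m : ℝ} {z k ζ : ℂ}

theorem isSpectralParam_zeta (hz : ¬(z.im = 0 ∧ (z.re ≤ -m ∨ m ≤ z.re))) :
    IsSpectralParam m z (sqrtUpper (z ^ 2 - (m : ℂ) ^ 2)) (zeta m z) := by
  have hk : 0 < (sqrtUpper (z ^ 2 - (m : ℂ) ^ 2)).im := by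
    refine sqrtUpper_im_pos fun h => hz ?_
    simp only [sq, Complex.sub_re, Complex.sub_im, Complex.mul_re, Complex.mul_im,
      Complex.ofReal_re, Complex.ofReal_im] at h
    have him : z.im = 0 := by
      by_contra hne
      have hre : z.re = 0 := by
        have : z.re * z.im = 0 := by linarith [h.1]
        exact (mul_eq_zero.1 this).resolve_right hne
      have : 0 < z.im * z.im := mul_self_pos.2 hne
      have := h.2
      rw [hre] at this
      nlinarith
    refine ⟨him, ?_⟩
    have h2 := h.2
    rw [him] at h2
    rcases le_total 0 z.re with h0 | h0
    · exact .inr (abs_le_of_sq_le_sq' (by linarith) h0).2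
    · exact .inl (by linarith [(abs_le_of_sq_le_sq' (a := m) (b := -z.re) (by linarith)
        (by linarith)).2])
  set κ := sqrtUpper (z ^ 2 - (m : ℂ) ^ 2) with hκ
  have hκ0 : κ ≠ 0 := fun h => by simp [h] at hk
  have hsq : κ ^ 2 = (z + m) * (z - m) := by
    rw [hκ, sqrtUpper_sq]
    ring
  have h2 : zeta m z * (z - m) = κ := by
    rw [zeta, ← hκ, div_mul_eq_mul_div, ← hsq, sq, mul_div_cancel_right₀ _ hκ0]
  refine ⟨hk, fun h => hκ0 ?_, mul_div_cancel₀ _ hκ0, h2⟩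
  rw [← h2, h, zero_mul]

theorem IsSpectralParam.conj (h : IsSpectralParam m z k ζ) :
    IsSpectralParam m (starRingEnd ℂ z) (-starRingEnd ℂ k) (-starRingEnd ℂ ζ) := by
  refine ⟨by simpa using h.im_pos, by simpa using h.ne_zero, ?_, ?_⟩
  · simpa using congrArg (starRingEnd ℂ) h.mul_eq
  · simpa using congrArg (starRingEnd ℂ) h.mul_sub_eq

theorem IsSpectralParam.im_mul (h : IsSpectralParam m z k ζ) :
    z.im * (‖ζ‖ ^ 2 + 1) = 2 * k.im * ζ.re := by
  have e1 := congrArg Complex.im h.mul_eq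
  have e2 := congrArg Complex.re h.mul_sub_eq
  have e3 := congrArg Complex.im h.mul_sub_eq
  simp only [Complex.mul_re, Complex.mul_im, Complex.add_im, Complex.sub_re, Complex.sub_im,
    Complex.ofReal_re, Complex.ofReal_im] at e1 e2 e3
  rw [← Complex.normSq_eq_norm_sq, Complex.normSq_apply]
  linear_combination -e1 + ζ.re * e3 - ζ.im * e2

end Parameters

/-! ### The factorized resolvent data -/

section Data

variable {m : ℝ} {z k ζ : ℂ} {M N W : ℝ → Mat}

theorem exists_clm_mem_graph {E F : Type*} [NormedAddCommGroup E] [NormedSpace ℂ E]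
    [NormedAddCommGroup F] [NormedSpace ℂ F] {A : E →ₗ.[ℂ] F} {R : E →L[ℂ] E} {C : ℝ}
    (h : ∀ f, ∃ u, (R f, u) ∈ A.graph ∧ ‖u‖ ≤ C * ‖f‖) :
    ∃ D : E →L[ℂ] F, ∀ f, (R f, D f) ∈ A.graph := by
  choose D hD hb using h
  let T : E →ₗ[ℂ] F :=
    { toFun := D
      map_add' := fun f g => by
        have := A.graph.add_mem (hD f) (hD g)
        rw [Prod.mk_add_mk, ← map_add] at this
        exact graph_unique (hD (f + g)) this
      map_smul' := fun c f => by
        have := A.graph.smul_mem c (hD f)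
        rw [Prod.smul_mk, ← map_smul] at this
        exact graph_unique (hD (c • f)) this }
  exact ⟨T.mkContinuous C hb, hD⟩

theorem exists_freeResolvent (h : IsSpectralParam m z k ζ) : ∃ R : L2 →L[ℂ] L2,
    IsResolventAt (freeDirac m) z R ∧ ∀ g : L2, ∀ᵐ x, R g x = resolventFun k ζ g x := by
  obtain ⟨R, hR⟩ := exists_freeResolvent_clm h.im_pos h.ne_zero
  obtain ⟨R', hR'⟩ := exists_freeResolvent_clm h.conj.im_pos h.conj.ne_zero
  refine ⟨R, isResolventAt_of_isSymm (R' := R') (isSymm_freeDirac m) ?_ ?_, hR⟩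
  · exact mem_graph_freeResolvent h.im_pos h.ne_zero h.mul_eq h.mul_sub_eq hR
  · exact mem_graph_freeResolvent h.conj.im_pos h.conj.ne_zero h.conj.mul_eq h.conj.mul_sub_eq hR'

/-- The operator `A R₀(z)`, bounded on `L²` and, in terms of `L¹` norms, on `L¹ ∩ L²`. -/
theorem exists_left (h : IsSpectralParam m z k ζ) (hM : IsSqrtWeight M W) {R : L2 →L[ℂ] L2}
    (hR : ∀ g : L2, ∀ᵐ x, R g x = resolventFun k ζ g x) :
    ∃ D : L2 →L[ℂ] L2, (∀ f, (R f, D f) ∈ (mulOp M).graph) ∧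
      (∀ f, ‖D f‖ ^ 2 ≤ ((∫ x, ‖W x 0 0‖) + (∫ x, ‖W x 1 1‖) / ‖ζ‖ ^ 2) *
        ((‖ζ‖ ^ 2 + 1) / (4 * k.im) * ‖f‖ ^ 2)) ∧
      ∀ f : L2, Integrable f volume →
        ‖D f‖ ^ 2 ≤ ((∫ x, ‖W x 0 0‖) + (∫ x, ‖W x 1 1‖) / ‖ζ‖ ^ 2) *
          ((‖ζ‖ + 1) * ∫ x, ‖f x‖) ^ 2 := by
  have hζ : 0 < ‖ζ‖ := norm_pos_iff.2 h.ne_zero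
  have h2 : ∀ f : L2, ∃ u, (R f, u) ∈ (mulOp M).graph ∧ ‖u‖ ^ 2 ≤
      ((∫ x, ‖W x 0 0‖) + (∫ x, ‖W x 1 1‖) / ‖ζ‖ ^ 2) *
        ((‖ζ‖ ^ 2 + 1) / (4 * k.im) * ‖f‖ ^ 2) := fun f => by
    refine hM.exists_mem_graph hζ ?_
    filter_upwards [hR f] with x hx
    rw [hx, norm_sq_L2]
    exact weighted_norm_resolventFun_le h.im_pos h.ne_zero (Lp.memLp f) x
  have h1 : ∀ f : L2, Integrable f volume → ∃ u, (R f, u) ∈ (mulOp M).graph ∧ ‖u‖ ^ 2 ≤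
      ((∫ x, ‖W x 0 0‖) + (∫ x, ‖W x 1 1‖) / ‖ζ‖ ^ 2) *
        ((‖ζ‖ + 1) * ∫ x, ‖f x‖) ^ 2 := fun f hf => by
    refine hM.exists_mem_graph hζ ?_
    filter_upwards [hR f] with x hx
    rw [hx]
    exact weighted_norm_resolventFun_le_of_integrable h.im_pos h.ne_zero hf x
  have hk := h.im_pos
  obtain ⟨D, hD⟩ : ∃ D : L2 →L[ℂ] L2, ∀ f, (R f, D f) ∈ (mulOp M).graph := by
    refine exists_clm_mem_graph (C := √(((∫ x, ‖W x 0 0‖) + (∫ x, ‖W x 1 1‖) / ‖ζ‖ ^ 2) *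
        ((‖ζ‖ ^ 2 + 1) / (4 * k.im)))) fun f => ?_
    obtain ⟨u, hu, hb⟩ := h2 f
    refine ⟨u, hu, (sq_le_sq₀ (norm_nonneg _) (by positivity)).1 ?_⟩
    rwa [mul_pow, Real.sq_sqrt (by positivity), mul_assoc]
  refine ⟨D, hD, fun f => ?_, fun f hf => ?_⟩
  · obtain ⟨u, hu, hb⟩ := h2 f
    rwa [graph_unique (hD f) hu]
  · obtain ⟨u, hu, hb⟩ := h1 f hf
    rwa [graph_unique (hD f) hu]

theorem exists_mem_graph_of_ae_eq (hN : ∀ᵐ x, N x = Complex.I • M x) (f g : L2)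
    (h : (f, g) ∈ (mulOp N).graph) : ∃ g', (f, g') ∈ (mulOp M).graph ∧ g = Complex.I • g' := by
  refine ⟨(-Complex.I) • g, mem_graph_mulOp.2 ?_, by simp [smul_smul]⟩
  filter_upwards [mem_graph_mulOp.1 h, hN, Lp.coeFn_smul (-Complex.I) g] with x h1 h2 h3
  rw [h3, Pi.smul_apply, h1, h2]
  ext i
  simp only [PiLp.smul_apply, act_apply, Matrix.smul_apply, smul_eq_mul]
  linear_combination -(M x i 0 * f x 0 + M x i 1 * f x 1) * Complex.I_sq

theorem dense_domain_of_ae_eq (hM : IsSqrtWeight M W) (hN : ∀ᵐ x, N x = Complex.I • M x) :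
    Dense ((mulOp N).domain : Set L2) := by
  refine hM.dense_domain.mono fun f hf => ?_
  refine ((show MemLp (pmul M f) 2 volume from hf).const_smul Complex.I).ae_eq ?_
  filter_upwards [hN] with x hx
  ext i
  simp only [pmul, hx, Pi.smul_apply, PiLp.smul_apply, act_apply, Matrix.smul_apply, smul_eq_mul]
  ring

/-- The bound on `cl(R₀(z) B)` is the one on its adjoint `-i A R₀(z̄)`; the constants match
those of the condition `Re ζ ‖W₁₁‖₁ + Re ζ⁻¹ ‖W₂₂‖₁ < 2`. -/
theorem exists_data (h : IsSpectralParam m z k ζ) (hM : IsSqrtWeight M W)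
    (hN : ∀ᵐ x, N x = Complex.I • M x) :
    ∃ R D K Q, ResolventData (freeDirac m) (mulOp M) (mulOp N) z R D K Q ∧
      ∀ v, ‖K v‖ ^ 2 ≤ ((∫ x, ‖W x 0 0‖) + (∫ x, ‖W x 1 1‖) / ‖ζ‖ ^ 2) *
        ((‖ζ‖ ^ 2 + 1) / (4 * k.im)) * ‖v‖ ^ 2 := by
  obtain ⟨R, hR, hRf⟩ := exists_freeResolvent h
  obtain ⟨R', hR', hRf'⟩ := exists_freeResolvent h.conj
  obtain ⟨D, hD, -, hD1⟩ := exists_left h hM hRf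
  obtain ⟨D', hD', hD2, -⟩ := exists_left h.conj hM hRf'
  have hk := h.im_pos
  set a := (∫ x, ‖W x 0 0‖) + (∫ x, ‖W x 1 1‖) / ‖ζ‖ ^ 2 with ha
  have ha0 : 0 ≤ a := by positivity
  obtain ⟨K, Q, hK, hn⟩ := exists_resolventData (isSymm_freeDirac m) hM.isSymm
    (exists_mem_graph_of_ae_eq hN) (dense_domain_of_ae_eq hM hN) hR hR' hD hD'
    (C := √a * ((‖ζ‖ + 1) * √((∫ x, ‖W x 0 0‖) + (∫ x, ‖W x 1 1‖)))) (fun f g hg => by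
      obtain ⟨g', hg', rfl⟩ := exists_mem_graph_of_ae_eq hN f g hg
      obtain ⟨hi, hb⟩ := hM.integrable_of_mem_graph hg'
      rw [map_smul, norm_smul, Complex.norm_I, one_mul]
      refine (sq_le_sq₀ (norm_nonneg _) (by positivity)).1 ((hD1 g' hi).trans ?_)
      rw [mul_assoc (√a), mul_pow (√a), Real.sq_sqrt ha0, mul_assoc (‖ζ‖ + 1)]
      have : 0 ≤ ∫ x, ‖g' x‖ := by positivity
      gcongr)
  refine ⟨R, D, K, Q, hK, fun v => ?_⟩
  set b := a * ((‖ζ‖ ^ 2 + 1) / (4 * k.im)) with hb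
  have hb0 : 0 ≤ b := by positivity
  have hD'n : ‖D'‖ ≤ √b := by
    refine ContinuousLinearMap.opNorm_le_bound _ (by positivity) fun f => ?_
    refine (sq_le_sq₀ (norm_nonneg _) (by positivity)).1 ((hD2 f).trans_eq ?_)
    rw [mul_pow, Real.sq_sqrt hb0, hb, ha]
    simp only [norm_neg, RCLike.norm_conj, Complex.neg_im, Complex.conj_im, neg_neg]
    ring
  have hKv : ‖K v‖ ≤ √b * ‖v‖ := K.le_of_opNorm_le (hn ▸ hD'n) v
  have := pow_le_pow_left₀ (norm_nonneg _) hKv 2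
  rwa [mul_pow, Real.sq_sqrt hb0] at this

theorem isSqrtWeight_matAbsSqrt {V : ℝ → Mat} (hi : ∀ i j, Integrable (fun x => V x i j) volume)
    (hV : ∀ᵐ x, (V x).PosSemidef) : IsSqrtWeight (fun x => matAbsSqrt (Complex.I • V x)) V where
  aestronglyMeasurable i j := by
    have hm : ∀ i j, AEMeasurable (fun x => V x i j) volume := fun i j => (hi i j).aemeasurable
    have hdet : AEMeasurable (fun x => √(V x).det.re) volume := by
      simp only [Matrix.det_fin_two]
      exact (Complex.measurable_re.comp_aemeasurable
        (((hm 0 0).mul (hm 1 1)).sub ((hm 0 1).mul (hm 1 0)))).sqrt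
    have htr : AEMeasurable (fun x => √((V x).trace.re + 2 * √(V x).det.re)) volume := by
      refine AEMeasurable.sqrt (AEMeasurable.add ?_ (hdet.const_mul 2))
      simp only [Matrix.trace_fin_two]
      exact Complex.measurable_re.comp_aemeasurable ((hm 0 0).add (hm 1 1))
    have := ((hm i j).add ((Complex.measurable_ofReal.comp_aemeasurable hdet).mul_const
      ((1 : Mat) i j))).div (Complex.measurable_ofReal.comp_aemeasurable htr)
    refine this.aestronglyMeasurable.congr ?_
    filter_upwards [hV] with x hx
    rw [matAbsSqrt_I_smul hx, cfc_sqrt_apply hx]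
    rfl
  isHermitian := by
    filter_upwards [hV] with x hx
    rw [matAbsSqrt_I_smul hx]
    exact (posSemidef_cfc_sqrt _).1
  mul_self := by
    filter_upwards [hV] with x hx
    rw [matAbsSqrt_I_smul hx, cfc_sqrt_mul_self hx]
  integrable i := hi i i

theorem ae_polarU_mul {V : ℝ → Mat} (hV : ∀ᵐ x, (V x).PosSemidef) :
    ∀ᵐ x, polarU (Complex.I • V x) * matAbsSqrt (Complex.I • V x) =
      Complex.I • matAbsSqrt (Complex.I • V x) := by
  filter_upwards [hV] with x hx
  rw [polarU_mul_matAbsSqrt hx, matAbsSqrt_I_smul hx]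

end Data

/-! ### Weyl sequences -/

section Weyl

/-- The free Dirac operator has plane waves `e^{ikx} e` at every real energy `l` with `|l| ≥ m`. -/
theorem exists_polarization {m l : ℝ} (h : m ^ 2 ≤ l ^ 2) {C : ℝ} (hC : 0 ≤ C) :
    ∃ (k : ℝ) (e : C2), k * e 1 + m * e 0 = l * e 0 ∧ k * e 0 - m * e 1 = l * e 1 ∧ ‖e‖ = C := by
  have hk : (√(l ^ 2 - m ^ 2) : ℂ) ^ 2 = l ^ 2 - m ^ 2 := by
    rw [← Complex.ofReal_pow, Real.sq_sqrt (by linarith)]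
    push_cast
    ring
  suffices ∃ e : C2, e ≠ 0 ∧ (√(l ^ 2 - m ^ 2) : ℝ) * e 1 + m * e 0 = l * e 0 ∧
      (√(l ^ 2 - m ^ 2) : ℝ) * e 0 - m * e 1 = l * e 1 by
    obtain ⟨e, he, h1, h2⟩ := this
    refine ⟨√(l ^ 2 - m ^ 2), ((C / ‖e‖ : ℝ) : ℂ) • e, ?_, ?_, ?_⟩
    · simp only [PiLp.smul_apply, smul_eq_mul]
      linear_combination ((C / ‖e‖ : ℝ) : ℂ) * h1
    · simp only [PiLp.smul_apply, smul_eq_mul]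
      linear_combination ((C / ‖e‖ : ℝ) : ℂ) * h2
    · rw [norm_smul, Complex.norm_real, Real.norm_of_nonneg (by positivity),
        div_mul_cancel₀ _ (norm_ne_zero_iff.2 he)]
  by_cases hlm : l + m = 0
  · have hl : l = -m := by linarith
    refine ⟨!₂[0, 1], fun h0 => ?_, ?_, ?_⟩
    · simpa using congrArg (fun v : C2 => v 1) h0
    · simp [hl]
    · simp [hl]
  · refine ⟨!₂[((l + m : ℝ) : ℂ), ((√(l ^ 2 - m ^ 2) : ℝ) : ℂ)], fun h0 => hlm ?_, ?_, ?_⟩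
    · exact Complex.ofReal_eq_zero.1 (congrArg (fun v : C2 => v 0) h0)
    · simp only [Matrix.cons_val_zero, Matrix.cons_val_one]
      push_cast
      linear_combination hk
    · simp only [Matrix.cons_val_zero, Matrix.cons_val_one]
      push_cast
      ring

/-- The envelope of the wave packets. Its logarithmic derivative is bounded by `δ`. -/
noncomputable def envelope (δ a x : ℝ) : ℝ := (1 + (δ * (x - a)) ^ 2)⁻¹

variable {δ a : ℝ}

theorem envelope_pos (δ a x : ℝ) : 0 < envelope δ a x := by
  rw [envelope]
  positivity

theorem envelope_le_one (δ a x : ℝ) : envelope δ a x ≤ 1 :=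
  inv_le_one_of_one_le₀ (by nlinarith [sq_nonneg (δ * (x - a))])

theorem continuous_envelope (δ a : ℝ) : Continuous (envelope δ a) :=
  Continuous.inv₀ (by fun_prop) fun x => by positivity

theorem hasDerivAt_envelope (δ a x : ℝ) :
    HasDerivAt (envelope δ a) (-(2 * δ * (δ * (x - a))) * envelope δ a x ^ 2) x := by
  have h1 : HasDerivAt (fun x => 1 + (δ * (x - a)) ^ 2) (2 * δ * (δ * (x - a))) x := by
    have := ((((hasDerivAt_id x).sub_const a).const_mul δ).pow 2).const_add 1
    refine this.congr_deriv ?_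
    simp only [id, Nat.cast_ofNat, Nat.add_one_sub_one, pow_one]
    ring
  refine (h1.inv (by positivity)).congr_deriv ?_
  rw [envelope]
  field_simp

theorem abs_deriv_envelope_le (hδ : 0 ≤ δ) (a x : ℝ) :
    |-(2 * δ * (δ * (x - a))) * envelope δ a x ^ 2| ≤ δ * envelope δ a x := by
  have h := envelope_pos δ a x
  have h1 : |2 * (δ * (x - a))| * envelope δ a x ≤ 1 := by
    rw [envelope, ← div_eq_mul_inv, div_le_one (by positivity), abs_le]
    constructor <;> nlinarith [sq_nonneg (δ * (x - a) + 1), sq_nonneg (δ * (x - a) - 1)]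
  have e : -(2 * δ * (δ * (x - a))) * envelope δ a x ^ 2 =
      -(δ * envelope δ a x * (2 * (δ * (x - a)) * envelope δ a x)) := by ring
  rw [e, abs_neg, abs_mul, abs_of_nonneg (by positivity : 0 ≤ δ * envelope δ a x), abs_mul _
    (envelope δ a x), abs_of_pos h]
  exact mul_le_of_le_one_right (by positivity) h1

theorem integrable_envelope_sq (hδ : 0 < δ) (a : ℝ) :
    Integrable (fun x => envelope δ a x ^ 2) volume := by
  have h1 : Integrable (envelope δ a) volume :=
    (integrable_inv_one_add_sq.comp_mul_left' hδ.ne').comp_sub_right a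
  refine h1.mono' ((continuous_envelope δ a).pow 2).aestronglyMeasurable (.of_forall fun x => ?_)
  have := envelope_pos δ a x
  rw [Real.norm_of_nonneg (by positivity), sq]
  exact mul_le_of_le_one_right this.le (envelope_le_one δ a x)

theorem integral_envelope_sq_pos (hδ : 0 < δ) (a : ℝ) : 0 < ∫ x, envelope δ a x ^ 2 := by
  rw [integral_pos_iff_support_of_nonneg (fun x => sq_nonneg _) (integrable_envelope_sq hδ a)]
  have : Function.support (fun x => envelope δ a x ^ 2) = Set.univ := by
    ext x
    simp [(envelope_pos δ a x).ne']
  simp [this]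

theorem integral_envelope_sq (δ a : ℝ) :
    ∫ x, envelope δ a x ^ 2 = ∫ x, envelope δ 0 x ^ 2 := by
  rw [← integral_sub_right_eq_self (fun x => envelope δ 0 x ^ 2) a]
  simp [envelope]

/-- Normalized wave packets at energy `l`: their shape is independent of the centre `a`. -/
theorem exists_packet {m l : ℝ} (h : m ^ 2 ≤ l ^ 2) (hδ : 0 < δ) : ∃ C : ℝ, ∀ a, ∃ f g : L2,
    (f, g) ∈ (freeDirac m).graph ∧ ‖f‖ = 1 ∧ ‖g - (l : ℂ) • f‖ ≤ δ ∧
      ∀ᵐ x, ‖f x‖ = C * envelope δ a x := by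
  set C : ℝ := (√(∫ x, envelope δ 0 x ^ 2))⁻¹ with hC
  obtain ⟨k, e, he0, he1, hen⟩ := exists_polarization h (C := C) (by positivity)
  refine ⟨C, fun a => ?_⟩
  set ρ := envelope δ a with hρ
  set ρ' : ℝ → ℝ := fun x => -(2 * δ * (δ * (x - a))) * envelope δ a x ^ 2 with hρ'
  set w : ℝ → ℂ := fun x => Complex.exp (Complex.I * k * x) with hw
  have hwn : ∀ x, ‖w x‖ = 1 := fun x => by
    have : Complex.I * k * x = ((k * x : ℝ) : ℂ) * Complex.I := by
      push_cast
      ring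
    rw [hw]
    simp only [this, Complex.norm_exp_ofReal_mul_I]
  have hρc : Continuous ρ := continuous_envelope δ a
  have hρ'c : Continuous ρ' := (by fun_prop : Continuous fun x : ℝ => -(2 * δ * (δ * (x - a)))).mul
    ((continuous_envelope δ a).pow 2)
  have hwc : Continuous w := by fun_prop
  have hfc : Continuous fun x => ((ρ x : ℂ) * w x) • e := by fun_prop
  have hrc : Continuous fun x => (-Complex.I * ((ρ' x : ℂ) * w x)) • act sigma1 e := by fun_prop
  have hfn : ∀ x, ‖((ρ x : ℂ) * w x) • e‖ = C * ρ x := fun x => by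
    rw [norm_smul, norm_mul, hwn, Complex.norm_real, Real.norm_of_nonneg (envelope_pos δ a x).le,
      hen]
    ring
  have hs1 : ‖act sigma1 e‖ = ‖e‖ := by
    rw [← sq_eq_sq₀ (norm_nonneg _) (norm_nonneg _), norm_sq_C2, norm_sq_C2]
    simp [act_apply, sigma1, add_comm]
  have hrn : ∀ x, ‖(-Complex.I * ((ρ' x : ℂ) * w x)) • act sigma1 e‖ ≤
      δ * ‖((ρ x : ℂ) * w x) • e‖ := fun x => by
    rw [hfn, norm_smul, norm_mul, norm_mul, hwn, Complex.norm_real, norm_neg, Complex.norm_I, hs1,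
      hen, Real.norm_eq_abs]
    have h1 : |ρ' x| ≤ δ * ρ x := abs_deriv_envelope_le hδ.le a x
    have hC0 : 0 ≤ C := by positivity
    nlinarith
  have hfm : MemLp (fun x => ((ρ x : ℂ) * w x) • e) 2 volume := by
    rw [memLp_two_iff_integrable_sq_norm hfc.aestronglyMeasurable]
    simp only [hfn, mul_pow]
    exact (integrable_envelope_sq hδ a).const_mul _
  have hrm : MemLp (fun x => (-Complex.I * ((ρ' x : ℂ) * w x)) • act sigma1 e) 2 volume :=
    (hfm.norm.const_mul δ).of_le hrc.aestronglyMeasurable (.of_forall fun x => by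
      refine (hrn x).trans (le_of_eq ?_)
      rw [Real.norm_of_nonneg (by positivity)])
  have hwd : ∀ x, HasDerivAt w (w x * (Complex.I * k)) x := fun x => by
    have h1 : HasDerivAt (fun x : ℝ => Complex.I * k * (x : ℂ)) (Complex.I * k) x := by
      simpa using (Complex.ofRealCLM.hasDerivAt (x := x)).const_mul (Complex.I * k)
    exact h1.cexp
  have hd : ∀ (i : Fin 2) (x : ℝ), HasDerivAt (fun x => (ρ x : ℂ) * w x * e i)
      (((ρ' x : ℂ) * w x + ρ x * (w x * (Complex.I * k))) * e i) x := fun i x =>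
    (((hasDerivAt_envelope δ a x).ofReal_comp).mul (hwd x)).mul_const (e i)
  have hp : ∀ i, IsPrimitive (fun x => (ρ x : ℂ) * w x * e i)
      (fun x => ((ρ' x : ℂ) * w x + ρ x * (w x * (Complex.I * k))) * e i) := fun i =>
    IsPrimitive.of_hasDerivAt (hd i) (by fun_prop)
  set f : L2 := hfm.toLp _ with hf
  set r : L2 := hrm.toLp _ with hr
  have hfx : ∀ᵐ x, f x = ((ρ x : ℂ) * w x) • e := hfm.coeFn_toLp
  have hrx : ∀ᵐ x, r x = (-Complex.I * ((ρ' x : ℂ) * w x)) • act sigma1 e := hrm.coeFn_toLp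
  have hgx : ∀ᵐ x, ((l : ℂ) • f + r : L2) x = (l : ℂ) • f x + r x := by
    filter_upwards [Lp.coeFn_add ((l : ℂ) • f) r, Lp.coeFn_smul (l : ℂ) f] with x h1 h2
    rw [h1, Pi.add_apply, h2, Pi.smul_apply]
  have hf1 : ‖f‖ = 1 := by
    rw [← sq_eq_sq₀ (norm_nonneg _) zero_le_one, norm_sq_L2, one_pow]
    have : ∫ x, ‖f x‖ ^ 2 = ∫ x, C ^ 2 * ρ x ^ 2 := by
      refine integral_congr_ae ?_
      filter_upwards [hfx] with x hx
      rw [hx, hfn, mul_pow]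
    have hpos := integral_envelope_sq_pos hδ 0
    rw [this, integral_const_mul, hρ, integral_envelope_sq, hC, inv_pow, Real.sq_sqrt hpos.le,
      inv_mul_cancel₀ hpos.ne']
  refine ⟨f, (l : ℂ) • f + r, mem_graph_freeDirac.2 ⟨_, _, ?_, ?_, (hp 0).congr_ae ?_,
    (hp 1).congr_ae ?_⟩, hf1, ?_, ?_⟩
  · filter_upwards [hfx] with x hx
    simp [hx]
  · filter_upwards [hfx] with x hx
    simp [hx]
  · filter_upwards [hfx, hrx, hgx] with x h1 h2 h3
    rw [h3, h1, h2]
    simp only [PiLp.add_apply, PiLp.smul_apply, smul_eq_mul, act_apply, sigma1]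
    simp
    linear_combination ((ρ' x : ℂ) * w x * e 0) * Complex.I_sq +
      Complex.I * ρ x * w x * he1
  · filter_upwards [hfx, hrx, hgx] with x h1 h2 h3
    rw [h3, h1, h2]
    simp only [PiLp.add_apply, PiLp.smul_apply, smul_eq_mul, act_apply, sigma1]
    simp
    linear_combination ((ρ' x : ℂ) * w x * e 1) * Complex.I_sq +
      Complex.I * ρ x * w x * he0
  · rw [add_sub_cancel_left]
    rw [← mul_one δ, ← hf1]
    refine Lp.norm_le_mul_norm_of_ae_le_mul ?_
    filter_upwards [hfx, hrx] with x h1 h2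
    rw [h1, h2]
    exact hrn x
  · filter_upwards [hfx] with x hx
    rw [hx, hfn]

/-- Moving the packets to infinity makes them insensitive to the perturbation. -/
theorem exists_weyl_sequence {m l : ℝ} (h : m ^ 2 ≤ l ^ 2) {M W : ℝ → Mat}
    (hM : IsSqrtWeight M W) {ε : ℝ} (hε : 0 < ε) : ∃ f g u, (f, g) ∈ (freeDirac m).graph ∧
      (f, u) ∈ (mulOp M).graph ∧ ‖f‖ = 1 ∧ ‖g - (l : ℂ) • f‖ ≤ ε ∧ ‖u‖ ≤ ε := by
  obtain ⟨C, hC⟩ := exists_packet h hε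
  obtain ⟨hwi, -⟩ := hM.integrable_weight 1
  simp only [div_one] at hwi
  set v : ℝ → ℝ → ℝ := fun a x => (‖W x 0 0‖ + ‖W x 1 1‖) * (C * envelope ε a x) ^ 2 with hv
  have hvm : ∀ a, AEStronglyMeasurable (v a) volume := fun a =>
    hwi.1.mul (by have := continuous_envelope ε a; fun_prop)
  have hvb : ∀ a x, ‖v a x‖ ≤ (‖W x 0 0‖ + ‖W x 1 1‖) * C ^ 2 := fun a x => by
    have h0 := (envelope_pos ε a x).le
    rw [Real.norm_of_nonneg (by positivity)]
    simp only [hv, mul_pow]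
    gcongr
    exact mul_le_of_le_one_right (sq_nonneg C) (pow_le_one₀ h0 (envelope_le_one ε a x))
  have hlim : Filter.Tendsto (fun a => ∫ x, v a x) Filter.atTop (nhds (∫ _ : ℝ, (0 : ℝ))) := by
    refine tendsto_integral_filter_of_dominated_convergence _ (.of_forall hvm)
      (.of_forall fun a => .of_forall (hvb a)) (hwi.mul_const _) (.of_forall fun x => ?_)
    have h1 : Filter.Tendsto (fun a => 1 + (ε * (x - a)) ^ 2) Filter.atTop Filter.atTop := by
      refine Filter.tendsto_atTop_add_const_left _ _ ?_
      have h2 : Filter.Tendsto (fun a => ε * (a - x)) Filter.atTop Filter.atTop :=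
        (Filter.tendsto_atTop_add_const_right _ (-x) Filter.tendsto_id).const_mul_atTop hε
      refine ((Filter.tendsto_pow_atTop two_ne_zero).comp h2).congr fun a => ?_
      simp only [Function.comp_apply]
      ring
    have h3 := ((h1.inv_tendsto_atTop.const_mul C).pow 2).const_mul (‖W x 0 0‖ + ‖W x 1 1‖)
    simpa [hv, envelope] using h3
  rw [integral_zero] at hlim
  obtain ⟨a, ha⟩ := (hlim.eventually_le_const (by positivity : 0 < ε ^ 2)).exists
  obtain ⟨f, g, hfg, hf1, hfe, hfx⟩ := hC a
  obtain ⟨u, hu, -⟩ := hM.exists_mem_graph one_pos (f := f) (S := C ^ 2) (by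
    filter_upwards [hfx] with x hx
    rw [one_pow, one_mul, ← norm_sq_C2, hx, mul_pow]
    exact mul_le_of_le_one_right (sq_nonneg C)
      (pow_le_one₀ (envelope_pos ε a x).le (envelope_le_one ε a x)))
  refine ⟨f, g, u, hfg, hu, hf1, hfe, (sq_le_sq₀ (norm_nonneg _) hε.le).1 (le_trans ?_ ha)⟩
  rw [norm_sq_L2]
  refine integral_mono_ae (integrable_norm_sq u)
    ((hwi.mul_const _).mono' (hvm a) (.of_forall (hvb a))) ?_
  filter_upwards [mem_graph_mulOp.1 hu, hM.norm_act_sq_le_trace, hfx] with x h1 h2 h3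
  rw [h1]
  refine (h2 (f x)).trans_eq ?_
  rw [h3]

end Weyl

/-! ### The spectrum of the perturbed operator -/

section Spectrum

variable {m : ℝ} {z k ζ : ℂ} {M N W : ℝ → Mat} {H : L2 →ₗ.[ℂ] L2}

theorem resolventSet_freeDirac (hm : 0 ≤ m) :
    resolventSet (freeDirac m) = {z : ℂ | ¬(z.im = 0 ∧ (z.re ≤ -m ∨ m ≤ z.re))} := by
  ext z
  constructor
  · rintro hz ⟨h0, h1⟩
    have hzr : z = (z.re : ℂ) := Complex.ext rfl h0
    have hsq : m ^ 2 ≤ z.re ^ 2 := by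
      rcases h1 with h1 | h1 <;> nlinarith
    refine mem_spectrum_of_approx (fun ε hε => ?_) hz
    obtain ⟨C, hC⟩ := exists_packet hsq hε
    obtain ⟨f, g, hf, hf1, hg, -⟩ := hC 0
    exact ⟨f, g, hf, hf1, by rwa [hzr]⟩
  · intro hz
    obtain ⟨R, hR, -⟩ := exists_freeResolvent (isSpectralParam_zeta hz)
    exact ⟨R, hR⟩

theorem isSpectralParam_of_mem (hm : 0 ≤ m) (hz : z ∈ resolventSet (freeDirac m)) :
    IsSpectralParam m z (sqrtUpper (z ^ 2 - (m : ℂ) ^ 2)) (zeta m z) := by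
  rw [resolventSet_freeDirac hm] at hz
  exact isSpectralParam_zeta hz

theorem mem_resolventSet_freeDirac_of_im_ne_zero (hm : 0 ≤ m) (hz : z.im ≠ 0) :
    z ∈ resolventSet (freeDirac m) := by
  rw [resolventSet_freeDirac hm]
  exact fun h => hz h.1

theorem existsUnique_isFactorizedPerturbation (hM : IsSqrtWeight M W)
    (hN : ∀ᵐ x, N x = Complex.I • M x) (hm : 0 ≤ m) :
    ∃! H, IsFactorizedPerturbation (freeDirac m) (mulOp M) (mulOp N) H := by
  have hdata : ∀ z ∈ resolventSet (freeDirac m), ∃ R D K Q,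
      ResolventData (freeDirac m) (mulOp M) (mulOp N) z R D K Q := fun z hz => by
    obtain ⟨R, D, K, Q, h, -⟩ := exists_data (isSpectralParam_of_mem hm hz) hM hN
    exact ⟨R, D, K, Q, h⟩
  obtain ⟨H, hH⟩ := exists_isFactorizedPerturbation_of_isSymm (z := -Complex.I)
    (isSymm_freeDirac m) hM.isSymm (exists_mem_graph_of_ae_eq hN) (dense_domain_of_ae_eq hM hN)
    hdata (by simp) (mem_resolventSet_freeDirac_of_im_ne_zero hm (by simp))
  exact ⟨H, hH, fun H' hH' => IsFactorizedPerturbation.eq hdata hH' hH⟩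

/-- In the closed lower half plane the dissipative perturbation does not reach the resolvent set. -/
theorem mem_resolventSet_of_im_nonpos (hM : IsSqrtWeight M W)
    (hN : ∀ᵐ x, N x = Complex.I • M x)
    (hH : IsFactorizedPerturbation (freeDirac m) (mulOp M) (mulOp N) H)
    (h : IsSpectralParam m z k ζ) (hz : z.im ≤ 0) :
    z ∈ resolventSet H := by
  obtain ⟨R, D, K, Q, hd, -⟩ := exists_data h hM hN
  exact (hH.mem_resolventSet_iff hd).1.2 (hd.isUnit_one_add_of_im_nonpos (isSymm_freeDirac m)
    hM.isSymm (exists_mem_graph_of_ae_eq hN) (dense_domain_of_ae_eq hM hN) hz)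

/-- Since `Im z (|ζ|² + 1) = 2 Im k Re ζ`, the bound on `Im z ‖cl(R₀(z) B)‖²` is half of
`Re ζ ‖W₁₁‖₁ + Re ζ⁻¹ ‖W₂₂‖₁`. -/
theorem mem_resolventSet_of_lt (hM : IsSqrtWeight M W)
    (hN : ∀ᵐ x, N x = Complex.I • M x)
    (hH : IsFactorizedPerturbation (freeDirac m) (mulOp M) (mulOp N) H)
    (h : IsSpectralParam m z k ζ)
    (hlt : ζ.re * (∫ x, ‖W x 0 0‖) + (ζ⁻¹).re * (∫ x, ‖W x 1 1‖) < 2) : z ∈ resolventSet H := by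
  rcases le_or_gt z.im 0 with hz | hz
  · exact mem_resolventSet_of_im_nonpos hM hN hH h hz
  obtain ⟨R, D, K, Q, hd, hK⟩ := exists_data h hM hN
  refine (hH.mem_resolventSet_iff hd).1.2 (hd.isUnit_one_add (isSymm_freeDirac m)
    hM.isSymm (exists_mem_graph_of_ae_eq hN) (dense_domain_of_ae_eq hM hN)
    (c := (ζ.re * (∫ x, ‖W x 0 0‖) + (ζ⁻¹).re * (∫ x, ‖W x 1 1‖)) / 2) (by linarith)
    fun v => ?_)
  refine (mul_le_mul_of_nonneg_left (hK v) hz.le).trans_eq ?_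
  rw [← mul_assoc]
  congr 1
  have hk := h.im_pos.ne'
  have hζ : ‖ζ‖ ≠ 0 := norm_ne_zero_iff.2 h.ne_zero
  rw [Complex.inv_re, Complex.normSq_eq_norm_sq]
  have e : z.im * (((∫ x, ‖W x 0 0‖) + (∫ x, ‖W x 1 1‖) / ‖ζ‖ ^ 2) *
      ((‖ζ‖ ^ 2 + 1) / (4 * k.im))) = (z.im * (‖ζ‖ ^ 2 + 1)) *
      (((∫ x, ‖W x 0 0‖) + (∫ x, ‖W x 1 1‖) / ‖ζ‖ ^ 2) / (4 * k.im)) := by ring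
  rw [e, h.im_mul]
  field_simp
  ring

theorem ofReal_mem_spectrum (hM : IsSqrtWeight M W)
    (hN : ∀ᵐ x, N x = Complex.I • M x)
    (hH : IsFactorizedPerturbation (freeDirac m) (mulOp M) (mulOp N) H)
    (hm : 0 ≤ m) {l : ℝ} (hl : m ^ 2 ≤ l ^ 2) : (l : ℂ) ∈ spectrum H :=
  hH.mem_spectrum (isSymm_freeDirac m) hM.isSymm (exists_mem_graph_of_ae_eq hN)
    (fun _ hz => by
      obtain ⟨R, D, K, Q, h, -⟩ := exists_data (isSpectralParam_of_mem hm
        (mem_resolventSet_freeDirac_of_im_ne_zero hm hz.ne)) hM hN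
      exact ⟨R, D, K, Q, h⟩)
    fun _ hε => exists_weyl_sequence hl hM hε

/-- A real point outside `(-m, m)` is a limit of such points, all of which are in the spectrum. -/
theorem discreteSpectrum_subset (hM : IsSqrtWeight M W)
    (hN : ∀ᵐ x, N x = Complex.I • M x)
    (hH : IsFactorizedPerturbation (freeDirac m) (mulOp M) (mulOp N) H)
    (hm : 0 ≤ m) : discreteSpectrum H ⊆ {z : ℂ | 0 < z.im} := by
  rintro z ⟨he, -, r, hr, hiso⟩
  by_contra hz
  have hz' : z.im ≤ 0 := not_lt.1 hz
  by_cases hz₀ : z ∈ resolventSet (freeDirac m)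
  · exact not_isEigenvalue_of_mem_resolventSet (mem_resolventSet_of_im_nonpos hM hN hH
      (isSpectralParam_of_mem hm hz₀) hz') he
  · rw [resolventSet_freeDirac hm, Set.mem_ofPred_eq, not_not] at hz₀
    obtain ⟨h0, h1⟩ := hz₀
    have hzr : z = (z.re : ℂ) := Complex.ext rfl h0
    obtain ⟨t, ht, htr, hsq⟩ : ∃ t : ℝ, t ≠ 0 ∧ |t| < r ∧ m ^ 2 ≤ (z.re + t) ^ 2 := by
      rcases h1 with h1 | h1
      · refine ⟨-(r / 2), by linarith, ?_, by nlinarith⟩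
        rw [abs_neg, abs_of_pos (by linarith)]
        linarith
      · refine ⟨r / 2, by linarith, ?_, by nlinarith⟩
        rw [abs_of_pos (by linarith)]
        linarith
    have hw := hiso _ (ofReal_mem_spectrum hM hN hH hm hsq) (by
      rwa [hzr, Complex.ofReal_re, Complex.dist_eq, ← Complex.ofReal_sub, add_sub_cancel_left,
        Complex.norm_real])
    have := congrArg Complex.re hw
    rw [Complex.ofReal_re] at this
    exact ht (by linarith)

/-- For `m = 0` one has `ζ = 1` in the upper half plane. -/
theorem spectrum_eq_of_massless (hM : IsSqrtWeight M W)
    (hN : ∀ᵐ x, N x = Complex.I • M x)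
    (hH : IsFactorizedPerturbation (freeDirac m) (mulOp M) (mulOp N) H)
    (hm : m = 0) (hlt : (∫ x, ‖W x 0 0‖) + (∫ x, ‖W x 1 1‖) < 2) :
    spectrum H = {z : ℂ | z.im = 0} := by
  subst hm
  ext z
  constructor
  · intro hz
    by_contra h0
    refine hz ?_
    rcases lt_or_gt_of_ne h0 with h0 | h0
    · exact mem_resolventSet_of_im_nonpos hM hN hH (isSpectralParam_of_mem le_rfl
        (mem_resolventSet_freeDirac_of_im_ne_zero le_rfl h0.ne)) h0.le
    · refine mem_resolventSet_of_lt hM hN hH (k := z) (ζ := 1) ⟨h0, one_ne_zero, ?_, ?_⟩ ?_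
      · simp
      · simp
      · simpa using hlt
  · intro hz
    have hzr : z = (z.re : ℂ) := Complex.ext rfl hz
    rw [hzr]
    exact ofReal_mem_spectrum hM hN hH le_rfl (by nlinarith)

end Spectrum

end DiracOp

theorem mainTheorem3 (m : ℝ) (hm : 0 ≤ m) (Vt : ℝ → DiracOp.Mat)
    (hVint : ∀ i j, MeasureTheory.Integrable (fun x => Vt x i j) MeasureTheory.volume)
    (hVpos : ∀ᵐ x ∂(MeasureTheory.volume : MeasureTheory.Measure ℝ), (Vt x).PosSemidef) :
    DiracOp.resolventSet (DiracOp.freeDirac m) = {z : ℂ | ¬(z.im = 0 ∧ (z.re ≤ -m ∨ m ≤ z.re))} ∧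
    (∃! H, DiracOp.IsDiracOperator m (fun x => Complex.I • Vt x) H) ∧
    ∀ H, DiracOp.IsDiracOperator m (fun x => Complex.I • Vt x) H →
      (DiracOp.discreteSpectrum H ⊆ {z : ℂ | 0 < z.im}) ∧
      (∀ z ∈ DiracOp.resolventSet (DiracOp.freeDirac m),
        (DiracOp.zeta m z).re * (∫ x, ‖Vt x 0 0‖) + ((DiracOp.zeta m z)⁻¹).re * (∫ x, ‖Vt x 1 1‖) < 2 →
        z ∉ DiracOp.spectrum H) ∧
      (m = 0 → (∫ x, ‖Vt x 0 0‖) + (∫ x, ‖Vt x 1 1‖) < 2 →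
        DiracOp.spectrum H = {z : ℂ | z.im = 0}) := by
  have hM := DiracOp.isSqrtWeight_matAbsSqrt hVint hVpos
  have hN := DiracOp.ae_polarU_mul hVpos
  refine ⟨DiracOp.resolventSet_freeDirac hm, DiracOp.existsUnique_isFactorizedPerturbation hM hN hm,
    fun H hH => ⟨DiracOp.discreteSpectrum_subset hM hN hH hm, fun z hz hlt hs => hs ?_,
      fun h0 hlt => DiracOp.spectrum_eq_of_massless hM hN hH h0 hlt⟩⟩
  exact DiracOp.mem_resolventSet_of_lt hM hN hH (DiracOp.isSpectralParam_of_mem hm hz) hlt
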